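/- Let $l,b,T>0$, and let $\lambda$ be a function on $[0,l]\times[0,T]$ such that for every $t\in[0,T]$: $\lambda(\cdot,t)\in H^{3,2}((0,l);\mathbb R)$ (identified with its continuous version), $\lambda(0,t)=\lambda(l,t)=\partial_s\lambda(0,t)=\partial_s\lambda(l,t)=0$ and $\lambda(s,t)>0$ for $s\in(0,l)$; moreover $\sup_{t\in[0,T]}\|\lambda(\cdot,t)\|_{H^{3,2}}<\infty$ and $\lambda,\partial_s\lambda$ are measurable on $[0,l]\times[0,T]$. Put $H^{2,2}_{bc}=\{u\in H^{2,2}((0,l);\mathbb R^3): u(l)=\partial_su(l)=0\}$ with inner product $b\int_0^l\langle\partial_s^2u,\partial_s^2v\rangle\,ds$, and $H^{4,2}_{bc}=\{u\in H^{4,2}((0,l);\mathbb R^3): u(l)=\partial_su(l)=0,\ \partial_s^2u(0)=\partial_s^3u(0)=0\}$ with inner product $b^2\int_0^l\langle\partial_s^4u,\partial_s^4v\rangle\,ds$. Let $H=H^{2,2}_{bc}\times L^2((0,l);\mathbb R^3)$ and $\mathcal D=H^{4,2}_{bc}\times H^{2,2}_{bc}\subset H$, each with the sum of the two inner products. On $\mathcal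 D$ define the operators in $H$ $$L_0(u,v)=(v,\,-b\,\partial_s^4u),\qquad L(t)(u,v)=\bigl(v,\ \partial_s(\lambda(\cdot,t)\,\partial_su)-b\,\partial_s^4u\bigr),\quad t\in[0,T],$$ and let $D(L_0^2)=\{w\in\mathcal D: L_0w\in\mathcal D\}$. Let $L^*(t)$ be the adjoint of $(L(t),\mathcal D)$ in $H$. An almost strong evolution system for a family $(L(t))_{0\le t\le T}$ of closed operators in $H$, such that $\bigcap_t D(L(t))$ is dense in $H$, with initial space $Y\subset\bigcap_tD(L(t))$, dense in $H$, is a family $(U(t,\tau))_{0\le\tau\le t\le T}$ of bounded linear operators on $H$ such that (i) $U(t,t)=\mathrm{Id}$ and $U(t,r)U(r,\tau)=U(t,\tau)$ for $\tau\le r\le t$; (ii) $t\mapsto U(t,\tau)u$ and $\tau\mapsto U(t,\tau)u$ are continuous for every $u\in H$, and $\sup_{\tau\le t}\|U(t,\tau)\|<\infty$; (iii) for all $\tau\in[0,T)$ and almost every $t\in[\tau,T]$, $U(t,\tau)Y\subset D(L(t))$, and $\int_\tau^tL(r)U(r,\tau)u\,dr=U(t,\tau)u-u$ for all $u\in Y$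 and $0\le\tau\le t\le T$. For a Hilbert space $O$ and $t\ge0$, $C^1_w([0,t];O)$ is the set of Bochner square integrable $\varrho:[0,t]\to O$ such that $\langle\varrho,w\rangle_O\in H^{1,2}((0,t);\mathbb R)$ for all $w\in O$ and there is a Bochner square integrable $\varrho'_O:[0,t]\to O$ with $\langle\varrho,w\rangle_O'=\langle\varrho'_O,w\rangle_O$ a.e. on $[0,t]$ for all $w\in O$. Then there is an almost strong evolution system $U$ for $(L(t))_{0\le t\le T}$ with initial space $\mathcal D$. For every such $U$, all $u\in D(L_0^2)$ and all $t\in[0,T]$: for all $\tau\in[0,t]$ the vector $\varrho(\tau):=U^*(t,\tau)u$ (Hilbert adjoint in $H$) lies in $\mathcal D\cap D(L^*(\tau))$ with $L^*(\tau)\varrho(\tau)\in\mathcal D$; the map $\varrho:[0,t]\to\mathcal D$ belongs to $C^1_w([0,t];\mathcal D)$; and its derivative $\varrho'_{\mathcal D}$ is (can be chosen as) $\varrho'_{\mathcal D}(\tau)=-L^*(\tau)\varrho(\tau)$ for all $\tau\in[0,t]$. -/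

import Mathlib

open MeasureTheory Set
open scoped ENNReal NNReal ContDiff InnerProductSpace

noncomputable section
namespace Beam

section Weak
variable {E : Type*} [NormedAddCommGroup E]

/-- Lebesgue measure on the interval `(0, l)`. -/
abbrev vol (l : ℝ) : Measure ℝ := volume.restrict (Ioo 0 l)

theorem integrable_of_memLp_two {l : ℝ} {u : ℝ → E} (hu : MemLp u 2 (vol l)) :
    Integrable u (vol l) := hu.integrable (by norm_num)

variable [NormedSpace ℝ E]

/-- `φ ∈ C_c^∞((0, l); ℝ)`. -/
structure IsTest (l : ℝ) (φ : ℝ → ℝ) : Prop where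
  smooth : ContDiff ℝ ∞ φ
  compact : HasCompactSupport φ
  supp : tsupport φ ⊆ Ioo 0 l

/-- `v` is the `k`-th weak derivative of `u` on `(0, l)`:
`∫ φ^(k) u = (-1)^k ∫ φ v` for all test functions `φ`. (Only used for square integrable or
continuous functions, so that the integrals converge.) -/
def IsWeakDeriv (l : ℝ) (k : ℕ) (u v : ℝ → E) : Prop :=
  ∀ φ : ℝ → ℝ, IsTest l φ →
    ∫ s, iteratedDeriv k φ s • u s ∂(vol l) = (-1 : ℝ) ^ k • ∫ s, φ s • v s ∂(vol l)

theorem IsTest.iterDeriv {l : ℝ} {φ : ℝ → ℝ} (h : IsTest l φ) (k : ℕ) :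
    IsTest l (iteratedDeriv k φ) := by
  induction k with
  | zero => simpa using h
  | succ k ih =>
    rw [iteratedDeriv_succ]
    exact ⟨(contDiff_infty_iff_deriv.1 ih.smooth).2, ih.compact.deriv,
      (tsupport_deriv_subset).trans ih.supp⟩

theorem IsTest.bdd {l : ℝ} {φ : ℝ → ℝ} (h : IsTest l φ) : ∃ C, ∀ x, ‖φ x‖ ≤ C :=
  h.compact.exists_bound_of_continuous h.smooth.continuous

theorem IsTest.integrable_smul {l : ℝ} {φ : ℝ → ℝ} (h : IsTest l φ) {u : ℝ → E}
    (hu : Integrable u (vol l)) : Integrable (fun s => φ s • u s) (vol l) := by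
  obtain ⟨C, hC⟩ := h.bdd
  exact hu.bdd_smul C h.smooth.continuous.aestronglyMeasurable (ae_of_all _ hC)

theorem IsWeakDeriv.congr {l : ℝ} {k : ℕ} {u v u₁ v₁ : ℝ → E} (h : IsWeakDeriv l k u v)
    (hu : u =ᵐ[vol l] u₁) (hv : v =ᵐ[vol l] v₁) : IsWeakDeriv l k u₁ v₁ := by
  intro φ hφ
  have e1 : (fun s => iteratedDeriv k φ s • u s) =ᵐ[vol l] fun s => iteratedDeriv k φ s • u₁ s :=
    hu.mono fun s hs => by simp only [hs]
  have e2 : (fun s => φ s • v s) =ᵐ[vol l] fun s => φ s • v₁ s :=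
    hv.mono fun s hs => by simp only [hs]
  rw [← integral_congr_ae e1, ← integral_congr_ae e2]
  exact h φ hφ

theorem IsWeakDeriv.add {l : ℝ} {k : ℕ} {u v u₁ v₁ : ℝ → E} (h : IsWeakDeriv l k u v)
    (h₁ : IsWeakDeriv l k u₁ v₁) (hu : Integrable u (vol l)) (hv : Integrable v (vol l))
    (hu₁ : Integrable u₁ (vol l)) (hv₁ : Integrable v₁ (vol l)) :
    IsWeakDeriv l k (u + u₁) (v + v₁) := by
  intro φ hφ
  simp only [Pi.add_apply, smul_add]
  rw [integral_add ((hφ.iterDeriv k).integrable_smul hu) ((hφ.iterDeriv k).integrable_smul hu₁),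
    integral_add (hφ.integrable_smul hv) (hφ.integrable_smul hv₁), h φ hφ, h₁ φ hφ, smul_add]

theorem IsWeakDeriv.const_smul {l : ℝ} {k : ℕ} {u v : ℝ → E} (h : IsWeakDeriv l k u v) (c : ℝ) :
    IsWeakDeriv l k (c • u) (c • v) := by
  intro φ hφ
  simp only [Pi.smul_apply, smul_comm _ c, integral_smul]
  rw [h φ hφ, smul_comm]

theorem isWeakDeriv_zero_right {l : ℝ} {k : ℕ} : IsWeakDeriv l k (0 : ℝ → E) 0 := by
  intro φ hφ; simp

theorem IsWeakDeriv.sub_index {l : ℝ} {j k : ℕ} {u v w : ℝ → E} (h : IsWeakDeriv l j u w)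
    (h₁ : IsWeakDeriv l (k + j) u v) : IsWeakDeriv l k w v := by
  intro φ hφ
  have a := h _ (hφ.iterDeriv k)
  have b := h₁ φ hφ
  rw [show iteratedDeriv j (iteratedDeriv k φ) = iteratedDeriv (k + j) φ by
    simp only [iteratedDeriv_eq_iterate, ← Function.iterate_add_apply, add_comm]] at a
  rw [b, pow_add, mul_comm, mul_smul] at a
  exact (smul_right_injective E (pow_ne_zero j (by norm_num : (-1 : ℝ) ≠ 0)) a).symm

theorem IsWeakDeriv.comp {l : ℝ} {j k : ℕ} {u v w : ℝ → E} (h : IsWeakDeriv l j u w)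
    (h₁ : IsWeakDeriv l k w v) : IsWeakDeriv l (k + j) u v := by
  intro φ hφ
  have a := h _ (hφ.iterDeriv k)
  rw [show iteratedDeriv j (iteratedDeriv k φ) = iteratedDeriv (k + j) φ by
    simp only [iteratedDeriv_eq_iterate, ← Function.iterate_add_apply, add_comm]] at a
  rw [a, h₁ φ hφ, pow_add, mul_comm, mul_smul]

variable [CompleteSpace E]

theorem IsWeakDeriv.unique {l : ℝ} {k : ℕ} {u v w : ℝ → E} (h : IsWeakDeriv l k u v)
    (h₁ : IsWeakDeriv l k u w) (hv : Integrable v (vol l)) (hw : Integrable w (vol l)) :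
    v =ᵐ[vol l] w := by
  have := isOpen_Ioo.ae_eq_zero_of_integral_contDiff_smul_eq_zero (U := Ioo 0 l)
    (f := v - w) (μ := volume)
    (IntegrableOn.locallyIntegrableOn (hv.sub hw)) (by
      intro φ h1 h2 h3
      have hφ : IsTest l φ := ⟨h1, h2, h3⟩
      have e : ∫ s, φ s • (v - w) s = ∫ s, φ s • (v - w) s ∂(vol l) := by
        refine (setIntegral_eq_integral_of_forall_compl_eq_zero ?_).symm
        intro s hs
        rw [image_eq_zero_of_notMem_tsupport (fun hh => hs (h3 hh)), zero_smul]
      rw [e]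
      simp only [Pi.sub_apply, smul_sub]
      rw [integral_sub (hφ.integrable_smul hv) (hφ.integrable_smul hw), sub_eq_zero]
      have := (h φ hφ).symm.trans (h₁ φ hφ)
      exact smul_right_injective E (pow_ne_zero k (by norm_num : (-1 : ℝ) ≠ 0)) this)
  refine (ae_restrict_iff' measurableSet_Ioo).2 (this.mono fun s hs hm => ?_)
  exact sub_eq_zero.1 (hs hm)

theorem integral_test {l : ℝ} {φ : ℝ → ℝ} (hφ : IsTest l φ) :
    ∫ s, φ s ∂(vol l) = ∫ s, φ s :=
  setIntegral_eq_integral_of_forall_compl_eq_zero fun _ hs =>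
    image_eq_zero_of_notMem_tsupport (fun hh => hs (hφ.supp hh))

/-- A test function with mean zero is the derivative of a test function. -/
theorem IsTest.primitive {l : ℝ} (hl : 0 < l) {ψ : ℝ → ℝ} (hψ : IsTest l ψ)
    (h0 : ∫ s, ψ s ∂(vol l) = 0) : ∃ Ψ, IsTest l Ψ ∧ deriv Ψ = ψ := by
  have hc := hψ.smooth.continuous
  have hd : ∀ s, HasDerivAt (fun s => ∫ r in (0 : ℝ)..s, ψ r) (ψ s) s := fun s =>
    intervalIntegral.integral_hasDerivAt_right (hc.intervalIntegrable _ _)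
      hc.stronglyMeasurable.stronglyMeasurableAtFilter hc.continuousAt
  have hdd : deriv (fun s => ∫ r in (0 : ℝ)..s, ψ r) = ψ := funext fun s => (hd s).deriv
  -- the support lies in a compact subinterval
  obtain ⟨a, b, ha, hb, hab, hsub⟩ : ∃ a b, 0 < a ∧ b < l ∧ a ≤ b ∧ tsupport ψ ⊆ Icc a b := by
    by_cases hne : (tsupport ψ).Nonempty
    · obtain ⟨a, ham, ha⟩ := hψ.compact.isCompact.exists_isLeast hne
      obtain ⟨b, hbm, hb⟩ := hψ.compact.isCompact.exists_isGreatest hne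
      exact ⟨a, b, (hψ.supp ham).1, (hψ.supp hbm).2, ha hbm, fun x hx => ⟨ha hx, hb hx⟩⟩
    · rw [not_nonempty_iff_eq_empty] at hne
      exact ⟨l / 2, l / 2, by linarith, by linarith, le_rfl, by simp [hne]⟩
  have hz : ∀ r, r ∉ Icc a b → ψ r = 0 := fun r hr =>
    image_eq_zero_of_notMem_tsupport (fun hh => hr (hsub hh))
  have hint : ∫ s in (0 : ℝ)..l, ψ s = 0 := by
    rw [intervalIntegral.integral_of_le hl.le, integral_Ioc_eq_integral_Ioo]; exact h0
  have hs : tsupport (fun s => ∫ r in (0 : ℝ)..s, ψ r) ⊆ Icc a b := by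
    refine closure_minimal ?_ isClosed_Icc
    intro s hs
    by_contra hn
    refine hs ?_
    show ∫ r in (0 : ℝ)..s, ψ r = 0
    rw [mem_Icc, not_and_or, not_le, not_le] at hn
    rcases hn with hn | hn
    · rw [intervalIntegral.integral_congr (g := fun _ => (0 : ℝ)), intervalIntegral.integral_zero]
      intro r hr
      refine hz r fun hh => ?_
      have := hr.2
      have h2 : max 0 s < a := max_lt ha hn
      exact absurd (hh.1.trans this) (not_le.2 h2)
    · rw [← intervalIntegral.integral_add_adjacent_intervals (hc.intervalIntegrable 0 l)
        (hc.intervalIntegrable l s), hint, zero_add,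
        intervalIntegral.integral_congr (g := fun _ => (0 : ℝ)), intervalIntegral.integral_zero]
      intro r hr
      refine hz r fun hh => ?_
      have := hr.1
      have h2 : b < min l s := lt_min hb hn
      exact absurd (this.trans hh.2) (not_le.2 h2)
  refine ⟨_, ⟨?_, ?_, hs.trans fun x hx => ⟨ha.trans_le hx.1, hx.2.trans_lt hb⟩⟩, hdd⟩
  · refine contDiff_infty_iff_deriv.2 ⟨fun s => (hd s).differentiableAt, ?_⟩
    rw [hdd]; exact hψ.smooth
  · exact isCompact_Icc.of_isClosed_subset (isClosed_tsupport _) hs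

theorem exists_test {l : ℝ} (hl : 0 < l) : ∃ θ, IsTest l θ ∧ ∫ s, θ s ∂(vol l) = 1 := by
  let f : ContDiffBump (l / 2) := ⟨l / 8, l / 4, by linarith, by linarith⟩
  have ht : IsTest l (f.normed volume) := by
    refine ⟨f.contDiff_normed, f.hasCompactSupport_normed, ?_⟩
    rw [f.tsupport_normed_eq, Real.closedBall_eq_Icc]
    intro x hx
    have h1 := hx.1
    have h2 := hx.2
    change l / 2 - l / 4 ≤ x at h1
    change x ≤ l / 2 + l / 4 at h2
    exact ⟨by linarith, by linarith⟩
  exact ⟨_, ht, by rw [integral_test ht, f.integral_normed]⟩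

/-- A continuous function with vanishing weak derivative and a zero in `[0, l]` vanishes. -/
theorem IsWeakDeriv.eq_zero {l : ℝ} (hl : 0 < l) {g v : ℝ → E} (hg : ContinuousOn g (Icc 0 l))
    (h : IsWeakDeriv l 1 g v) (hv : v =ᵐ[vol l] 0) {a : ℝ} (ha : a ∈ Icc 0 l) (h0 : g a = 0) :
    ∀ s ∈ Icc 0 l, g s = 0 := by
  obtain ⟨θ, hθ, hθ1⟩ := exists_test hl
  have hgi : Integrable g (vol l) :=
    (hg.integrableOn_Icc).mono_set Ioo_subset_Icc_self
  set c : E := ∫ s, θ s • g s ∂(vol l) with hc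
  have hcst : IsWeakDeriv l 0 g (fun _ => c) := by
    intro φ hφ
    have hi : ∀ {η : ℝ → ℝ}, IsTest l η → Integrable η (vol l) := fun hη =>
      (hη.smooth.continuous.integrable_of_hasCompactSupport hη.compact).restrict
    set m := ∫ s, φ s ∂(vol l) with hm
    have hψ : IsTest l (fun s => φ s - m * θ s) := by
      have e : tsupport (fun s => φ s - m * θ s) ⊆ tsupport φ ∪ tsupport θ := by
        refine closure_minimal ?_ ((isClosed_tsupport _).union (isClosed_tsupport _))
        intro s hs
        by_contra hn
        rw [mem_union, not_or] at hn
        refine hs ?_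
        simp [image_eq_zero_of_notMem_tsupport hn.1, image_eq_zero_of_notMem_tsupport hn.2]
      exact ⟨hφ.smooth.sub (contDiff_const.mul hθ.smooth),
        (hφ.compact.isCompact.union hθ.compact.isCompact).of_isClosed_subset
          (isClosed_tsupport _) e, e.trans (union_subset hφ.supp hθ.supp)⟩
    have hψ0 : ∫ s, (φ s - m * θ s) ∂(vol l) = 0 := by
      rw [integral_sub (hi hφ) ((hi hθ).const_mul m), integral_const_mul, hθ1, mul_one, sub_self]
    obtain ⟨Ψ, hΨ, hΨd⟩ := hψ.primitive hl hψ0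
    have := h Ψ hΨ
    have e0 : (fun s => Ψ s • v s) =ᵐ[vol l] fun _ => (0 : E) :=
      hv.mono fun s hs => by simp [hs]
    rw [iteratedDeriv_one, hΨd, integral_congr_ae e0, integral_zero, smul_zero] at this
    simp only [sub_smul, mul_smul] at this
    rw [integral_sub (hφ.integrable_smul hgi)
      (show Integrable (fun s => m • θ s • g s) (vol l) from (hθ.integrable_smul hgi).smul m),
      integral_smul, sub_eq_zero, ← hc] at this
    simp only [iteratedDeriv_zero, pow_zero, one_smul]
    rw [this, integral_smul_const]
  have hself : IsWeakDeriv l 0 g g := by intro φ hφ; simp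
  have hae : g =ᵐ[vol l] fun _ => c :=
    hself.unique hcst hgi (integrable_const c)
  have hEq : EqOn g (fun _ => c) (Icc 0 l) := by
    rw [← closure_Ioo hl.ne] at hg ⊢
    have h1 : EqOn g (fun _ => c) (Ioo 0 l) :=
      Measure.eqOn_open_of_ae_eq hae isOpen_Ioo (hg.mono subset_closure) continuousOn_const
    exact h1.of_subset_closure hg continuousOn_const subset_closure le_rfl
  intro s hs
  rw [hEq hs, ← h0, hEq ha]

/-- `s ↦ ∫_s^l f` has the weak derivative `-f`. -/
theorem isWeakDeriv_primitive {l : ℝ} {f : ℝ → E} (hf : Integrable f (vol l)) :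
    IsWeakDeriv l 1 (fun s => ∫ r in Ioo s l, f r ∂(vol l)) (-f) := by
  intro φ hφ
  have hd := (hφ.iterDeriv 1)
  rw [iteratedDeriv_one] at hd
  have hdi : Integrable (deriv φ) (vol l) :=
    (hd.smooth.continuous.integrable_of_hasCompactSupport hd.compact).restrict
  let K : ℝ → ℝ → E := fun s r => (Ioi s).indicator (fun r => deriv φ s • f r) r
  have hK : Integrable (Function.uncurry K) ((vol l).prod (vol l)) := by
    have : Function.uncurry K = {p : ℝ × ℝ | p.1 < p.2}.indicator
        (fun p => deriv φ p.1 • f p.2) := by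
      ext p
      by_cases hp : p.1 < p.2 <;> simp [K, Function.uncurry, indicator, hp]
    rw [this]
    exact (hdi.smul_prod hf).indicator (measurableSet_lt measurable_fst measurable_snd)
  have e1 : ∫ s, iteratedDeriv 1 φ s • ∫ r in Ioo s l, f r ∂(vol l) ∂(vol l)
      = ∫ s, ∫ r, K s r ∂(vol l) ∂(vol l) := by
    refine integral_congr_ae (ae_of_all _ fun s => ?_)
    simp only [K, iteratedDeriv_one]
    rw [integral_indicator measurableSet_Ioi, ← integral_smul]
    rw [Measure.restrict_restrict measurableSet_Ioo, Measure.restrict_restrict measurableSet_Ioi]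
    congr 2
    ext x
    simp only [mem_inter_iff, mem_Ioo, mem_Ioi]
    tauto
  rw [e1, integral_integral_swap hK, pow_one, neg_smul, one_smul, ← integral_neg]
  refine setIntegral_congr_fun measurableSet_Ioo fun r hr => ?_
  simp only [K]
  have e2 : ∀ s, (Ioi s).indicator (fun r => deriv φ s • f r) r
      = (Iio r).indicator (fun s => deriv φ s) s • f r := by
    intro s
    by_cases h : s < r <;> simp [indicator, h]
  simp only [e2]
  rw [integral_smul_const, integral_indicator measurableSet_Iio,
    Measure.restrict_restrict measurableSet_Iio]
  have e3 : Iio r ∩ Ioo 0 l = Ioo 0 r := by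
    ext x
    simp only [mem_inter_iff, mem_Ioo, mem_Iio]
    exact ⟨fun h => ⟨h.2.1, h.1⟩, fun h => ⟨h.2, h.1, h.2.trans hr.2⟩⟩
  rw [e3, ← integral_Ioc_eq_integral_Ioo, ← intervalIntegral.integral_of_le hr.1.le,
    intervalIntegral.integral_deriv_eq_sub'  _ rfl
      (fun x _ => (hφ.smooth.differentiable (by simp)).differentiableAt)
      hd.smooth.continuous.continuousOn,
    image_eq_zero_of_notMem_tsupport (x := (0:ℝ)) (fun hh => lt_irrefl _ (hφ.supp hh).1)]
  simp

end Weak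

section Spaces

/-- The Euclidean space `ℝ³`. -/
abbrev R3 : Type := EuclideanSpace ℝ (Fin 3)

/-- `L²((0, l); ℝ³)`. -/
abbrev L2 (l : ℝ) : Type := Lp R3 2 (vol l)

/-- `u ∈ H^{m,2}((0, l); E)`: `u` is square integrable and so are its weak derivatives up to
order `m`. -/
def MemSobolev {E : Type*} [NormedAddCommGroup E] [NormedSpace ℝ E] (l : ℝ) (m : ℕ)
    (u : ℝ → E) : Prop :=
  MemLp u 2 (vol l) ∧ ∀ k ≤ m, ∃ v : ℝ → E, MemLp v 2 (vol l) ∧ IsWeakDeriv l k u v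

/-- `‖u‖_{H^{m,2}((0, l); E)} ≤ C` with the norm `(∑_{k ≤ m} ∫ |∂^k u|²)^{1/2}`. -/
def SobolevNormLE {E : Type*} [NormedAddCommGroup E] [NormedSpace ℝ E] (l : ℝ) (m : ℕ)
    (u : ℝ → E) (C : ℝ) : Prop :=
  ∃ v : ℕ → ℝ → E, (∀ k ≤ m, MemLp (v k) 2 (vol l) ∧ IsWeakDeriv l k u (v k)) ∧
    ∑ k ∈ Finset.range (m + 1), ∫ s, ‖v k s‖ ^ 2 ∂(vol l) ≤ C ^ 2

/-- Boundary condition `∂^k u(a) = 0`, `a ∈ {0, l}`: the `k`-th weak derivative of `u` has a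
continuous version on `[0, l]`, and this version vanishes at `a`. -/
def BdryZero (l a : ℝ) (k : ℕ) (u : ℝ → R3) : Prop :=
  ∃ g : ℝ → R3, ContinuousOn g (Icc 0 l) ∧ IsWeakDeriv l k u g ∧ g a = 0

theorem integrable_of_continuousOn {E : Type*} [NormedAddCommGroup E] {l : ℝ} {g : ℝ → E}
    (hg : ContinuousOn g (Icc 0 l)) : Integrable g (vol l) :=
  hg.integrableOn_Icc.mono_set Ioo_subset_Icc_self

theorem integrable_coe {l : ℝ} (u : L2 l) : Integrable u (vol l) :=
  integrable_of_memLp_two (Lp.memLp u)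

theorem BdryZero.add {l a : ℝ} {k : ℕ} {u v : L2 l} (hu : BdryZero l a k u)
    (hv : BdryZero l a k v) : BdryZero l a k (u + v : L2 l) := by
  obtain ⟨g, hg, hw, h0⟩ := hu
  obtain ⟨g', hg', hw', h0'⟩ := hv
  refine ⟨g + g', hg.add hg', ?_, by simp [h0, h0']⟩
  exact (hw.add hw' (integrable_coe u) (integrable_of_continuousOn hg) (integrable_coe v)
    (integrable_of_continuousOn hg')).congr (Lp.coeFn_add u v).symm .rfl

theorem BdryZero.smul {l a : ℝ} {k : ℕ} {u : L2 l} (c : ℝ) (hu : BdryZero l a k u) :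
    BdryZero l a k (c • u : L2 l) := by
  obtain ⟨g, hg, hw, h0⟩ := hu
  exact ⟨c • g, hg.const_smul c, (hw.const_smul c).congr (Lp.coeFn_smul c u).symm .rfl,
    by simp [h0]⟩

theorem BdryZero.zero (l a : ℝ) (k : ℕ) : BdryZero l a k (0 : L2 l) :=
  ⟨0, continuousOn_const, isWeakDeriv_zero_right.congr (Lp.coeFn_zero R3 2 (vol l)).symm .rfl, rfl⟩

theorem MemSobolev.add {l : ℝ} {m : ℕ} {u v : L2 l} (hu : MemSobolev l m u)
    (hv : MemSobolev l m v) : MemSobolev l m (u + v : L2 l) := by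
  refine ⟨Lp.memLp _, fun k hk => ?_⟩
  obtain ⟨f, hf, h⟩ := hu.2 k hk
  obtain ⟨f', hf', h'⟩ := hv.2 k hk
  exact ⟨f + f', hf.add hf', (h.add h' (integrable_coe u) (integrable_of_memLp_two hf)
    (integrable_coe v) (integrable_of_memLp_two hf')).congr (Lp.coeFn_add u v).symm .rfl⟩

theorem MemSobolev.smul {l : ℝ} {m : ℕ} {u : L2 l} (c : ℝ) (hu : MemSobolev l m u) :
    MemSobolev l m (c • u : L2 l) := by
  refine ⟨Lp.memLp _, fun k hk => ?_⟩
  obtain ⟨f, hf, h⟩ := hu.2 k hk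
  exact ⟨c • f, hf.const_smul c, (h.const_smul c).congr (Lp.coeFn_smul c u).symm .rfl⟩

theorem MemSobolev.zero (l : ℝ) (m : ℕ) : MemSobolev l m (0 : L2 l) :=
  ⟨Lp.memLp _, fun _ _ => ⟨0, MemLp.zero,
    isWeakDeriv_zero_right.congr (Lp.coeFn_zero R3 2 (vol l)).symm .rfl⟩⟩

/-- `H^{2,2}_bc(0, l)`: `u ∈ H^{2,2}((0, l); ℝ³)`, `u(l) = ∂u(l) = 0`. -/
def H2bc (l : ℝ) : Submodule ℝ (L2 l) where
  carrier := {u | MemSobolev l 2 u ∧ BdryZero l l 0 u ∧ BdryZero l l 1 u}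
  add_mem' hu hv := ⟨hu.1.add hv.1, hu.2.1.add hv.2.1, hu.2.2.add hv.2.2⟩
  zero_mem' := ⟨.zero _ _, .zero _ _ _, .zero _ _ _⟩
  smul_mem' c _ hu := ⟨hu.1.smul c, hu.2.1.smul c, hu.2.2.smul c⟩

/-- `H^{4,2}_bc(0, l)`: `u ∈ H^{4,2}((0, l); ℝ³)`, `u(l) = ∂u(l) = 0`, `∂²u(0) = ∂³u(0) = 0`. -/
def H4bc (l : ℝ) : Submodule ℝ (L2 l) where
  carrier := {u | MemSobolev l 4 u ∧ BdryZero l l 0 u ∧ BdryZero l l 1 u ∧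
    BdryZero l 0 2 u ∧ BdryZero l 0 3 u}
  add_mem' hu hv := ⟨hu.1.add hv.1, hu.2.1.add hv.2.1, hu.2.2.1.add hv.2.2.1,
    hu.2.2.2.1.add hv.2.2.2.1, hu.2.2.2.2.add hv.2.2.2.2⟩
  zero_mem' := ⟨.zero _ _, .zero _ _ _, .zero _ _ _, .zero _ _ _, .zero _ _ _⟩
  smul_mem' c _ hu := ⟨hu.1.smul c, hu.2.1.smul c, hu.2.2.1.smul c, hu.2.2.2.1.smul c,
    hu.2.2.2.2.smul c⟩

theorem H4bc_le_H2bc (l : ℝ) : H4bc l ≤ H2bc l := fun _ hu =>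
  ⟨⟨hu.1.1, fun k hk => hu.1.2 k (hk.trans (by norm_num))⟩, hu.2.1, hu.2.2.1⟩

/-- The `k`-th weak derivative as an unbounded operator in `L²((0, l); ℝ³)`. -/
def weakDeriv (l : ℝ) (k : ℕ) : L2 l →ₗ.[ℝ] L2 l where
  domain :=
    { carrier := {u | ∃ v : L2 l, IsWeakDeriv l k u v}
      add_mem' := by
        rintro u v ⟨f, hf⟩ ⟨g, hg⟩
        exact ⟨f + g, (hf.add hg (integrable_coe u) (integrable_coe f) (integrable_coe v)
          (integrable_coe g)).congr (Lp.coeFn_add u v).symm (Lp.coeFn_add f g).symm⟩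
      zero_mem' := ⟨0, isWeakDeriv_zero_right.congr (Lp.coeFn_zero R3 2 (vol l)).symm
        (Lp.coeFn_zero R3 2 (vol l)).symm⟩
      smul_mem' := by
        rintro c u ⟨f, hf⟩
        exact ⟨c • f, (hf.const_smul c).congr (Lp.coeFn_smul c u).symm
          (Lp.coeFn_smul c f).symm⟩ }
  toFun :=
    { toFun := fun u => u.2.choose
      map_add' := by
        intro u v
        refine Lp.ext ((u + v).2.choose_spec.unique ?_ (integrable_coe _) (integrable_coe _))
        exact (u.2.choose_spec.add v.2.choose_spec (integrable_coe _) (integrable_coe _)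
          (integrable_coe _) (integrable_coe _)).congr (Lp.coeFn_add _ _).symm
          (Lp.coeFn_add _ _).symm
      map_smul' := by
        intro c u
        refine Lp.ext ((c • u).2.choose_spec.unique ?_ (integrable_coe _) (integrable_coe _))
        exact (u.2.choose_spec.const_smul c).congr (Lp.coeFn_smul _ _).symm
          (Lp.coeFn_smul _ _).symm }

theorem weakDeriv_spec {l : ℝ} {k : ℕ} (u : (weakDeriv l k).domain) :
    IsWeakDeriv l k (u : L2 l) (weakDeriv l k u : L2 l) := u.2.choose_spec

theorem weakDeriv_eq {l : ℝ} {k : ℕ} (u : (weakDeriv l k).domain) {v : L2 l}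
    (h : IsWeakDeriv l k (u : L2 l) v) : weakDeriv l k u = v :=
  Lp.ext ((weakDeriv_spec u).unique h (integrable_coe _) (integrable_coe _))

theorem MemSobolev.mem_domain {l : ℝ} {m k : ℕ} {u : L2 l} (hu : MemSobolev l m u)
    (hk : k ≤ m) : u ∈ (weakDeriv l k).domain := by
  obtain ⟨v, hv, h⟩ := hu.2 k hk
  exact ⟨hv.toLp v, h.congr .rfl hv.coeFn_toLp.symm⟩

/-- If `u ∈ H^{2,2}_bc` and `∂²u = 0` then `u = 0`. -/
theorem eq_zero_of_H2bc {l : ℝ} (hl : 0 < l) {u : L2 l} (hu : u ∈ H2bc l)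
    (h : IsWeakDeriv l 2 u (0 : ℝ → R3)) : u = 0 := by
  obtain ⟨-, ⟨g0, hg0, hw0, h0⟩, ⟨g1, hg1, hw1, h1⟩⟩ := hu
  have hm : l ∈ Icc 0 l := ⟨hl.le, le_rfl⟩
  have z1 := (IsWeakDeriv.sub_index hw1 (k := 1) h).eq_zero hl hg1 .rfl hm h1
  have z1' : g1 =ᵐ[vol l] 0 :=
    (ae_restrict_iff' measurableSet_Ioo).2 (ae_of_all _ fun s hs => z1 s (Ioo_subset_Icc_self hs))
  have z0 := (IsWeakDeriv.sub_index hw0 (k := 1) hw1).eq_zero hl hg0 z1' hm h0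
  have z0' : g0 =ᵐ[vol l] 0 :=
    (ae_restrict_iff' measurableSet_Ioo).2 (ae_of_all _ fun s hs => z0 s (Ioo_subset_Icc_self hs))
  have hself : IsWeakDeriv l 0 (u : ℝ → R3) u := by intro φ hφ; simp
  exact Lp.ext (((hself.unique hw0 (integrable_coe u) (integrable_of_continuousOn hg0)).trans
    z0').trans (Lp.coeFn_zero R3 2 (vol l)).symm)

/-- If `u ∈ H^{4,2}_bc` and `∂⁴u = 0` then `u = 0`. -/
theorem eq_zero_of_H4bc {l : ℝ} (hl : 0 < l) {u : L2 l} (hu : u ∈ H4bc l)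
    (h : IsWeakDeriv l 4 u (0 : ℝ → R3)) : u = 0 := by
  have hu2 := H4bc_le_H2bc l hu
  obtain ⟨-, -, -, ⟨g0, hg0, hw0, h0⟩, ⟨g1, hg1, hw1, h1⟩⟩ := hu
  have hm : (0 : ℝ) ∈ Icc 0 l := ⟨le_rfl, hl.le⟩
  have z1 := (IsWeakDeriv.sub_index hw1 (k := 1) h).eq_zero hl hg1 .rfl hm h1
  have z1' : g1 =ᵐ[vol l] 0 :=
    (ae_restrict_iff' measurableSet_Ioo).2 (ae_of_all _ fun s hs => z1 s (Ioo_subset_Icc_self hs))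
  have z0 := (IsWeakDeriv.sub_index hw0 (k := 1) hw1).eq_zero hl hg0 z1' hm h0
  have z0' : g0 =ᵐ[vol l] 0 :=
    (ae_restrict_iff' measurableSet_Ioo).2 (ae_of_all _ fun s hs => z0 s (Ioo_subset_Icc_self hs))
  exact eq_zero_of_H2bc hl hu2 (hw0.congr .rfl z0')

/-- The primitive `s ↦ ∫_s^l f` of an integrable function is continuous on `[0, l]`. -/
theorem continuousOn_primitive {l : ℝ} (hl : 0 < l) {f : ℝ → R3} (hf : Integrable f (vol l)) :
    ContinuousOn (fun s => ∫ r in Ioo s l, f r ∂(vol l)) (Icc 0 l) := by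
  have hf' : IntegrableOn f (uIcc 0 l) := by
    rw [uIcc_of_le hl.le, integrableOn_Icc_iff_integrableOn_Ioo]; exact hf
  have := intervalIntegral.continuousOn_primitive_interval_left hf'
  rw [uIcc_of_le hl.le] at this
  refine this.congr fun s hs => ?_
  simp only
  rw [intervalIntegral.integral_of_le hs.2, integral_Ioc_eq_integral_Ioo,
    Measure.restrict_restrict measurableSet_Ioo]
  congr 2
  ext x
  simp only [mem_inter_iff, mem_Ioo]
  exact ⟨fun h => h.1, fun h => ⟨h, hs.1.trans_lt h.1, h.2⟩⟩

theorem memLp_of_continuousOn {E : Type*} [NormedAddCommGroup E] {l : ℝ} {g : ℝ → E}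
    (hg : ContinuousOn g (Icc 0 l)) (p : ℝ≥0∞) : MemLp g p (vol l) := by
  obtain ⟨C, hC⟩ := isCompact_Icc.exists_bound_of_continuousOn hg
  refine MemLp.of_bound
    ((hg.mono Ioo_subset_Icc_self).aestronglyMeasurable measurableSet_Ioo) C ?_
  exact (ae_restrict_iff' measurableSet_Ioo).2
    (ae_of_all _ fun s hs => hC s (Ioo_subset_Icc_self hs))

/-- `∂² : H^{2,2}_bc → L²` is onto. -/
theorem exists_H2bc {l : ℝ} (hl : 0 < l) (f : L2 l) :
    ∃ u : L2 l, u ∈ H2bc l ∧ IsWeakDeriv l 2 u f := by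
  set F : ℝ → R3 := fun s => ∫ r in Ioo s l, f r ∂(vol l) with hF
  have cF := continuousOn_primitive hl (integrable_coe f)
  have iF := integrable_of_continuousOn cF
  set G : ℝ → R3 := fun s => ∫ r in Ioo s l, F r ∂(vol l) with hG
  have cG := continuousOn_primitive hl iF
  have w1 : IsWeakDeriv l 1 F (-f) := isWeakDeriv_primitive (integrable_coe f)
  have w1' : IsWeakDeriv l 1 (-F) f := by
    have := w1.const_smul (-1)
    simpa using this
  have w2 : IsWeakDeriv l 1 G (-F) := isWeakDeriv_primitive iF
  have w3 : IsWeakDeriv l 2 G f := w2.comp (k := 1) w1'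
  have w0 : IsWeakDeriv l 0 G G := by intro φ hφ; simp
  have mG := memLp_of_continuousOn cG 2
  have mF := memLp_of_continuousOn cF 2
  have hu := mG.coeFn_toLp.symm
  refine ⟨mG.toLp G, ⟨⟨Lp.memLp _, fun k hk => ?_⟩, ⟨G, cG, w0.congr hu .rfl, by simp [hG]⟩,
    ⟨-F, cF.neg, w2.congr hu .rfl, by simp [hF]⟩⟩, w3.congr hu .rfl⟩
  interval_cases k
  · exact ⟨G, mG, w0.congr hu .rfl⟩
  · exact ⟨-F, mF.neg, w2.congr hu .rfl⟩
  · exact ⟨f, Lp.memLp f, w3.congr hu .rfl⟩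

/-- The space `H^{2,2}_bc(0, l)`, to be equipped with the inner product `b ∫ ⟨∂²u, ∂²v⟩`. -/
def H2 (l _b : ℝ) : Type := H2bc l

/-- The space `H^{4,2}_bc(0, l)`, to be equipped with the inner product `b² ∫ ⟨∂⁴u, ∂⁴v⟩`. -/
def H4 (l _b : ℝ) : Type := H4bc l

instance (l b : ℝ) : AddCommGroup (H2 l b) := inferInstanceAs (AddCommGroup (H2bc l))
instance (l b : ℝ) : Module ℝ (H2 l b) := inferInstanceAs (Module ℝ (H2bc l))
instance (l b : ℝ) : AddCommGroup (H4 l b) := inferInstanceAs (AddCommGroup (H4bc l))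
instance (l b : ℝ) : Module ℝ (H4 l b) := inferInstanceAs (Module ℝ (H4bc l))

/-- The inclusion `H^{2,2}_bc(0, l) → L²`. -/
def H2.toL2 (l b : ℝ) : H2 l b →ₗ[ℝ] L2 l := (H2bc l).subtype

/-- The inclusion `H^{4,2}_bc(0, l) → L²`. -/
def H4.toL2 (l b : ℝ) : H4 l b →ₗ[ℝ] L2 l := (H4bc l).subtype

/-- The inclusion `H^{4,2}_bc(0, l) → H^{2,2}_bc(0, l)`. -/
def H4.toH2 (l b : ℝ) : H4 l b →ₗ[ℝ] H2 l b := Submodule.inclusion (H4bc_le_H2bc l)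

/-- `∂ : H^{2,2}_bc(0, l) → L²`. -/
def H2.d1 (l b : ℝ) : H2 l b →ₗ[ℝ] L2 l :=
  (weakDeriv l 1).toFun ∘ₗ Submodule.inclusion fun _ hu => hu.1.mem_domain (by norm_num)

/-- `∂² : H^{2,2}_bc(0, l) → L²`. -/
def H2.d2 (l b : ℝ) : H2 l b →ₗ[ℝ] L2 l :=
  (weakDeriv l 2).toFun ∘ₗ Submodule.inclusion fun _ hu => hu.1.mem_domain le_rfl

/-- `∂⁴ : H^{4,2}_bc(0, l) → L²`. -/
def H4.d4 (l b : ℝ) : H4 l b →ₗ[ℝ] L2 l :=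
  (weakDeriv l 4).toFun ∘ₗ Submodule.inclusion fun _ hu => hu.1.mem_domain le_rfl

theorem H2.d2_spec {l b : ℝ} (u : H2 l b) : IsWeakDeriv l 2 (H2.toL2 l b u) (H2.d2 l b u) :=
  weakDeriv_spec (l := l) (k := 2)
    ⟨H2.toL2 l b u, MemSobolev.mem_domain (Subtype.prop (p := (· ∈ H2bc l)) u).1 le_rfl⟩

theorem H4.d4_spec {l b : ℝ} (u : H4 l b) : IsWeakDeriv l 4 (H4.toL2 l b u) (H4.d4 l b u) :=
  weakDeriv_spec (l := l) (k := 4)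
    ⟨H4.toL2 l b u, MemSobolev.mem_domain (Subtype.prop (p := (· ∈ H4bc l)) u).1 le_rfl⟩

theorem H2.eq_zero_of_d2 {l b : ℝ} (hl : 0 < l) {u : H2 l b} (h : H2.d2 l b u = 0) : u = 0 := by
  have := H2.d2_spec u
  rw [h] at this
  exact Subtype.ext (eq_zero_of_H2bc hl u.2 (this.congr .rfl (Lp.coeFn_zero R3 2 (vol l))))

theorem H4.eq_zero_of_d4 {l b : ℝ} (hl : 0 < l) {u : H4 l b} (h : H4.d4 l b u = 0) : u = 0 := by
  have := H4.d4_spec u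
  rw [h] at this
  exact Subtype.ext (eq_zero_of_H4bc hl u.2 (this.congr .rfl (Lp.coeFn_zero R3 2 (vol l))))

section Norms

variable (l b : ℝ) [hl : Fact (0 < l)] [hb : Fact (0 < b)]

/-- The inner product `⟨u, v⟩ = b ∫ ⟨∂²u, ∂²v⟩` on `H^{2,2}_bc(0, l)`. -/
abbrev H2.core : InnerProductSpace.Core ℝ (H2 l b) where
  inner u v := b * ⟪H2.d2 l b u, H2.d2 l b v⟫_ℝ
  conj_inner_symm u v := by simp [real_inner_comm]
  re_inner_nonneg u := mul_nonneg hb.out.le real_inner_self_nonneg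
  add_left u v w := by simp [inner_add_left, mul_add]
  smul_left u v r := by simp [real_inner_smul_left, mul_left_comm]
  definite u h := H2.eq_zero_of_d2 hl.out
    (inner_self_eq_zero.1 ((mul_eq_zero.1 h).resolve_left hb.out.ne'))

/-- The inner product `⟨u, v⟩ = b² ∫ ⟨∂⁴u, ∂⁴v⟩` on `H^{4,2}_bc(0, l)`. -/
abbrev H4.core : InnerProductSpace.Core ℝ (H4 l b) where
  inner u v := b ^ 2 * ⟪H4.d4 l b u, H4.d4 l b v⟫_ℝ
  conj_inner_symm u v := by simp [real_inner_comm]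
  re_inner_nonneg u := mul_nonneg (sq_nonneg b) real_inner_self_nonneg
  add_left u v w := by simp [inner_add_left, mul_add]
  smul_left u v r := by simp [real_inner_smul_left, mul_left_comm]
  definite u h := H4.eq_zero_of_d4 hl.out
    (inner_self_eq_zero.1 ((mul_eq_zero.1 h).resolve_left (pow_pos hb.out 2).ne'))

instance : NormedAddCommGroup (H2 l b) := (H2.core l b).toNormedAddCommGroup
instance : InnerProductSpace ℝ (H2 l b) := InnerProductSpace.ofCore (H2.core l b).toCore
instance : NormedAddCommGroup (H4 l b) := (H4.core l b).toNormedAddCommGroup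
instance : InnerProductSpace ℝ (H4 l b) := InnerProductSpace.ofCore (H4.core l b).toCore

theorem H2.inner_def (u v : H2 l b) : ⟪u, v⟫_ℝ = b * ⟪H2.d2 l b u, H2.d2 l b v⟫_ℝ := rfl

theorem H4.inner_def (u v : H4 l b) : ⟪u, v⟫_ℝ = b ^ 2 * ⟪H4.d4 l b u, H4.d4 l b v⟫_ℝ := rfl

instance : CompleteSpace (H2 l b) := by
  have hbs : Real.sqrt b ≠ 0 := (Real.sqrt_pos.2 hb.out).ne'
  let e : H2 l b →ₗᵢ[ℝ] L2 l := LinearMap.isometryOfInner (Real.sqrt b • H2.d2 l b) (by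
    intro u v
    rw [H2.inner_def, LinearMap.smul_apply, LinearMap.smul_apply, real_inner_smul_left,
      real_inner_smul_right, ← mul_assoc, Real.mul_self_sqrt hb.out.le])
  have hs : Function.Surjective e := by
    intro f
    obtain ⟨u, hu, hw⟩ := exists_H2bc hl.out ((Real.sqrt b)⁻¹ • f)
    refine ⟨(⟨u, hu⟩ : H2bc l), ?_⟩
    show Real.sqrt b • H2.d2 l b (⟨u, hu⟩ : H2bc l) = f
    have : H2.d2 l b (⟨u, hu⟩ : H2bc l) = (Real.sqrt b)⁻¹ • f :=
      weakDeriv_eq (l := l) (k := 2) _ hw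
    rw [this, smul_inv_smul₀ hbs]
  exact (LinearIsometryEquiv.ofSurjective e hs).toIsometryEquiv.completeSpace

end Norms

variable (l b : ℝ)

/-- The energy space `H = H^{2,2}_bc(0, l) × L²((0, l); ℝ³)`, a Hilbert space with the inner
product of the direct sum. -/
abbrev Energy : Type := WithLp 2 (H2 l b × L2 l)

/-- The space `𝒟 = H^{4,2}_bc(0, l) × H^{2,2}_bc(0, l)` with the inner product of the direct
sum. -/
abbrev Dom : Type := WithLp 2 (H4 l b × H2 l b)

/-- The inclusion `𝒟 → H`. -/
def Dom.incl : Dom l b →ₗ[ℝ] Energy l b where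
  toFun w := WithLp.toLp 2 (H4.toH2 l b w.fst, H2.toL2 l b w.snd)
  map_add' _ _ := by simp [← WithLp.toLp_add]
  map_smul' _ _ := by simp [← WithLp.toLp_smul]

/-- `𝒟` as a subspace of `H`: all `(u, v)` with `u ∈ H^{4,2}_bc` and `v ∈ H^{2,2}_bc`. -/
def domSub : Submodule ℝ (Energy l b) where
  carrier := {w | H2.toL2 l b w.fst ∈ H4bc l ∧ w.snd ∈ H2bc l}
  add_mem' hv hw := ⟨by simpa using add_mem hv.1 hw.1, by simpa using add_mem hv.2 hw.2⟩
  zero_mem' := by simp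
  smul_mem' c _ hw := ⟨by simpa using Submodule.smul_mem _ c hw.1,
    by simpa using Submodule.smul_mem _ c hw.2⟩

/-- The identification of `𝒟 ⊆ H` with pairs `(u, v) ∈ H^{4,2}_bc × H^{2,2}_bc`. -/
def domSub.toPair : domSub l b →ₗ[ℝ] H4 l b × H2 l b where
  toFun w := ((⟨H2.toL2 l b w.1.fst, w.2.1⟩ : H4bc l), (⟨w.1.snd, w.2.2⟩ : H2bc l))
  map_add' _ _ := rfl
  map_smul' _ _ := rfl

/-- The operator `L₀(u, v) = (v, -b ∂⁴u)` in `H` with domain `𝒟`. -/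
def L0 : Energy l b →ₗ.[ℝ] Energy l b where
  domain := domSub l b
  toFun := (WithLp.linearEquiv 2 ℝ (H2 l b × L2 l)).symm ∘ₗ
    LinearMap.prod (LinearMap.snd ℝ (H4 l b) (H2 l b))
      (-(b • (H4.d4 l b ∘ₗ LinearMap.fst ℝ (H4 l b) (H2 l b)))) ∘ₗ domSub.toPair l b

theorem L0_apply (w : (L0 l b).domain) :
    L0 l b w = WithLp.toLp 2 ((domSub.toPair l b w).2,
      -(b • H4.d4 l b (domSub.toPair l b w).1)) := rfl

open Classical in
/-- Multiplication by an essentially bounded scalar function `a` on `L²((0, l); ℝ³)`. -/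
def mulL2 (a : ℝ → ℝ) : L2 l →ₗ[ℝ] L2 l :=
  if h : MemLp a ∞ (vol l) then
    { toFun := fun f => h.toLp a • f
      map_add' := fun _ _ => Lp.add_smul _ _ _
      map_smul' := fun c f => (Lp.smul_comm c _ f).symm }
  else 0

/-- The operator `L(u, v) = (v, ∂(a ∂u) - b ∂⁴u)` in `H`, where `a` is a bounded function on
`(0, l)`. Its domain consists of all `(u, v) ∈ 𝒟` for which `∂(a ∂u)` exists in `L²` as a weak
derivative; for `a` in `H^{3,2}` (indeed for `a` in `H^{1,2}`) this is all of `𝒟`. -/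
def beamOp (a : ℝ → ℝ) : Energy l b →ₗ.[ℝ] Energy l b where
  domain := domSub l b ⊓ ((weakDeriv l 1).domain.comap
    (mulL2 l a ∘ₗ H2.d1 l b ∘ₗ WithLp.fstₗ 2 ℝ (H2 l b) (L2 l)))
  toFun :=
    let pr := domSub.toPair l b ∘ₗ Submodule.inclusion inf_le_left
    (WithLp.linearEquiv 2 ℝ (H2 l b × L2 l)).symm ∘ₗ
      LinearMap.prod (LinearMap.snd ℝ (H4 l b) (H2 l b) ∘ₗ pr)
        ((weakDeriv l 1).toFun ∘ₗ
            LinearMap.restrict (mulL2 l a ∘ₗ H2.d1 l b ∘ₗ WithLp.fstₗ 2 ℝ (H2 l b) (L2 l))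
              (fun _ hw => (Submodule.mem_inf.1 hw).2)
          - b • (H4.d4 l b ∘ₗ LinearMap.fst ℝ (H4 l b) (H2 l b) ∘ₗ pr))

theorem beamOp_apply (a : ℝ → ℝ) (w : (beamOp l b a).domain) :
    beamOp l b a w = WithLp.toLp 2 ((domSub.toPair l b ⟨w.1, w.2.1⟩).2,
      weakDeriv l 1 ⟨mulL2 l a (H2.d1 l b w.1.fst), w.2.2⟩
        - b • H4.d4 l b (domSub.toPair l b ⟨w.1, w.2.1⟩).1) := rfl

end Spaces

section Notions

/-- The conditions on the tractive force `λ`, written `lam t s` for time `t ∈ [0, T]` and arc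
length `s ∈ [0, l]`. Every `λ(t) ∈ H^{3,2}((0, l); ℝ)` is identified with its continuous version
on `[0, l]`. -/
structure IsTractiveForce (l T : ℝ) (lam : ℝ → ℝ → ℝ) : Prop where
  continuousOn : ∀ t ∈ Icc 0 T, ContinuousOn (lam t) (Icc 0 l)
  memSobolev : ∀ t ∈ Icc 0 T, MemSobolev l 3 (lam t)
  bounded : ∃ C : ℝ, 0 ≤ C ∧ ∀ t ∈ Icc 0 T, SobolevNormLE l 3 (lam t) C
  left : ∀ t ∈ Icc 0 T, lam t 0 = 0
  right : ∀ t ∈ Icc 0 T, lam t l = 0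
  deriv_left : ∀ t ∈ Icc 0 T, derivWithin (lam t) (Icc 0 l) 0 = 0
  deriv_right : ∀ t ∈ Icc 0 T, derivWithin (lam t) (Icc 0 l) l = 0
  pos : ∀ t ∈ Icc 0 T, ∀ s ∈ Ioo 0 l, 0 < lam t s
  measurable : AEMeasurable (fun p : ℝ × ℝ => lam p.1 p.2)
    (volume.restrict (Icc 0 T ×ˢ Icc 0 l))
  measurable_deriv : AEMeasurable (fun p : ℝ × ℝ => derivWithin (lam p.1) (Icc 0 l) p.2)
    (volume.restrict (Icc 0 T ×ˢ Icc 0 l))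

variable {K : Type*} [NormedAddCommGroup K] [InnerProductSpace ℝ K]

/-- `(U(t, τ))`, `0 ≤ τ ≤ t ≤ T`, is an almost strong evolution system in the Hilbert space `K`
with generators `L(t)`, `t ∈ [0, T]`, and initial space `Y`. Values of `U` at other pairs
`(t, τ)` are irrelevant. -/
structure IsAlmostStrongEvolutionSystem (T : ℝ) (L : ℝ → K →ₗ.[ℝ] K) (Y : Submodule ℝ K)
    (U : ℝ → ℝ → K →L[ℝ] K) : Prop where
  isClosed : ∀ t ∈ Icc 0 T, (L t).IsClosed
  dense_inter : Dense (⋂ t ∈ Icc 0 T, ((L t).domain : Set K))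
  initial_le : ∀ t ∈ Icc 0 T, Y ≤ (L t).domain
  dense_initial : Dense (Y : Set K)
  refl : ∀ t ∈ Icc 0 T, U t t = ContinuousLinearMap.id ℝ K
  comp : ∀ τ r t, 0 ≤ τ → τ ≤ r → r ≤ t → t ≤ T → U t r ∘L U r τ = U t τ
  continuousOn_left : ∀ u, ∀ τ ∈ Icc 0 T, ContinuousOn (fun t => U t τ u) (Icc τ T)
  continuousOn_right : ∀ u, ∀ t ∈ Icc 0 T, ContinuousOn (fun τ => U t τ u) (Icc 0 t)
  bounded : ∃ C : ℝ, ∀ τ t, 0 ≤ τ → τ ≤ t → t ≤ T → ‖U t τ‖ ≤ C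
  invariant : ∀ τ ∈ Ico 0 T, ∀ᵐ t ∂(volume.restrict (Icc τ T)), ∀ u ∈ Y, U t τ u ∈ (L t).domain
  /-- `∫_τ^t L(r) U(r, τ) u dr = U(t, τ) u - u`; the integrand `f` is determined a.e. -/
  integral_eq : ∀ u ∈ Y, ∀ τ ∈ Icc 0 T, ∃ f : ℝ → K,
    (∀ᵐ r ∂(volume.restrict (Icc τ T)), ∃ h : U r τ u ∈ (L r).domain, f r = L r ⟨U r τ u, h⟩) ∧
    IntegrableOn f (Icc τ T) ∧ ∀ t ∈ Icc τ T, ∫ r in τ..t, f r = U t τ u - u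

/-- `ρ'` is a derivative of `ρ` in the sense of `C_w^1([0, T]; K)`: it is Bochner square
integrable, and for every `v` the weak derivative of `⟨ρ, v⟩` on `(0, T)` is `⟨ρ', v⟩`. -/
def IsCw1Deriv (T : ℝ) (ρ ρ' : ℝ → K) : Prop :=
  MemLp ρ' 2 (vol T) ∧
    ∀ v : K, IsWeakDeriv T 1 (fun r => ⟪ρ r, v⟫_ℝ) (fun r => ⟪ρ' r, v⟫_ℝ)

/-- `ρ ∈ C_w^1([0, T]; K)`. -/
def MemCw1 (T : ℝ) (ρ : ℝ → K) : Prop :=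
  MemLp ρ 2 (vol T) ∧ (∀ v : K, MemSobolev T 1 fun r => ⟪ρ r, v⟫_ℝ) ∧
    ∃ ρ' : ℝ → K, IsCw1Deriv T ρ ρ'

/-- The domain `D(A²) = {u ∈ D(A) | A u ∈ D(A)}`. -/
def sqDomain (A : K →ₗ.[ℝ] K) : Set K := {u | ∃ h : u ∈ A.domain, A ⟨u, h⟩ ∈ A.domain}

end Notions
end Beam

end

/-! Let K be the inverse of `L0`. It is bounded, injective and skew-adjoint on the energy space, 𝒟
is its range and D(L₀²) is the range of K². On the range of K the generator is L(t) = K⁻¹ + B(t),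
where B(t)(u, v) = (0, ∂(λ∂u)) is bounded uniformly in t. Two facts about λ enter. (1) B(t)K = K
B'(t) with B'(t) uniformly bounded, because ∂(λ∂u) lies in H^{2,2}_bc for u in H^{4,2}_bc
(`exists_divOp_H4_bound`). This takes three derivatives of λ in L² and λ = ∂λ = 0 at l. (2) K B(t)
is self-adjoint, because ∂(λ∂·) is symmetric when λ vanishes at both ends (`IsCoeff.inner_divOp`).

Existence: K⁻¹ generates a unitary group S (`exists_isGroupOfInverse`). In the interaction picture
w' = S(-t)B(t)S(t)w is a linear equation with bounded, strongly measurable coefficients; its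
propagator W is given by a Neumann series (`exists_propagator`), and U(t,τ) = S(t)W(t,τ)S(-τ)
(`exists_evolutionSystem`). By (1), the same construction with B' in place of B is conjugate to U by
K, so U preserves the range of K.

Adjoint: by (2), L*(τ) = -K L(τ) K⁻¹ on the range of K² (`IsInverseAdd.adjoint_apply`). This
suggests U*(t,τ) = K U(τ,t) K⁻¹, where U(τ,t) is the evolution backwards in time, available because
S is a group. So for u = K²y let Kp solve w' = L(τ)w with w(t) = Ky. Then r ↦ ⟨U(r,τ)x, K²p(r)⟩ is
constant for every x in 𝒟, and by density U*(t,τ)u = K²p(τ) (`exists_adjoint_eq`). Of U only the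
integral identity and U(τ,τ) = Id are used here, so every evolution system is covered and no
uniqueness is needed.

Regularity: Kp has the derivative p + K B'p in H, and K is bounded from H to 𝒟. Hence K²p is
differentiable in 𝒟 with derivative K(p + K B'p) = -L*(τ)K²p. -/

set_option linter.unusedSectionVars false

noncomputable section
namespace Beam

open Filter Topology

/-! ### Calculus of indefinite integrals of vector-valued L¹ functions -/

section Calculus
variable {E F G : Type*} [NormedAddCommGroup E] [NormedSpace ℝ E]
  [NormedAddCommGroup F] [NormedSpace ℝ F] [NormedAddCommGroup G] [NormedSpace ℝ G]

/-- On `[a, b]` the function `f` is an indefinite integral of the integrable function `f'`. -/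
structure HasL1Deriv (a b : ℝ) (f f' : ℝ → E) : Prop where
  integrable : IntervalIntegrable f' volume a b
  eq : ∀ s ∈ Icc a b, f s = f a + ∫ r in a..s, f' r

variable {a b : ℝ} {f f' : ℝ → E} {g g' : ℝ → F}

theorem HasL1Deriv.integrable_of_mem (h : HasL1Deriv a b f f') {s t : ℝ} (hs : s ∈ Icc a b)
    (ht : t ∈ Icc a b) : IntervalIntegrable f' volume s t :=
  h.integrable.mono_set (by
    rw [uIcc_of_le (hs.1.trans hs.2)]; exact uIcc_subset_Icc hs ht)

theorem HasL1Deriv.sub_eq (h : HasL1Deriv a b f f') {s t : ℝ} (hs : s ∈ Icc a b)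
    (ht : t ∈ Icc a b) : f t - f s = ∫ r in s..t, f' r := by
  have ha : a ∈ Icc a b := ⟨le_rfl, hs.1.trans hs.2⟩
  rw [h.eq s hs, h.eq t ht, add_sub_add_left_eq_sub,
    intervalIntegral.integral_interval_sub_left (h.integrable_of_mem ha ht)
      (h.integrable_of_mem ha hs)]

/-- The base point is immaterial. This is needed for boundary values at the right end and for
equations with initial time inside the interval. -/
theorem HasL1Deriv.of_base {c : ℝ} (hc : c ∈ Icc a b) (hi : IntervalIntegrable f' volume a b)
    (h : ∀ s ∈ Icc a b, f s = f c + ∫ r in c..s, f' r) : HasL1Deriv a b f f' := by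
  have ha : a ∈ Icc a b := ⟨le_rfl, hc.1.trans hc.2⟩
  have hi' : ∀ {s t}, s ∈ Icc a b → t ∈ Icc a b → IntervalIntegrable f' volume s t :=
    fun hs ht => hi.mono_set (by
      rw [uIcc_of_le (hc.1.trans hc.2)]; exact uIcc_subset_Icc hs ht)
  refine ⟨hi, fun s hs => ?_⟩
  rw [h s hs, h a ha, add_assoc, intervalIntegral.integral_add_adjacent_intervals
    (hi' hc ha) (hi' ha hs)]

theorem HasL1Deriv.mono (h : HasL1Deriv a b f f') {c d : ℝ} (hcd : c ≤ d) (hc : a ≤ c)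
    (hd : d ≤ b) : HasL1Deriv c d f f' := by
  have hc' : c ∈ Icc a b := ⟨hc, hcd.trans hd⟩
  refine ⟨h.integrable_of_mem hc' ⟨hc.trans hcd, hd⟩, fun s hs => ?_⟩
  rw [← h.sub_eq hc' ⟨hc.trans hs.1, hs.2.trans hd⟩]; abel

theorem HasL1Deriv.continuousOn (h : HasL1Deriv a b f f') : ContinuousOn f (Icc a b) := by
  rcases le_or_gt a b with hab | hab
  · have := intervalIntegral.continuousOn_primitive_interval (f := f') (a := a) (b := b)
      (μ := volume) (by
        rw [uIcc_of_le hab, integrableOn_Icc_iff_integrableOn_Ioc]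
        exact (intervalIntegrable_iff_integrableOn_Ioc_of_le hab).1 h.integrable)
    rw [uIcc_of_le hab] at this
    exact (continuousOn_const.add this).congr h.eq
  · simp [Icc_eq_empty_of_lt hab]

theorem HasL1Deriv.congr (h : HasL1Deriv a b f f') (hab : a ≤ b) {f₁ f₁' : ℝ → E}
    (e : ∀ s ∈ Icc a b, f s = f₁ s) (e' : f' =ᵐ[volume.restrict (Icc a b)] f₁') :
    HasL1Deriv a b f₁ f₁' := by
  have e2 : f' =ᵐ[volume.restrict (Ioc a b)] f₁' := ae_restrict_of_ae_restrict_of_subset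
    Ioc_subset_Icc_self e'
  refine ⟨?_, fun s hs => ?_⟩
  · rw [intervalIntegrable_iff_integrableOn_Ioc_of_le hab]
    exact ((intervalIntegrable_iff_integrableOn_Ioc_of_le hab).1 h.integrable).congr e2
  · rw [← e s hs, ← e a ⟨le_rfl, hab⟩, h.eq s hs]
    congr 1
    refine intervalIntegral.integral_congr_ae_restrict ?_
    rw [uIoc_of_le hs.1]
    exact ae_restrict_of_ae_restrict_of_subset (Ioc_subset_Ioc_right hs.2) e2

theorem HasL1Deriv.add {f₁ f₁' : ℝ → E} (h : HasL1Deriv a b f f') (h₁ : HasL1Deriv a b f₁ f₁') :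
    HasL1Deriv a b (fun s => f s + f₁ s) (fun s => f' s + f₁' s) := by
  refine ⟨h.integrable.add h₁.integrable, fun s hs => ?_⟩
  have ha : a ∈ Icc a b := ⟨le_rfl, hs.1.trans hs.2⟩
  rw [intervalIntegral.integral_add (h.integrable_of_mem ha hs) (h₁.integrable_of_mem ha hs),
    h.eq s hs, h₁.eq s hs]
  abel

theorem hasL1Deriv_const (a b : ℝ) (c : E) : HasL1Deriv a b (fun _ => c) (fun _ => 0) :=
  ⟨by simp, fun s _ => by simp⟩

theorem hasL1Deriv_primitive [CompleteSpace E] {c : ℝ} (hc : c ∈ Icc a b)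
    (hi : IntervalIntegrable f' volume a b) :
    HasL1Deriv a b (fun s => ∫ r in c..s, f' r) f' :=
  .of_base hc hi fun s _ => by simp

variable [CompleteSpace E] [CompleteSpace F] [CompleteSpace G]

theorem HasL1Deriv.clm (h : HasL1Deriv a b f f') (L : E →L[ℝ] F) :
    HasL1Deriv a b (fun s => L (f s)) (fun s => L (f' s)) := by
  refine ⟨⟨L.integrable_comp h.integrable.1, L.integrable_comp h.integrable.2⟩, fun s hs => ?_⟩
  have ha : a ∈ Icc a b := ⟨le_rfl, hs.1.trans hs.2⟩
  rw [L.intervalIntegral_comp_comm (h.integrable_of_mem ha hs), ← map_add, ← h.eq s hs]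

theorem setIntegral_Ioc_indicator_Iic {r : ℝ} (hr : r ∈ Ioc a b) (h : ℝ → E) :
    ∫ s in Ioc a b, (Iic r).indicator h s = ∫ s in a..r, h s := by
  rw [integral_indicator measurableSet_Iic, Measure.restrict_restrict measurableSet_Iic,
    intervalIntegral.integral_of_le hr.1.le]
  congr 2
  ext x
  simp only [mem_inter_iff, mem_Ioc, mem_Iic]
  exact ⟨fun h => ⟨h.2.1, h.1⟩, fun h => ⟨h.2, h.1, h.2.trans hr.2⟩⟩

theorem setIntegral_Ioc_indicator_Iio {r : ℝ} (hr : r ∈ Ioc a b) (h : ℝ → E) :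
    ∫ s in Ioc a b, (Iio r).indicator h s = ∫ s in a..r, h s := by
  rw [← setIntegral_Ioc_indicator_Iic hr]
  exact integral_congr_ae (indicator_ae_eq_of_ae_eq_set
    (ae_restrict_of_ae Iio_ae_eq_Iic))

/-- By Fubini the left side is the integral of L(f'(r), g'(s)) over the square; the diagonal cuts
the square into two triangles, one for each term on the right. -/
theorem integral_bilin_primitive (hab : a ≤ b) (L : E →L[ℝ] F →L[ℝ] G)
    (hf : IntervalIntegrable f' volume a b) (hg : IntervalIntegrable g' volume a b) :
    L (∫ r in a..b, f' r) (∫ r in a..b, g' r) =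
      (∫ r in a..b, L (f' r) (∫ s in a..r, g' s)) + ∫ r in a..b, L (∫ s in a..r, f' s) (g' r) := by
  rw [intervalIntegrable_iff_integrableOn_Ioc_of_le hab] at hf hg
  simp only [intervalIntegral.integral_of_le hab]
  set μ := volume.restrict (Ioc a b) with hμ
  have hfg : Integrable (fun p : ℝ × ℝ => L (f' p.1) (g' p.2)) (μ.prod μ) :=
    hf.op_fst_snd (op := fun x y => L x y) (by fun_prop)
      ⟨‖L‖, fun x y => L.le_opNorm₂ x y⟩ hg
  have hD : MeasurableSet {p : ℝ × ℝ | p.2 ≤ p.1} := measurableSet_le measurable_snd measurable_fst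
  have h0 : L (∫ r, f' r ∂μ) (∫ r, g' r ∂μ) = ∫ p, L (f' p.1) (g' p.2) ∂(μ.prod μ) :=
    (integral_prod_bilin L hf hg).symm
  rw [h0, ← integral_add_compl hD hfg, ← integral_indicator hD, ← integral_indicator hD.compl,
    integral_prod _ (hfg.indicator hD), integral_prod_symm _ (hfg.indicator hD.compl)]
  congr 1
  · refine setIntegral_congr_fun measurableSet_Ioc fun r hr => ?_
    have e : ∀ s, {p : ℝ × ℝ | p.2 ≤ p.1}.indicator (fun p => L (f' p.1) (g' p.2)) (r, s)
        = L (f' r) ((Iic r).indicator g' s) := by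
      intro s
      by_cases h : s ≤ r <;> simp [indicator, h]
    simp only [e]
    rw [(L (f' r)).integral_comp_comm (hg.indicator measurableSet_Iic),
      setIntegral_Ioc_indicator_Iic hr]
  · refine setIntegral_congr_fun measurableSet_Ioc fun r hr => ?_
    have e : ∀ s, {p : ℝ × ℝ | p.2 ≤ p.1}ᶜ.indicator (fun p => L (f' p.1) (g' p.2)) (s, r)
        = L.flip (g' r) ((Iio r).indicator f' s) := by
      intro s
      by_cases h : s < r <;> simp [indicator, h]
    simp only [e]
    rw [(L.flip (g' r)).integral_comp_comm (hf.indicator measurableSet_Iio),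
      setIntegral_Ioc_indicator_Iio hr]
    rfl

/-- The product rule. -/
theorem HasL1Deriv.bilin (hab : a ≤ b) (L : E →L[ℝ] F →L[ℝ] G) (hf : HasL1Deriv a b f f')
    (hg : HasL1Deriv a b g g') :
    HasL1Deriv a b (fun s => L (f s) (g s)) (fun s => L (f' s) (g s) + L (f s) (g' s)) := by
  have hi1 : IntervalIntegrable (fun s => L (f' s) (g s)) volume a b := by
    rw [intervalIntegrable_iff_integrableOn_Ioc_of_le hab]
    obtain ⟨C, hC⟩ := isCompact_Icc.exists_bound_of_continuousOn hg.continuousOn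
    have hm := (hg.continuousOn.mono Ioc_subset_Icc_self).aestronglyMeasurable (μ := volume)
      measurableSet_Ioc
    have hf1 := (intervalIntegrable_iff_integrableOn_Ioc_of_le hab).1 hf.integrable
    refine Integrable.mono' (hf1.norm.const_mul (‖L‖ * C))
      (L.aestronglyMeasurable_comp₂ hf1.1 hm) ?_
    refine (ae_restrict_iff' measurableSet_Ioc).2 (ae_of_all _ fun s hs => ?_)
    refine (L.le_opNorm₂ _ _).trans ?_
    have := hC s (Ioc_subset_Icc_self hs)
    nlinarith [mul_le_mul_of_nonneg_left this (mul_nonneg (norm_nonneg L) (norm_nonneg (f' s)))]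
  have hi2 : IntervalIntegrable (fun s => L (f s) (g' s)) volume a b := by
    rw [intervalIntegrable_iff_integrableOn_Ioc_of_le hab]
    obtain ⟨C, hC⟩ := isCompact_Icc.exists_bound_of_continuousOn hf.continuousOn
    have hm := (hf.continuousOn.mono Ioc_subset_Icc_self).aestronglyMeasurable (μ := volume)
      measurableSet_Ioc
    have hg1 := (intervalIntegrable_iff_integrableOn_Ioc_of_le hab).1 hg.integrable
    refine Integrable.mono' (hg1.norm.const_mul (‖L‖ * C))
      (L.aestronglyMeasurable_comp₂ hm hg1.1) ?_
    refine (ae_restrict_iff' measurableSet_Ioc).2 (ae_of_all _ fun s hs => ?_)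
    refine (L.le_opNorm₂ _ _).trans ?_
    have := hC s (Ioc_subset_Icc_self hs)
    nlinarith [mul_le_mul_of_nonneg_left this (mul_nonneg (norm_nonneg L) (norm_nonneg (g' s)))]
  refine ⟨hi1.add hi2, fun s hs => ?_⟩
  have ha : a ∈ Icc a b := ⟨le_rfl, hab⟩
  have hsub : uIcc a s ⊆ uIcc a b := by
    rw [uIcc_of_le hs.1, uIcc_of_le hab]; exact Icc_subset_Icc_right hs.2
  have j1 := hf.integrable_of_mem ha hs
  have j2 := hg.integrable_of_mem ha hs
  have c1 : IntervalIntegrable (fun r => L (f' r) (g a)) volume a s :=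
    ⟨(L.flip (g a)).integrable_comp j1.1, (L.flip (g a)).integrable_comp j1.2⟩
  have c2 : IntervalIntegrable (fun r => L (f a) (g' r)) volume a s :=
    ⟨(L (f a)).integrable_comp j2.1, (L (f a)).integrable_comp j2.2⟩
  -- Splitting g into g(a) plus its primitive reduces the product rule to
  -- `integral_bilin_primitive`, up to terms in which one factor is constant.
  have e1 : ∫ r in a..s, L (f' r) (g r)
      = L (∫ r in a..s, f' r) (g a) + ∫ r in a..s, L (f' r) (∫ q in a..r, g' q) := by
    have : ∫ r in a..s, L (f' r) (∫ q in a..r, g' q)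
        = ∫ r in a..s, (L (f' r) (g r) - L (f' r) (g a)) := by
      refine intervalIntegral.integral_congr fun r hr => ?_
      rw [uIcc_of_le hs.1] at hr
      rw [hg.eq r ⟨hr.1, hr.2.trans hs.2⟩, ← map_sub, add_sub_cancel_left]
    rw [this, intervalIntegral.integral_sub (hi1.mono_set hsub) c1]
    have := (L.flip (g a)).intervalIntegral_comp_comm j1
    simp only [ContinuousLinearMap.flip_apply] at this
    rw [this]
    abel
  have e2 : ∫ r in a..s, L (f r) (g' r)
      = L (f a) (∫ r in a..s, g' r) + ∫ r in a..s, L (∫ q in a..r, f' q) (g' r) := by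
    have : ∫ r in a..s, L (∫ q in a..r, f' q) (g' r)
        = ∫ r in a..s, (L (f r) (g' r) - L (f a) (g' r)) := by
      refine intervalIntegral.integral_congr fun r hr => ?_
      rw [uIcc_of_le hs.1] at hr
      rw [hf.eq r ⟨hr.1, hr.2.trans hs.2⟩, map_add, add_apply,
        add_sub_cancel_left]
    rw [this, intervalIntegral.integral_sub (hi2.mono_set hsub) c2,
      (L (f a)).intervalIntegral_comp_comm j2]
    abel
  rw [intervalIntegral.integral_add (hi1.mono_set hsub) (hi2.mono_set hsub), e1, e2,
    hf.eq s hs, hg.eq s hs]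
  simp only [map_add, add_apply]
  rw [integral_bilin_primitive hs.1 L j1 j2]
  abel

end Calculus

/-! ### Weak derivatives and indefinite integrals -/

section WeakDerivatives
variable {E : Type*} [NormedAddCommGroup E] [NormedSpace ℝ E] [CompleteSpace E] {l : ℝ}

theorem isWeakDeriv_const (hl : 0 ≤ l) (c : E) : IsWeakDeriv l 1 (fun _ => c) 0 := by
  intro φ hφ
  have hd := hφ.iterDeriv 1
  rw [iteratedDeriv_one] at hd
  simp only [iteratedDeriv_one, Pi.zero_apply, smul_zero, integral_zero]
  rw [integral_smul_const, ← integral_Ioc_eq_integral_Ioo,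
    ← intervalIntegral.integral_of_le hl,
    intervalIntegral.integral_deriv_eq_sub' _ rfl
      (fun x _ => (hφ.smooth.differentiable (by simp)).differentiableAt)
      hd.smooth.continuous.continuousOn,
    image_eq_zero_of_notMem_tsupport (x := (0:ℝ)) (fun hh => lt_irrefl _ (hφ.supp hh).1),
    image_eq_zero_of_notMem_tsupport (x := l) (fun hh => lt_irrefl _ (hφ.supp hh).2)]
  simp

theorem intervalIntegrable_iff_vol (hl : 0 ≤ l) {f : ℝ → E} :
    IntervalIntegrable f volume 0 l ↔ Integrable f (vol l) := by
  rw [intervalIntegrable_iff_integrableOn_Ioc_of_le hl, integrableOn_Ioc_iff_integrableOn_Ioo]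
  rfl

theorem integral_Ioo_vol {f : ℝ → E} {s : ℝ} (hs : s ∈ Icc 0 l) :
    ∫ r in Ioo s l, f r ∂(vol l) = ∫ r in s..l, f r := by
  rw [intervalIntegral.integral_of_le hs.2, integral_Ioc_eq_integral_Ioo,
    Measure.restrict_restrict measurableSet_Ioo]
  congr 2
  ext x
  simp only [mem_inter_iff, mem_Ioo]
  exact ⟨fun h => h.1, fun h => ⟨h, hs.1.trans_lt h.1, h.2⟩⟩

variable {f f' : ℝ → E}

theorem HasL1Deriv.integrable_vol (hl : 0 ≤ l) (h : HasL1Deriv 0 l f f') :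
    Integrable f' (vol l) := (intervalIntegrable_iff_vol hl).1 h.integrable

/-- Write f(s) = f(l) - ∫_s^l f' and use the weak derivative of a primitive based at l. -/
theorem HasL1Deriv.isWeakDeriv (hl : 0 ≤ l) (h : HasL1Deriv 0 l f f') : IsWeakDeriv l 1 f f' := by
  have hi := h.integrable_vol hl
  have h1 := (isWeakDeriv_primitive hi).const_smul (-1)
  have hP : Integrable (fun s => ∫ r in Ioo s l, f' r ∂(vol l)) (vol l) := by
    refine (integrable_of_continuousOn (l := l)
      (g := fun s => f l - f s) (continuousOn_const.sub h.continuousOn)).congr ?_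
    refine (ae_restrict_iff' measurableSet_Ioo).2 (ae_of_all _ fun s hs => ?_)
    have hs' := Ioo_subset_Icc_self hs
    simp only
    rw [integral_Ioo_vol hs', h.sub_eq hs' ⟨hl, le_rfl⟩]
  have h2 := (isWeakDeriv_const hl (f l)).add h1 (integrable_const _) (integrable_zero _ _ _)
    (hP.smul (-1 : ℝ)) (hi.neg.smul (-1 : ℝ))
  refine h2.congr ?_ (by simp)
  refine (ae_restrict_iff' measurableSet_Ioo).2 (ae_of_all _ fun s hs => ?_)
  have hs' := Ioo_subset_Icc_self hs
  simp only [Pi.add_apply, Pi.smul_apply]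
  rw [integral_Ioo_vol hs', ← h.sub_eq hs' ⟨hl, le_rfl⟩]
  simp

/-- A continuous function with an integrable weak derivative is its indefinite integral. -/
theorem HasL1Deriv.of_isWeakDeriv (hl : 0 < l) (hf : ContinuousOn f (Icc 0 l))
    (hi : Integrable f' (vol l)) (h : IsWeakDeriv l 1 f f') : HasL1Deriv 0 l f f' := by
  have h0 : (0 : ℝ) ∈ Icc 0 l := ⟨le_rfl, hl.le⟩
  have hP := hasL1Deriv_primitive h0 ((intervalIntegrable_iff_vol hl.le).2 hi)
  have hw := h.add ((hP.isWeakDeriv hl.le).const_smul (-1)) (integrable_of_continuousOn hf) hi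
    ((integrable_of_continuousOn hP.continuousOn).smul (-1 : ℝ)) (hi.smul (-1 : ℝ))
  -- Subtracting both the primitive and the constant f(0) leaves a continuous function with weak
  -- derivative zero that vanishes at 0.
  have hw2 := hw.add (isWeakDeriv_const hl.le (-f 0))
    ((integrable_of_continuousOn hf).add
      ((integrable_of_continuousOn hP.continuousOn).smul (-1 : ℝ)))
    (hi.add (hi.smul (-1 : ℝ))) (integrable_const _) (integrable_zero _ _ _)
  have := hw2.eq_zero hl ((hf.add (hP.continuousOn.const_smul (-1 : ℝ))).add continuousOn_const)
    (ae_of_all _ fun s => by simp) h0 (by simp)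
  refine ⟨(intervalIntegrable_iff_vol hl.le).2 hi, fun s hs => ?_⟩
  have h3 : f s + (-1 : ℝ) • (∫ r in 0..s, f' r) + -f 0 = 0 := this s hs
  rw [neg_smul, one_smul] at h3
  rw [← sub_eq_zero, ← h3]
  abel

/-- An integrable function with vanishing weak derivative is constant. -/
theorem IsWeakDeriv.ae_const (hl : 0 < l) {v : ℝ → E} (hf : Integrable f (vol l))
    (h : IsWeakDeriv l 1 f v) (hv : v =ᵐ[vol l] 0) : ∃ c : E, f =ᵐ[vol l] fun _ => c := by
  obtain ⟨θ, hθ, hθ1⟩ := exists_test hl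
  set c : E := ∫ s, θ s • f s ∂(vol l) with hc
  have hcst : IsWeakDeriv l 0 f (fun _ => c) := by
    intro φ hφ
    have hi : ∀ {η : ℝ → ℝ}, IsTest l η → Integrable η (vol l) := fun hη =>
      (hη.smooth.continuous.integrable_of_hasCompactSupport hη.compact).restrict
    set m := ∫ s, φ s ∂(vol l) with hm
    -- φ - mθ has mean zero, so it is the derivative of a test function, which may be inserted into
    -- the hypothesis.
    have hψ : IsTest l (fun s => φ s - m * θ s) := by
      have e : tsupport (fun s => φ s - m * θ s) ⊆ tsupport φ ∪ tsupport θ := by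
        refine closure_minimal ?_ ((isClosed_tsupport _).union (isClosed_tsupport _))
        intro s hs
        by_contra hn
        rw [mem_union, not_or] at hn
        refine hs ?_
        simp [image_eq_zero_of_notMem_tsupport hn.1, image_eq_zero_of_notMem_tsupport hn.2]
      exact ⟨hφ.smooth.sub (contDiff_const.mul hθ.smooth),
        (hφ.compact.isCompact.union hθ.compact.isCompact).of_isClosed_subset
          (isClosed_tsupport _) e, e.trans (union_subset hφ.supp hθ.supp)⟩
    have hψ0 : ∫ s, (φ s - m * θ s) ∂(vol l) = 0 := by
      rw [integral_sub (hi hφ) ((hi hθ).const_mul m), integral_const_mul, hθ1, mul_one, sub_self]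
    obtain ⟨Ψ, hΨ, hΨd⟩ := hψ.primitive hl hψ0
    have := h Ψ hΨ
    have e0 : (fun s => Ψ s • v s) =ᵐ[vol l] fun _ => (0 : E) :=
      hv.mono fun s hs => by simp [hs]
    rw [iteratedDeriv_one, hΨd, integral_congr_ae e0, integral_zero, smul_zero] at this
    simp only [sub_smul, mul_smul] at this
    rw [integral_sub (hφ.integrable_smul hf)
      (show Integrable (fun s => m • θ s • f s) (vol l) from (hθ.integrable_smul hf).smul m),
      integral_smul, sub_eq_zero, ← hc] at this
    simp only [iteratedDeriv_zero, pow_zero, one_smul]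
    rw [this, integral_smul_const]
  have hself : IsWeakDeriv l 0 f f := by intro φ hφ; simp
  exact ⟨c, hself.unique hcst hf (integrable_const c)⟩

/-- The absolutely continuous version of a function with an integrable weak derivative. -/
theorem IsWeakDeriv.exists_hasL1Deriv (hl : 0 < l) (hf : Integrable f (vol l))
    (hi : Integrable f' (vol l)) (h : IsWeakDeriv l 1 f f') :
    ∃ g, f =ᵐ[vol l] g ∧ HasL1Deriv 0 l g f' := by
  have hP := hasL1Deriv_primitive (c := 0) ⟨le_rfl, hl.le⟩
    ((intervalIntegrable_iff_vol hl.le).2 hi)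
  have hPi := integrable_of_continuousOn hP.continuousOn
  have hw := h.add ((hP.isWeakDeriv hl.le).const_smul (-1)) hf hi (hPi.smul (-1 : ℝ))
    (hi.smul (-1 : ℝ))
  obtain ⟨c, hc⟩ := hw.ae_const hl (hf.add (hPi.smul (-1 : ℝ))) (ae_of_all _ fun s => by simp)
  refine ⟨fun s => c + ∫ r in 0..s, f' r, hc.mono fun s hs => ?_, ?_⟩
  · have h3 : f s + (-1 : ℝ) • (∫ r in 0..s, f' r) = c := hs
    rw [← h3, neg_smul, one_smul]
    simp
  · simpa using (hasL1Deriv_const 0 l c).add hP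

theorem IsWeakDeriv.ae_eq (h : IsWeakDeriv l 0 f f') (hf : Integrable f (vol l))
    (hf' : Integrable f' (vol l)) : f =ᵐ[vol l] f' :=
  IsWeakDeriv.unique (u := f) (fun φ hφ => by simp) h hf hf'

end WeakDerivatives

/-! ### The unitary group generated by the inverse of a bounded skew-adjoint operator -/

section Group
variable {H : Type*} [NormedAddCommGroup H] [InnerProductSpace ℝ H] [CompleteSpace H]

theorem inner_skew {X : H →L[ℝ] H} (hX : star X = -X) (x y : H) : ⟪X x, y⟫_ℝ = -⟪x, X y⟫_ℝ := by
  rw [← ContinuousLinearMap.adjoint_inner_right, ← ContinuousLinearMap.star_eq_adjoint, hX]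
  simp

theorem inner_exp_skew {X : H →L[ℝ] H} (hX : star X = -X) (t : ℝ) (x y : H) :
    ⟪NormedSpace.exp (t • X) x, y⟫_ℝ = ⟪x, NormedSpace.exp ((-t) • X) y⟫_ℝ := by
  rw [← ContinuousLinearMap.adjoint_inner_right, ← ContinuousLinearMap.star_eq_adjoint,
    NormedSpace.star_exp, star_smul, hX]
  simp

theorem exp_add_smul (X : H →L[ℝ] H) (s t : ℝ) :
    NormedSpace.exp ((s + t) • X) = NormedSpace.exp (s • X) * NormedSpace.exp (t • X) := by
  rw [add_smul]
  let : NormedAlgebra ℚ (H →L[ℝ] H) := NormedAlgebra.restrictScalars ℚ ℝ _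
  exact NormedSpace.exp_add_of_commute (((Commute.refl X).smul_left s).smul_right t)

theorem norm_exp_skew {X : H →L[ℝ] H} (hX : star X = -X) (t : ℝ) (x : H) :
    ‖NormedSpace.exp (t • X) x‖ = ‖x‖ := by
  have h1 : ⟪NormedSpace.exp (t • X) x, NormedSpace.exp (t • X) x⟫_ℝ = ⟪x, x⟫_ℝ := by
    rw [inner_exp_skew hX, ← mul_apply_eq_comp, ← exp_add_smul]
    simp
  rw [real_inner_self_eq_norm_sq, real_inner_self_eq_norm_sq] at h1
  exact (sq_eq_sq₀ (norm_nonneg _) (norm_nonneg _)).1 h1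

theorem hasDerivAt_exp_apply (X : H →L[ℝ] H) (x : H) (t : ℝ) :
    HasDerivAt (fun u : ℝ => NormedSpace.exp (u • X) x) (NormedSpace.exp (t • X) (X x)) t := by
  have := hasDerivAt_exp_smul_const (𝕂 := ℝ) X t
  exact this.clm_apply (hasDerivAt_const t x) |>.congr_deriv (by simp)

theorem norm_exp_skew_sub_le {X : H →L[ℝ] H} (hX : star X = -X) (t : ℝ) (x : H) :
    ‖NormedSpace.exp (t • X) x - x‖ ≤ |t| * ‖X x‖ := by
  have := convex_univ.norm_image_sub_le_of_norm_hasDerivWithin_le (𝕜 := ℝ)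
    (f := fun u : ℝ => NormedSpace.exp (u • X) x)
    (f' := fun u => NormedSpace.exp (u • X) (X x)) (C := ‖X x‖)
    (fun u _ => (hasDerivAt_exp_apply X x u).hasDerivWithinAt)
    (fun u _ => (norm_exp_skew hX u _).le) (mem_univ 0) (mem_univ t)
  simpa [mul_comm] using this

/-- A uniform bound carries strong convergence from a dense set to the whole space. -/
theorem tendsto_zero_of_denseRange {ι : Type*} {f : Filter ι} {T : ι → H →L[ℝ] H} {C : ℝ}
    (hT : ∀ n x, ‖T n x‖ ≤ C * ‖x‖) {α : Type*} {P : α → H} (hP : DenseRange P)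
    (h : ∀ a, Tendsto (fun n => T n (P a)) f (𝓝 0)) (x : H) :
    Tendsto (fun n => T n x) f (𝓝 0) := by
  rw [Metric.tendsto_nhds]
  intro ε hε
  set D := |C| + 1 with hD
  have hDp : 0 < D := by positivity
  obtain ⟨a, ha⟩ := Metric.denseRange_iff.1 hP x (ε / (2 * D)) (by positivity)
  filter_upwards [Metric.tendsto_nhds.1 (h a) (ε / 2) (by positivity)] with n hn
  rw [dist_zero_right] at hn ⊢
  have h1 : ‖T n (x - P a)‖ ≤ D * ‖x - P a‖ := (hT n _).trans
    (mul_le_mul_of_nonneg_right ((le_abs_self C).trans (by linarith)) (norm_nonneg _))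
  rw [dist_eq_norm] at ha
  have h2 : D * ‖x - P a‖ < ε / 2 := by
    calc D * ‖x - P a‖ < D * (ε / (2 * D)) := mul_lt_mul_of_pos_left ha hDp
      _ = ε / 2 := by field_simp
  calc ‖T n x‖ = ‖T n (x - P a) + T n (P a)‖ := by rw [← map_add, sub_add_cancel]
    _ ≤ ‖T n (x - P a)‖ + ‖T n (P a)‖ := norm_add_le _ _
    _ < ε := by linarith

variable {K : H →L[ℝ] H} (hK : star K = -K)
include hK

/-- The orthogonal complement of the range is the kernel of K* = -K, which is trivial. -/
theorem denseRange_skew (hinj : Function.Injective K) : DenseRange K := by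
  have h : (LinearMap.range (K : H →ₗ[ℝ] H))ᗮ = ⊥ := by
    rw [eq_bot_iff]
    intro x hx
    have h1 : K x = 0 := by
      refine ext_inner_left ℝ fun y => ?_
      have := Submodule.inner_right_of_mem_orthogonal (LinearMap.mem_range_self (K : H →ₗ[ℝ] H) y) hx
      have h2 := inner_skew hK y x
      rw [inner_zero_right]
      change ⟪K y, x⟫_ℝ = 0 at this
      linarith
    exact hinj (by rw [h1, map_zero])
  have := (Submodule.topologicalClosure_eq_top_iff).2 h
  exact (Submodule.dense_iff_topologicalClosure_eq_top).2 this

/-- Coercivity: skewness gives ⟨(ε - K²)x, x⟩ = ε‖x‖² + ‖Kx‖². -/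
theorem isUnit_sub_sq {ε : ℝ} (hε : 0 < ε) : IsUnit (ε • (1 : H →L[ℝ] H) - K * K) := by
  refine ContinuousLinearMap.isUnit_of_forall_le_norm_inner_map _ (c := ⟨ε, hε.le⟩) hε fun x => ?_
  have : ⟪(ε • (1 : H →L[ℝ] H) - K * K) x, x⟫_ℝ = ε * ‖x‖ ^ 2 + ‖K x‖ ^ 2 := by
    simp [inner_sub_left, real_inner_smul_left, inner_skew hK (K x)]
  rw [this, Real.norm_of_nonneg (by positivity)]
  change ‖x‖ ^ 2 * ε ≤ _
  nlinarith [sq_nonneg ‖K x‖]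

omit hK in
/-- The resolvent `(ε - K²)⁻¹`. -/
def sqResolvent (K : H →L[ℝ] H) (ε : ℝ) : H →L[ℝ] H := Ring.inverse (ε • 1 - K * K)

theorem sqResolvent_mul {ε : ℝ} (hε : 0 < ε) :
    sqResolvent K ε * (ε • 1 - K * K) = 1 := Ring.inverse_mul_cancel _ (isUnit_sub_sq hK hε)

theorem mul_sqResolvent {ε : ℝ} (hε : 0 < ε) :
    (ε • 1 - K * K) * sqResolvent K ε = 1 := Ring.mul_inverse_cancel _ (isUnit_sub_sq hK hε)

theorem commute_sqResolvent {ε : ℝ} (hε : 0 < ε) {X : H →L[ℝ] H} (hX : Commute K X) :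
    Commute X (sqResolvent K ε) := by
  have h : X * (ε • 1 - K * K) = (ε • 1 - K * K) * X := by
    have : Commute X (ε • 1 - K * K) :=
      ((Commute.one_right X).smul_right ε).sub_right (hX.symm.mul_right hX.symm)
    exact this
  calc X * sqResolvent K ε = sqResolvent K ε * (ε • 1 - K * K) * (X * sqResolvent K ε) := by
        rw [sqResolvent_mul hK hε, one_mul]
    _ = sqResolvent K ε * X * ((ε • 1 - K * K) * sqResolvent K ε) := by
        rw [mul_assoc, ← mul_assoc _ X, ← h]; simp only [mul_assoc]
    _ = _ := by rw [mul_sqResolvent hK hε, mul_one]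

theorem star_sqResolvent (ε : ℝ) : star (sqResolvent K ε) = sqResolvent K ε := by
  rw [sqResolvent, ← Ring.inverse_star]
  simp [hK]

/-- Pair the resolvent equation εy - K²y = x with y. -/
theorem norm_sqResolvent_le {ε : ℝ} (hε : 0 < ε) (x : H) : ‖ε • sqResolvent K ε x‖ ≤ ‖x‖ := by
  set y := sqResolvent K ε x with hy
  have h1 : ε • y - K (K y) = x := by
    have := congrArg (fun X : H →L[ℝ] H => X x) (mul_sqResolvent hK hε)
    simpa using this
  have h2 : ⟪x, y⟫_ℝ = ε * ‖y‖ ^ 2 + ‖K y‖ ^ 2 := by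
    rw [← h1]
    simp [inner_sub_left, real_inner_smul_left, inner_skew hK (K y)]
  have h3 := real_inner_le_norm x y
  rw [norm_smul, Real.norm_of_nonneg hε.le]
  rcases (norm_nonneg y).eq_or_lt with h0 | h0
  · rw [← h0]; simp
  · have : ε * ‖y‖ * ‖y‖ ≤ ‖x‖ * ‖y‖ := by nlinarith [sq_nonneg ‖K y‖]
    exact le_of_mul_le_mul_right this h0

omit hK in
/-- The bounded approximations `-K(ε - K²)⁻¹` of the inverse of `K`. -/
def yosida (K : H →L[ℝ] H) (n : ℕ) : H →L[ℝ] H := -(K * sqResolvent K (1 / ((n : ℝ) + 1)))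

theorem star_yosida (n : ℕ) : star (yosida K n) = -yosida K n := by
  have hε : 0 < 1 / ((n : ℝ) + 1) := Nat.one_div_pos_of_nat
  rw [yosida, star_neg, star_mul, star_sqResolvent hK, hK, mul_neg, neg_neg,
    (commute_sqResolvent hK hε (Commute.refl K)).eq, neg_neg]

theorem commute_yosida (n : ℕ) {X : H →L[ℝ] H} (hX : Commute K X) : Commute X (yosida K n) :=
  (hX.symm.mul_right (commute_sqResolvent hK Nat.one_div_pos_of_nat hX)).neg_right

/-- This is the resolvent identity -K²(ε - K²)⁻¹ = 1 - ε(ε - K²)⁻¹. It shows in which sense the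
approximations tend to K⁻¹: the error on Kx is εRx with R = (ε - K²)⁻¹. -/
theorem yosida_mul_apply (n : ℕ) (x : H) : yosida K n (K x) =
    x - (1 / ((n : ℝ) + 1)) • sqResolvent K (1 / ((n : ℝ) + 1)) x := by
  have hε : 0 < 1 / ((n : ℝ) + 1) := Nat.one_div_pos_of_nat
  have h1 : yosida K n * K = -(K * K * sqResolvent K (1 / ((n : ℝ) + 1))) := by
    rw [yosida, neg_mul, mul_assoc, ← (commute_sqResolvent hK hε (Commute.refl K)).eq, mul_assoc]
  have h2 := mul_sqResolvent hK hε
  rw [sub_mul, sub_eq_iff_eq_add, ← sub_eq_iff_eq_add'] at h2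
  have h3 := congrArg (fun X : H →L[ℝ] H => X x) h1
  rw [← h2] at h3
  simpa using h3

/-- The operators εR with R = (ε - K²)⁻¹ are contractions, so the dense range of K² suffices. There
RK²y = εRy - y has norm at most 2‖y‖, and the extra factor ε tends to zero. -/
theorem tendsto_sqResolvent (hinj : Function.Injective K) (x : H) :
    Tendsto (fun n : ℕ => (1 / ((n : ℝ) + 1)) • sqResolvent K (1 / ((n : ℝ) + 1)) x)
      atTop (𝓝 0) := by
  have hd := denseRange_skew hK hinj
  refine tendsto_zero_of_denseRange (C := 1) (P := fun y => K (K y))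
    (T := fun n : ℕ => (1 / ((n : ℝ) + 1)) • sqResolvent K (1 / ((n : ℝ) + 1)))
    (fun n x => by
      rw [one_mul]; exact norm_sqResolvent_le hK Nat.one_div_pos_of_nat x)
    (hd.comp hd K.continuous) (fun y => ?_) x
  refine squeeze_zero_norm (a := fun n : ℕ => (1 / ((n : ℝ) + 1)) * (2 * ‖y‖)) (fun n => ?_) ?_
  · have hε : 0 < 1 / ((n : ℝ) + 1) := Nat.one_div_pos_of_nat
    have h1 := congrArg (fun X : H →L[ℝ] H => X y) (sqResolvent_mul hK hε)
    have h2 : sqResolvent K (1 / ((n : ℝ) + 1)) (K (K y)) =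
      (1 / ((n : ℝ) + 1)) • sqResolvent K (1 / ((n : ℝ) + 1)) y - y := by
      simp only [mul_sub, mul_apply_eq_comp, sub_apply, mul_smul_comm,
        mul_one, smul_apply] at h1
      rw [sub_eq_iff_eq_add] at h1
      rw [h1]
      exact (add_sub_cancel_left _ _).symm
    rw [smul_apply, norm_smul, Real.norm_of_nonneg hε.le, h2]
    refine mul_le_mul_of_nonneg_left ((norm_sub_le _ _).trans ?_) hε.le
    linarith [norm_sqResolvent_le hK hε y]
  · simpa using tendsto_one_div_add_atTop_nhds_zero_nat.mul_const (2 * ‖y‖)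

theorem tendsto_yosida (hinj : Function.Injective K) (x : H) :
    Tendsto (fun n => yosida K n (K x)) atTop (𝓝 x) := by
  simp only [yosida_mul_apply hK]
  simpa using (tendsto_sqResolvent hK hinj x).const_sub x

omit hK in
/-- `S` is the unitary group generated by the inverse of `K`. -/
structure IsGroupOfInverse (K : H →L[ℝ] H) (S : ℝ → H →L[ℝ] H) : Prop where
  norm_eq : ∀ t x, ‖S t x‖ = ‖x‖
  zero : S 0 = 1
  add : ∀ s t, S (s + t) = S s * S t
  inner_eq : ∀ t x y, ⟪S t x, y⟫_ℝ = ⟪x, S (-t) y⟫_ℝ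
  comm : ∀ t x, S t (K x) = K (S t x)
  continuous : ∀ x, Continuous fun t => S t x
  hasDerivAt : ∀ x t, HasDerivAt (fun t => S t (K x)) (S t x) t

/-- S(t) is the strong limit of exp(tYₙ), where Yₙ = `yosida K n`. The Yₙ are skew-adjoint, so these
exponentials are isometries, and they commute with each other, so two of them differ on Ky by at
most |t|‖(Yₙ - Yₘ)Ky‖. This tends to zero, and the range of K is dense. -/
theorem exists_isGroupOfInverse (hinj : Function.Injective K) :
    ∃ S : ℝ → H →L[ℝ] H, IsGroupOfInverse K S := by
  have hd := denseRange_skew hK hinj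
  let Sn : ℕ → ℝ → H →L[ℝ] H := fun n t => NormedSpace.exp (t • yosida K n)
  have hnorm : ∀ n t x, ‖Sn n t x‖ = ‖x‖ := fun n t x => norm_exp_skew (star_yosida hK n) t x
  have hcauchy : ∀ t x, CauchySeq fun n => Sn n t x := by
    intro t x
    have hdiff : ∀ n m y, ‖Sn n t (K y) - Sn m t (K y)‖
        ≤ |t| * ‖yosida K n (K y) - yosida K m (K y)‖ := by
      intro n m y
      have hc : Commute (yosida K m) (yosida K n) :=
        commute_yosida hK n (commute_yosida hK m (Commute.refl K))
      let : NormedAlgebra ℚ (H →L[ℝ] H) := NormedAlgebra.restrictScalars ℚ ℝ _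
      have e : Sn n t = Sn m t * NormedSpace.exp (t • (yosida K n - yosida K m)) := by
        rw [← NormedSpace.exp_add_of_commute, ← smul_add, add_sub_cancel]
        exact ((hc.sub_right (Commute.refl _)).smul_left t).smul_right t
      have h := norm_exp_skew_sub_le (X := yosida K n - yosida K m)
        (by rw [star_sub, star_yosida hK, star_yosida hK]; abel) t (K y)
      rw [e, mul_apply_eq_comp, ← map_sub, hnorm]
      simpa using h
    rw [Metric.cauchySeq_iff]
    intro ε hε
    obtain ⟨y, hy⟩ := Metric.denseRange_iff.1 hd x (ε / 3) (by positivity)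
    obtain ⟨N, hN⟩ := Metric.cauchySeq_iff.1 (tendsto_yosida hK hinj y).cauchySeq
      (ε / (3 * (|t| + 1))) (by positivity)
    refine ⟨N, fun n hn m hm => ?_⟩
    have h1 := hN n hn m hm
    rw [dist_eq_norm] at h1 hy ⊢
    have h2 : |t| * ‖yosida K n (K y) - yosida K m (K y)‖ < ε / 3 := by
      have h3 : (|t| + 1) * ‖yosida K n (K y) - yosida K m (K y)‖ < ε / 3 := by
        calc _ < (|t| + 1) * (ε / (3 * (|t| + 1))) := mul_lt_mul_of_pos_left h1 (by positivity)
          _ = ε / 3 := by field_simp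
      nlinarith [norm_nonneg (yosida K n (K y) - yosida K m (K y))]
    have e : Sn n t x - Sn m t x = Sn n t (x - K y) - Sn m t (x - K y)
        + (Sn n t (K y) - Sn m t (K y)) := by
      simp only [map_sub]; abel
    calc ‖Sn n t x - Sn m t x‖
        ≤ ‖Sn n t (x - K y)‖ + ‖Sn m t (x - K y)‖ + ‖Sn n t (K y) - Sn m t (K y)‖ := by
          rw [e]; exact (norm_add_le _ _).trans (add_le_add_left (norm_sub_le _ _) _)
      _ < ε := by
          rw [hnorm, hnorm]; linarith [hdiff n m y]
  choose f hf using fun t x => cauchySeq_tendsto_of_complete (hcauchy t x)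
  let S : ℝ → H →L[ℝ] H := fun t =>
    continuousLinearMapOfTendsto (fun n => Sn n t) (f := f t) (tendsto_pi_nhds.2 (hf t))
  have hS : ∀ t x, Tendsto (fun n => Sn n t x) atTop (𝓝 (S t x)) := hf
  have hSnorm : ∀ t x, ‖S t x‖ = ‖x‖ := fun t x =>
    tendsto_nhds_unique (hS t x).norm (by simp [hnorm])
  -- strong convergence is preserved under composition
  have hcomp : ∀ t (x : ℕ → H) y, Tendsto x atTop (𝓝 y) →
      Tendsto (fun n => Sn n t (x n)) atTop (𝓝 (S t y)) := by
    intro t x y hx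
    have h1 : Tendsto (fun n => Sn n t (x n - y)) atTop (𝓝 0) := by
      rw [tendsto_zero_iff_norm_tendsto_zero]
      simp only [hnorm]
      exact tendsto_iff_norm_sub_tendsto_zero.1 hx
    simpa using h1.add (hS t y)
  have hadd : ∀ s t, S (s + t) = S s * S t := by
    intro s t
    ext x
    refine tendsto_nhds_unique (hS (s + t) x) ?_
    have : ∀ n, Sn n (s + t) x = Sn n s (Sn n t x) := fun n => by
      simp only [Sn, exp_add_smul, mul_apply_eq_comp]
    simp only [this]
    exact hcomp s _ _ (hS t x)
  have hzero : S 0 = 1 := by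
    ext x
    exact tendsto_nhds_unique (hS 0 x) (by simp [Sn])
  -- On the range of K the orbits are Lipschitz at 0; density then gives strong continuity at 0, and
  -- the group law gives it everywhere.
  have hlip : ∀ t x, ‖S t (K x) - K x‖ ≤ |t| * ‖x‖ := by
    intro t x
    refine le_of_tendsto_of_tendsto' ((hS t (K x)).sub_const (K x)).norm
      ((tendsto_yosida hK hinj x).norm.const_mul |t|) fun n => ?_
    exact norm_exp_skew_sub_le (star_yosida hK n) t (K x)
  have hcont0 : ∀ x, Tendsto (fun t => (S t - 1) x) (𝓝 0) (𝓝 0) := by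
    refine tendsto_zero_of_denseRange (C := 2) (fun t x => ?_) hd fun y => ?_
    · refine (norm_sub_le _ _).trans ?_
      change ‖S t x‖ + ‖x‖ ≤ 2 * ‖x‖
      rw [hSnorm]
      linarith
    · refine squeeze_zero_norm (a := fun t : ℝ => |t| * ‖y‖) (fun t => hlip t y) ?_
      simpa using (continuous_abs.tendsto (0 : ℝ)).mul_const ‖y‖
  have hcont : ∀ x, Continuous fun t => S t x := by
    intro x
    rw [continuous_iff_continuousAt]
    intro t
    rw [ContinuousAt, tendsto_iff_norm_sub_tendsto_zero]
    have h1 : ∀ s, ‖S s x - S t x‖ = ‖(S (s - t) - 1) x‖ := by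
      intro s
      have : S s = S t * S (s - t) := by rw [← hadd, add_sub_cancel]
      rw [this, mul_apply_eq_comp, ← map_sub, hSnorm]
      simp
    simp only [h1]
    have h2 : Tendsto (fun s => s - t) (𝓝 t) (𝓝 0) := by
      simpa using (continuous_sub_right t).tendsto t
    simpa using ((hcont0 x).comp h2).norm
  have hcomm : ∀ t x, S t (K x) = K (S t x) := by
    intro t x
    refine tendsto_nhds_unique (hS t (K x)) ?_
    have : ∀ n, Sn n t (K x) = K (Sn n t x) := fun n => by
      have h := ((commute_yosida hK n (Commute.refl K)).smul_right t).exp_right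
      exact (congrArg (fun X : H →L[ℝ] H => X x) h.eq).symm
    simp only [this]
    exact (K.continuous.tendsto _).comp (hS t x)
  -- The integrated equation passes to the limit by dominated convergence. The bound 2‖x‖ holds
  -- because YₙKx = x - εRx with ‖εRx‖ ≤ ‖x‖.
  have hint : ∀ x t, S t (K x) = K x + ∫ r in (0 : ℝ)..t, S r x := by
    intro x t
    refine tendsto_nhds_unique (hS t (K x)) ?_
    have h1 : ∀ n, Sn n t (K x) = K x + ∫ r in (0 : ℝ)..t, Sn n r (yosida K n (K x)) := by
      intro n
      rw [intervalIntegral.integral_eq_sub_of_hasDerivAt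
        (fun u _ => hasDerivAt_exp_apply (yosida K n) (K x) u)]
      · simp [Sn]
      · refine Continuous.intervalIntegrable ?_ _ _
        exact continuous_iff_continuousAt.2 fun u =>
          (hasDerivAt_exp_apply (yosida K n) (yosida K n (K x)) u).continuousAt
    simp only [h1]
    refine tendsto_const_nhds.add ?_
    refine intervalIntegral.tendsto_integral_filter_of_dominated_convergence
      (fun _ => 2 * ‖x‖) ?_ ?_ (by simp) (ae_of_all _ fun r _ =>
        hcomp r _ _ (tendsto_yosida hK hinj x))
    · refine Eventually.of_forall fun n => Continuous.aestronglyMeasurable ?_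
      exact continuous_iff_continuousAt.2 fun u =>
          (hasDerivAt_exp_apply (yosida K n) (yosida K n (K x)) u).continuousAt
    · refine Eventually.of_forall fun n => ae_of_all _ fun r _ => ?_
      rw [hnorm, yosida_mul_apply hK]
      refine (norm_sub_le _ _).trans ?_
      linarith [norm_sqResolvent_le hK (Nat.one_div_pos_of_nat (n := n) (α := ℝ)) x]
  refine ⟨S, hSnorm, hzero, hadd, fun t x y => ?_, hcomm, hcont, fun x t => ?_⟩
  · refine tendsto_nhds_unique ((hS t x).inner tendsto_const_nhds) ?_
    have : ∀ n, ⟪Sn n t x, y⟫_ℝ = ⟪x, Sn n (-t) y⟫_ℝ := fun n =>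
      inner_exp_skew (star_yosida hK n) t x y
    simp only [this]
    exact tendsto_const_nhds.inner (hS (-t) y)
  · simp only [hint x]
    exact (intervalIntegral.integral_hasDerivAt_right ((hcont x).intervalIntegrable _ _)
      (hcont x).stronglyMeasurable.stronglyMeasurableAtFilter
      (hcont x).continuousAt).const_add _

end Group

/-! ### Linear equations with bounded, strongly measurable coefficients -/

section Ode
variable {E : Type*} [NormedAddCommGroup E] [NormedSpace ℝ E]

/-- A strongly measurable family of operators maps measurable functions to measurable functions. -/
theorem aestronglyMeasurable_family_apply {α F : Type*} [MeasurableSpace α] {μ : Measure α}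
    [NormedAddCommGroup F] [NormedSpace ℝ F] {C : α → E →L[ℝ] F}
    (hC : ∀ x, AEStronglyMeasurable (fun t => C t x) μ) {f : α → E}
    (hf : AEStronglyMeasurable f μ) : AEStronglyMeasurable (fun t => C t (f t)) μ := by
  -- For a simple function only finitely many of the functions t ↦ C(t)y occur; the general case is
  -- a pointwise limit, as each C(t) is continuous.
  have h1 : ∀ φ : SimpleFunc α E, AEStronglyMeasurable (fun t => C t (φ t)) μ := by
    intro φ
    have e : (fun t => C t (φ t)) =
        fun t => ∑ y ∈ φ.range, (φ ⁻¹' {y}).indicator (fun t => C t y) t := by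
      ext t
      rw [Finset.sum_eq_single (φ t)]
      · simp
      · intro y _ hy
        exact indicator_of_notMem (fun h => hy (by simpa using h.symm)) _
      · intro h
        exact absurd (φ.mem_range_self t) h
    rw [e]
    exact Finset.aestronglyMeasurable_fun_sum _ fun y _ =>
      (hC y).indicator (φ.measurableSet_preimage _)
  have h2 : AEStronglyMeasurable (fun t => C t (hf.mk f t)) μ :=
    aestronglyMeasurable_of_tendsto_ae atTop (fun n => h1 (hf.stronglyMeasurable_mk.approx n))
      (ae_of_all _ fun t => ((C t).continuous.tendsto _).comp
        (hf.stronglyMeasurable_mk.tendsto_approx t))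
  exact h2.congr (hf.ae_eq_mk.symm.mono fun t ht => by simp only [ht])

/-- A family of operators on `[0, T]` that is bounded by `M` and strongly measurable. -/
structure IsBddFamily (T M : ℝ) (C : ℝ → E →L[ℝ] E) : Prop where
  norm_le : ∀ t ∈ Icc 0 T, ‖C t‖ ≤ M
  measurable : ∀ x, AEStronglyMeasurable (fun t => C t x) (volume.restrict (Icc 0 T))

variable {T M : ℝ} {C : ℝ → E →L[ℝ] E}

theorem IsBddFamily.nonneg (hC : IsBddFamily T M C) (hT : 0 ≤ T) : 0 ≤ M :=
  (norm_nonneg _).trans (hC.norm_le 0 ⟨le_rfl, hT⟩)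

theorem IsBddFamily.integrableOn (hC : IsBddFamily T M C) {w : ℝ → E}
    (hw : ContinuousOn w (Icc 0 T)) : IntegrableOn (fun t => C t (w t)) (Icc 0 T) := by
  obtain ⟨D, hD⟩ := isCompact_Icc.exists_bound_of_continuousOn hw
  have : IsFiniteMeasure (volume.restrict (Icc (0 : ℝ) T)) := ⟨by simp⟩
  refine Integrable.of_bound (aestronglyMeasurable_family_apply hC.measurable
    (hw.aestronglyMeasurable measurableSet_Icc)) (M * D) ?_
  refine (ae_restrict_iff' measurableSet_Icc).2 (ae_of_all _ fun t ht => ?_)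
  exact ((C t).le_opNorm _).trans (mul_le_mul (hC.norm_le t ht) (hD t ht) (norm_nonneg _)
    ((norm_nonneg _).trans (hC.norm_le t ht)))

theorem intervalIntegrable_of_Icc {f : ℝ → E} (hf : IntegrableOn f (Icc 0 T)) {s t : ℝ}
    (hs : s ∈ Icc 0 T) (ht : t ∈ Icc 0 T) : IntervalIntegrable f volume s t :=
  (hf.mono_set (uIcc_subset_Icc hs ht)).intervalIntegrable

variable [CompleteSpace E]

/-- The Volterra operator `w ↦ ∫_τ^· C(r) w(r) dr` on `C([0, T]; E)`. -/
theorem exists_volterra (hT : 0 ≤ T) (hC : IsBddFamily T M C) {τ : ℝ} (hτ : τ ∈ Icc 0 T) :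
    ∃ V : C(Icc 0 T, E) →L[ℝ] C(Icc 0 T, E), ∀ w t,
      V w t = ∫ r in τ..t, C r (IccExtend hT w r) := by
  have hcont : ∀ w : C(Icc 0 T, E), ContinuousOn (IccExtend hT w) (Icc 0 T) := fun w =>
    w.continuous.Icc_extend'.continuousOn
  have hint : ∀ w : C(Icc 0 T, E), IntegrableOn (fun r => C r (IccExtend hT w r)) (Icc 0 T) :=
    fun w => hC.integrableOn (hcont w)
  have hcV : ∀ w : C(Icc 0 T, E),
      Continuous fun t : Icc 0 T => ∫ r in τ..t, C r (IccExtend hT w r) := fun w =>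
    continuousOn_iff_continuous_domRestrict.1 (hasL1Deriv_primitive hτ
      (intervalIntegrable_of_Icc (hint w) (left_mem_Icc.2 hT) (right_mem_Icc.2 hT))).continuousOn
  let V₀ : C(Icc 0 T, E) →ₗ[ℝ] C(Icc 0 T, E) :=
    { toFun := fun w => ⟨_, hcV w⟩
      map_add' := fun w w' => by
        ext t
        change ∫ r in τ..t, C r (IccExtend hT (w + w') r) = (∫ r in τ..t, C r (IccExtend hT w r))
          + ∫ r in τ..t, C r (IccExtend hT w' r)
        rw [← intervalIntegral.integral_add (intervalIntegrable_of_Icc (hint w) hτ t.2)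
          (intervalIntegrable_of_Icc (hint w') hτ t.2)]
        simp [IccExtend]
      map_smul' := fun c w => by
        ext t
        change ∫ r in τ..t, C r (IccExtend hT (c • w) r) = c • ∫ r in τ..t, C r (IccExtend hT w r)
        rw [← intervalIntegral.integral_smul]
        simp [IccExtend] }
  refine ⟨V₀.mkContinuous (M * T) fun w => ?_, fun w t => rfl⟩
  have hM := hC.nonneg hT
  rw [ContinuousMap.norm_le _ (by positivity)]
  intro t
  refine (intervalIntegral.norm_integral_le_of_norm_le_const (C := M * ‖w‖) fun r hr => ?_).trans ?_
  · have hr' : r ∈ Icc 0 T := uIcc_subset_Icc hτ t.2 (uIoc_subset_uIcc hr)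
    exact ((C r).le_opNorm _).trans (mul_le_mul (hC.norm_le r hr') (w.norm_coe_le_norm _)
      (norm_nonneg _) hM)
  · have : |(t : ℝ) - τ| ≤ T := by
      rw [abs_le]; constructor <;> linarith [t.2.1, t.2.2, hτ.1, hτ.2]
    calc M * ‖w‖ * |(t : ℝ) - τ| ≤ M * ‖w‖ * T := by gcongr
      _ = M * T * ‖w‖ := by ring

/-- Each iteration integrates |r - τ|ⁿ once more and so produces the factorial. The Neumann series
therefore converges without any smallness of M T, on both sides of τ. -/
theorem norm_volterra_pow_le (hT : 0 ≤ T) (hC : IsBddFamily T M C) {τ : ℝ} (hτ : τ ∈ Icc 0 T)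
    {V : C(Icc 0 T, E) →L[ℝ] C(Icc 0 T, E)}
    (hV : ∀ w t, V w t = ∫ r in τ..t, C r (IccExtend hT w r)) (n : ℕ) :
    ‖V ^ n‖ ≤ (M * T) ^ n / n.factorial := by
  have hM := hC.nonneg hT
  have key : ∀ n (w : C(Icc 0 T, E)) (t : Icc 0 T),
      ‖(V ^ n) w t‖ ≤ M ^ n * |(t : ℝ) - τ| ^ n / n.factorial * ‖w‖ := by
    intro n w
    induction n with
    | zero => intro t; simpa using w.norm_coe_le_norm t
    | succ n ih =>
      intro t
      rw [pow_succ', mul_apply_eq_comp, hV]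
      have h1 : ∀ r ∈ uIoc τ (t : ℝ), ‖C r (IccExtend hT ((V ^ n) w) r)‖
          ≤ M * (M ^ n * |r - τ| ^ n / n.factorial * ‖w‖) := by
        intro r hr
        have hr' : r ∈ Icc 0 T := uIcc_subset_Icc hτ t.2 (uIoc_subset_uIcc hr)
        rw [IccExtend_of_mem _ _ hr']
        exact ((C r).le_opNorm _).trans (mul_le_mul (hC.norm_le r hr') (ih ⟨r, hr'⟩)
          (norm_nonneg _) hM)
      rw [intervalIntegral.norm_intervalIntegral_eq]
      refine (norm_integral_le_of_norm_le (g := fun r =>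
        M * (M ^ n * |r - τ| ^ n / n.factorial * ‖w‖)) ?_
        ((ae_restrict_iff' measurableSet_uIoc).2 (ae_of_all _ h1))).trans ?_
      · have : Continuous fun r : ℝ => M * (M ^ n * |r - τ| ^ n / n.factorial * ‖w‖) := by
          fun_prop
        exact (this.intervalIntegrable _ _).def'
      · have e : ∀ r : ℝ, M * (M ^ n * |r - τ| ^ n / n.factorial * ‖w‖)
            = (M ^ (n + 1) / n.factorial * ‖w‖) * |r - τ| ^ n := fun r => by ring
        simp only [e]
        rw [integral_const_mul, integral_pow_abs_sub_uIoc, Nat.factorial_succ]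
        refine le_of_eq ?_
        push_cast
        field_simp
  refine ContinuousLinearMap.opNorm_le_bound _ (by positivity) fun w => ?_
  rw [ContinuousMap.norm_le _ (by positivity)]
  intro t
  refine (key n w t).trans ?_
  have : |(t : ℝ) - τ| ≤ T := by
    rw [abs_le]; constructor <;> linarith [t.2.1, t.2.2, hτ.1, hτ.2]
  rw [← mul_pow]
  gcongr

/-- R = 1 + aR will give existence of solutions, R = 1 + Ra uniqueness. -/
theorem exists_neumann {A : Type*} [NormedRing A] [CompleteSpace A] {a : A} {c : ℝ}
    (h : ∀ n : ℕ, ‖a ^ n‖ ≤ c ^ n / n.factorial) :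
    ∃ R : A, R = 1 + a * R ∧ R = 1 + R * a ∧ ‖R‖ ≤ Real.exp c := by
  have hexp : HasSum (fun n : ℕ => c ^ n / n.factorial) (Real.exp c) := by
    rw [Real.exp_eq_exp_ℝ]
    exact NormedSpace.expSeries_div_hasSum_exp c
  have hs : Summable fun n => a ^ n := Summable.of_norm_bounded hexp.summable h
  refine ⟨∑' n, a ^ n, ?_, ?_, tsum_of_norm_bounded hexp h⟩
  · conv_lhs => rw [hs.tsum_eq_zero_add]
    simp only [pow_zero, pow_succ', hs.tsum_mul_left]
  · conv_lhs => rw [hs.tsum_eq_zero_add]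
    simp only [pow_zero, pow_succ, hs.tsum_mul_right]

theorem exists_volterra_resolvent (hT : 0 ≤ T) (hC : IsBddFamily T M C) {τ : ℝ}
    (hτ : τ ∈ Icc 0 T) {V : C(Icc 0 T, E) →L[ℝ] C(Icc 0 T, E)}
    (hV : ∀ w t, V w t = ∫ r in τ..t, C r (IccExtend hT w r)) :
    ∃ R : C(Icc 0 T, E) →L[ℝ] C(Icc 0 T, E), R = 1 + V * R ∧ R = 1 + R * V ∧
      ‖R‖ ≤ Real.exp (M * T) :=
  exists_neumann (A := C(Icc 0 T, E) →L[ℝ] C(Icc 0 T, E)) (a := V) (norm_volterra_pow_le hT hC hτ hV)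

/-- Existence of the propagator of `w' = C(t) w`. -/
theorem exists_propagator (hT : 0 ≤ T) (hC : IsBddFamily T M C) :
    ∃ W : ℝ → ℝ → E →L[ℝ] E, ∀ τ ∈ Icc 0 T, (∀ t, ‖W t τ‖ ≤ Real.exp (M * T)) ∧
      ∀ x, W τ τ x = x ∧ HasL1Deriv 0 T (fun t => W t τ x) (fun t => C t (W t τ x)) := by
  have key : ∀ τ, ∃ W : ℝ → E →L[ℝ] E, τ ∈ Icc 0 T → (∀ t, ‖W t‖ ≤ Real.exp (M * T)) ∧
      ∀ x, W τ x = x ∧ HasL1Deriv 0 T (fun t => W t x) (fun t => C t (W t x)) := by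
    intro τ
    by_cases hτ : τ ∈ Icc 0 T
    swap
    · exact ⟨0, fun h => absurd h hτ⟩
    -- The equation is solved on all of [0, T], also for times before τ. The adjoint evolution
    -- relies on this.
    obtain ⟨V, hV⟩ := exists_volterra hT hC hτ
    obtain ⟨R, hR, -, hRn⟩ := exists_volterra_resolvent hT hC hτ hV
    let c : E →ₗ[ℝ] C(Icc 0 T, E) :=
      { toFun := fun x => ContinuousMap.const _ x
        map_add' := fun _ _ => rfl
        map_smul' := fun _ _ => rfl }
    have hc : ∀ x, ‖c x‖ ≤ ‖x‖ := fun x =>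
      (ContinuousMap.norm_le _ (norm_nonneg x)).2 fun _ => le_rfl
    let W : ℝ → E →L[ℝ] E := fun t => LinearMap.mkContinuous
      { toFun := fun x => R (c x) (projIcc 0 T hT t)
        map_add' := fun x y => by simp
        map_smul' := fun a x => by simp } (Real.exp (M * T)) fun x =>
        ((R (c x)).norm_coe_le_norm _).trans ((R.le_opNorm _).trans
          (mul_le_mul hRn (hc x) (norm_nonneg _) (Real.exp_pos _).le))
    have hW : ∀ t x, W t x = IccExtend hT (R (c x)) t := fun t x => rfl
    have heq : ∀ x, ∀ t ∈ Icc 0 T, W t x = x + ∫ r in τ..t, C r (W r x) := by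
      intro x t ht
      have := congrArg (fun X : C(Icc 0 T, E) →L[ℝ] C(Icc 0 T, E) => X (c x) ⟨t, ht⟩) hR
      rw [hW, IccExtend_of_mem _ _ ht]
      simp only [add_apply, one_apply_eq_self, mul_apply_eq_comp, ContinuousMap.add_apply, hV] at this
      exact this
    refine ⟨W, fun _ => ⟨fun t => LinearMap.mkContinuous_norm_le _ (Real.exp_pos _).le _,
      fun x => ⟨?_, ?_⟩⟩⟩
    · rw [heq x τ hτ]; simp
    · have h0 : W τ x = x := by rw [heq x τ hτ]; simp
      refine .of_base hτ (intervalIntegrable_of_Icc (hC.integrableOn ?_) ⟨le_rfl, hT⟩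
        ⟨hT, le_rfl⟩) fun t ht => ?_
      · exact (R (c x)).continuous.Icc_extend'.continuousOn
      · rw [h0]; exact heq x t ht
  choose W hW using key
  exact ⟨fun t τ => W τ t, fun τ hτ => hW τ hτ⟩

/-- Uniqueness for `w' = C(t) w`. -/
theorem HasL1Deriv.unique_of_family (hT : 0 ≤ T) (hC : IsBddFamily T M C) {w w' : ℝ → E}
    (hw : HasL1Deriv 0 T w fun t => C t (w t)) (hw' : HasL1Deriv 0 T w' fun t => C t (w' t))
    {τ : ℝ} (hτ : τ ∈ Icc 0 T) (h : w τ = w' τ) : ∀ t ∈ Icc 0 T, w t = w' t := by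
  obtain ⟨V, hV⟩ := exists_volterra hT hC hτ
  obtain ⟨R, -, hR, -⟩ := exists_volterra_resolvent hT hC hτ hV
  have hdc : Continuous fun t : Icc 0 T => w t - w' t :=
    continuousOn_iff_continuous_domRestrict.1 (hw.continuousOn.sub hw'.continuousOn)
  obtain ⟨d, hdd⟩ : ∃ d : C(Icc 0 T, E), ∀ t : Icc 0 T, d t = w t - w' t :=
    ⟨⟨_, hdc⟩, fun _ => rfl⟩
  have hd : V d = d := by
    ext t
    rw [hV]
    have e : ∀ r ∈ uIcc τ (t : ℝ), C r (IccExtend hT d r) = C r (w r) - C r (w' r) := by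
      intro r hr
      rw [IccExtend_of_mem _ _ (uIcc_subset_Icc hτ t.2 hr)]
      rw [hdd, map_sub]
    rw [intervalIntegral.integral_congr e, intervalIntegral.integral_sub
      (hw.integrable_of_mem hτ t.2) (hw'.integrable_of_mem hτ t.2), ← hw.sub_eq hτ t.2,
      ← hw'.sub_eq hτ t.2, h]
    rw [hdd]; abel
  -- Since Vd = d, the identity R = 1 + RV gives Rd = d + Rd.
  have h0 : d = 0 := by
    have := congrArg (fun X : C(Icc 0 T, E) →L[ℝ] C(Icc 0 T, E) => X d) hR
    simp only [add_apply, one_apply_eq_self, mul_apply_eq_comp, hd] at this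
    exact left_eq_add.1 (this.trans (add_comm _ _))
  intro t ht
  have := congrArg (fun f : C(Icc 0 T, E) => f ⟨t, ht⟩) h0
  rw [hdd] at this
  exact sub_eq_zero.1 this

end Ode

/-! ### Evolution systems for bounded perturbations of an inverse -/

section Evolution
variable {H : Type*} [NormedAddCommGroup H] [InnerProductSpace ℝ H] [CompleteSpace H]

theorem HasL1Deriv.inner {a b : ℝ} (hab : a ≤ b) {f f' g g' : ℝ → H} (hf : HasL1Deriv a b f f')
    (hg : HasL1Deriv a b g g') :
    HasL1Deriv a b (fun s => ⟪f s, g s⟫_ℝ) (fun s => ⟪f' s, g s⟫_ℝ + ⟪f s, g' s⟫_ℝ) :=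
  hf.bilin hab (isBoundedBilinearMap_inner (𝕜 := ℝ) (E := H)).toContinuousLinearMap hg

/-- Once the candidate derivative is integrable, the integral equation may be checked against each
vector z, where the unitary group can be moved to z. -/
theorem HasL1Deriv.of_inner {a b : ℝ} {f f' : ℝ → H} (hi : IntervalIntegrable f' volume a b)
    (h : ∀ z, HasL1Deriv a b (fun s => ⟪f s, z⟫_ℝ) (fun s => ⟪f' s, z⟫_ℝ)) :
    HasL1Deriv a b f f' := by
  refine ⟨hi, fun s hs => ext_inner_right ℝ fun z => ?_⟩
  have hi' : IntervalIntegrable f' volume a s := hi.mono_set (by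
    rw [uIcc_of_le hs.1, uIcc_of_le (hs.1.trans hs.2)]; exact Icc_subset_Icc_right hs.2)
  rw [(h z).eq s hs, inner_add_left]
  congr 1
  have := ((innerSL ℝ z : H →L[ℝ] ℝ)).intervalIntegral_comp_comm hi'
  simp only [innerSL_apply_apply] at this
  rw [real_inner_comm, ← this]
  simp only [real_inner_comm]

theorem hasL1Deriv_of_hasDerivAt {E : Type*} [NormedAddCommGroup E] [NormedSpace ℝ E]
    [CompleteSpace E] {a b : ℝ} {f f' : ℝ → E}
    (h : ∀ t, HasDerivAt f (f' t) t) (hc : Continuous f') : HasL1Deriv a b f f' :=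
  ⟨hc.intervalIntegrable _ _, fun s _ => by
    rw [intervalIntegral.integral_eq_sub_of_hasDerivAt (fun u _ => h u)
      (hc.intervalIntegrable _ _)]; abel⟩

/-- `B(t)` are uniformly bounded perturbations of the inverse of the skew-adjoint operator `K`
which respect the range of `K`, and `K⁻¹ B(t)` is formally self-adjoint. -/
structure IsPerturbation (T M : ℝ) (K : H →L[ℝ] H) (B B' : ℝ → H →L[ℝ] H) : Prop where
  skew : star K = -K
  inj : Function.Injective K
  bdd : IsBddFamily T M B
  norm_le : ∀ t ∈ Icc 0 T, ‖B' t‖ ≤ M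
  comm : ∀ t ∈ Icc 0 T, ∀ x, B t (K x) = K (B' t x)
  adj : ∀ t ∈ Icc 0 T, ∀ x y, ⟪K x, B t y⟫_ℝ = -⟪K (B t x), y⟫_ℝ

variable {T M : ℝ} {K : H →L[ℝ] H} {B B' : ℝ → H →L[ℝ] H} {S : ℝ → H →L[ℝ] H}

/-- Measurability of B' is inherited from B: B' = K⁻¹BK is the strong limit of the Yosida
approximations of K⁻¹ applied to BK. -/
theorem IsPerturbation.bdd' (h : IsPerturbation T M K B B') : IsBddFamily T M B' := by
  refine ⟨h.norm_le, fun x => ?_⟩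
  refine aestronglyMeasurable_of_tendsto_ae atTop (f := fun n t => yosida K n (B t (K x)))
    (fun n => (yosida K n).continuous.comp_aestronglyMeasurable (h.bdd.measurable (K x))) ?_
  refine (ae_restrict_iff' measurableSet_Icc).2 (ae_of_all _ fun t ht => ?_)
  simp only [h.comm t ht]
  exact tendsto_yosida h.skew h.inj _

theorem IsGroupOfInverse.neg_apply (hS : IsGroupOfInverse K S) (t : ℝ) (x : H) :
    S (-t) (S t x) = x := by
  rw [← mul_apply_eq_comp, ← hS.add, neg_add_cancel, hS.zero, one_apply_eq_self]

theorem IsGroupOfInverse.apply_neg (hS : IsGroupOfInverse K S) (t : ℝ) (x : H) :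
    S t (S (-t) x) = x := by
  rw [← mul_apply_eq_comp, ← hS.add, add_neg_cancel, hS.zero, one_apply_eq_self]

/-- The isometry property upgrades strong continuity to continuity along moving vectors. -/
theorem IsGroupOfInverse.continuousOn_apply (hS : IsGroupOfInverse K S) {s : Set ℝ} {w : ℝ → H}
    (hw : ContinuousOn w s) : ContinuousOn (fun t => S t (w t)) s := by
  intro t ht
  rw [ContinuousWithinAt, tendsto_iff_norm_sub_tendsto_zero]
  refine squeeze_zero (fun _ => norm_nonneg _)
    (g := fun r => ‖w r - w t‖ + ‖S r (w t) - S t (w t)‖) (fun r => ?_) ?_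
  · rw [← hS.norm_eq r (w r - w t), map_sub]
    exact norm_sub_le_norm_sub_add_norm_sub _ _ _
  · have h1 := tendsto_iff_norm_sub_tendsto_zero.1 (hw t ht)
    have h2 := tendsto_iff_norm_sub_tendsto_zero.1
      ((hS.continuous (w t)).continuousWithinAt (s := s) (x := t))
    simpa using h1.add h2

/-- The family `S(-t) B(t) S(t)`. -/
def conjFamily (S B : ℝ → H →L[ℝ] H) (t : ℝ) : H →L[ℝ] H := S (-t) * B t * S t

theorem conjFamily_apply (S B : ℝ → H →L[ℝ] H) (t : ℝ) (x : H) :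
    conjFamily S B t x = S (-t) (B t (S t x)) := rfl

theorem IsBddFamily.conj (hB : IsBddFamily T M B) (hS : IsGroupOfInverse K S) :
    IsBddFamily T M (conjFamily S B) := by
  refine ⟨fun t ht => ContinuousLinearMap.opNorm_le_bound _
    ((norm_nonneg _).trans (hB.norm_le t ht)) fun x => ?_, fun x => ?_⟩
  · rw [conjFamily_apply, hS.norm_eq, ← hS.norm_eq t x]
    exact (B t).le_of_opNorm_le (hB.norm_le t ht) _
  · exact aestronglyMeasurable_family_apply
      (fun y => ((hS.continuous y).comp continuous_neg).aestronglyMeasurable)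
      (aestronglyMeasurable_family_apply hB.measurable (hS.continuous x).aestronglyMeasurable)

/-- Duhamel's principle in differential form. -/
theorem HasL1Deriv.group_apply (hK : star K = -K) (hS : IsGroupOfInverse K S) (hT : 0 ≤ T)
    (hB : IsBddFamily T M B) {w : ℝ → H}
    (hw : HasL1Deriv 0 T w fun t => conjFamily S B t (w t)) :
    HasL1Deriv 0 T (fun t => K (S t (w t))) fun t => S t (w t) + K (B t (S t (w t))) := by
  have hc := hS.continuousOn_apply hw.continuousOn
  have hi : IntervalIntegrable (fun t => S t (w t) + K (B t (S t (w t)))) volume 0 T :=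
    (intervalIntegrable_of_Icc hc.integrableOn_Icc (left_mem_Icc.2 hT) (right_mem_Icc.2 hT)).add
      (intervalIntegrable_of_Icc (K.integrable_comp (hB.integrableOn hc)) (left_mem_Icc.2 hT)
        (right_mem_Icc.2 hT))
  refine .of_inner hi fun z => ?_
  -- S(t)w(t) itself need not be differentiable, as w(t) may lie outside the range of K. Tested with
  -- z, the operator K S(t) moves to the vector Kz, whose orbit is differentiable.
  have h1 : HasL1Deriv 0 T (fun t => S (-t) (K z)) (fun t => -S (-t) z) :=
    hasL1Deriv_of_hasDerivAt (fun t => by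
      have := (hS.hasDerivAt z (-t)).scomp t (hasDerivAt_neg t)
      rwa [neg_one_smul] at this)
      ((hS.continuous z).comp continuous_neg).neg
  have h2 := (hw.inner hT h1).clm (-ContinuousLinearMap.id ℝ ℝ)
  refine h2.congr hT (fun t _ => ?_) (ae_of_all _ fun t => ?_)
  · simp [inner_skew hK, hS.inner_eq]
  · simp [inner_skew hK, hS.inner_eq, conjFamily_apply, inner_add_left, hS.apply_neg]

theorem conjFamily_comm (hS : IsGroupOfInverse K S) (h : IsPerturbation T M K B B') {t : ℝ}
    (ht : t ∈ Icc 0 T) (x : H) : conjFamily S B t (K x) = K (conjFamily S B' t x) := by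
  rw [conjFamily_apply, conjFamily_apply, hS.comm, h.comm t ht, hS.comm]

/-- `A` is the operator `K⁻¹ + B` on the range of `K`. -/
structure IsInverseAdd (K B : H →L[ℝ] H) (A : H →ₗ.[ℝ] H) : Prop where
  mem_domain : ∀ w, w ∈ A.domain ↔ ∃ x, K x = w
  apply_eq : ∀ x (h : K x ∈ A.domain), A ⟨K x, h⟩ = x + B (K x)

/-- The equation v = K⁻¹w + Bw reads K(v - Bw) = w, which is a closed condition on (w, v). -/
theorem IsInverseAdd.isClosed {A : H →ₗ.[ℝ] H} {B : H →L[ℝ] H} (hA : IsInverseAdd K B A) :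
    A.IsClosed := by
  have : (A.graph : Set (H × H)) = {p | K (p.2 - B p.1) = p.1} := by
    ext ⟨w, v⟩
    simp only [SetLike.mem_coe, LinearPMap.mem_graph_iff, mem_ofPred_eq]
    constructor
    · rintro ⟨⟨y, hy⟩, rfl, rfl⟩
      obtain ⟨x, rfl⟩ := (hA.mem_domain y).1 hy
      simp only [hA.apply_eq, add_sub_cancel_right]
    · intro h
      have hw := (hA.mem_domain w).2 ⟨_, h⟩
      refine ⟨⟨w, hw⟩, rfl, ?_⟩
      have h3 := hA.apply_eq (v - B w) (by rw [h]; exact hw)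
      simp only [h] at h3
      rw [h3, sub_add_cancel]
  rw [LinearPMap.IsClosed, this]
  exact isClosed_eq (by fun_prop) (by fun_prop)

theorem IsInverseAdd.dense (hK : star K = -K) (hinj : Function.Injective K) {A : H →ₗ.[ℝ] H}
    {B : H →L[ℝ] H} (hA : IsInverseAdd K B A) : Dense (A.domain : Set H) := by
  refine (denseRange_skew hK hinj).mono ?_
  rintro _ ⟨x, rfl⟩
  exact (hA.mem_domain _).2 ⟨x, rfl⟩

/-- U(t,τ) = S(t)W(t,τ)S(-τ) with W the propagator of the conjugated family of B. A second
propagator W', built from B', satisfies WK = KW'; hence U maps the range of K into itself, and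
Duhamel's principle for W' gives the integral identity there. -/
theorem exists_evolutionSystem (hT : 0 ≤ T) (h : IsPerturbation T M K B B')
    {A : ℝ → H →ₗ.[ℝ] H} (hA : ∀ t ∈ Icc 0 T, IsInverseAdd K (B t) (A t)) {Y : Submodule ℝ H}
    (hY : ∀ w, w ∈ Y ↔ ∃ x, K x = w) :
    ∃ U : ℝ → ℝ → H →L[ℝ] H, IsAlmostStrongEvolutionSystem T A Y U := by
  obtain ⟨S, hS⟩ := exists_isGroupOfInverse h.skew h.inj
  have hC := h.bdd.conj hS
  have hC' := h.bdd'.conj hS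
  obtain ⟨W, hW⟩ := exists_propagator hT hC
  obtain ⟨W', hW'⟩ := exists_propagator hT hC'
  have hM := h.bdd.nonneg hT
  have hYd : Dense (Y : Set H) := by
    refine (denseRange_skew h.skew h.inj).mono ?_
    rintro _ ⟨x, rfl⟩
    exact (hY _).2 ⟨x, rfl⟩
  have hYA : ∀ t ∈ Icc 0 T, Y ≤ (A t).domain := fun t ht w hw =>
    ((hA t ht).mem_domain w).2 ((hY w).1 hw)
  have hcomp : ∀ τ r t, τ ∈ Icc 0 T → r ∈ Icc 0 T → t ∈ Icc 0 T → ∀ x,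
      W t r (W r τ x) = W t τ x := by
    intro τ r t hτ hr ht x
    refine ((hW r hr).2 _).2.unique_of_family hT hC ((hW τ hτ).2 x).2 hr ?_ t ht
    rw [((hW r hr).2 _).1]
  -- Both sides solve the same linear equation with the same value at τ.
  have hKW : ∀ τ t, τ ∈ Icc 0 T → t ∈ Icc 0 T → ∀ x, W t τ (K x) = K (W' t τ x) := by
    intro τ t hτ ht x
    refine ((hW τ hτ).2 _).2.unique_of_family hT hC (w' := fun t => K (W' t τ x)) ?_ hτ ?_ t ht
    · refine (((hW' τ hτ).2 x).2.clm K).congr hT (fun _ _ => rfl) ?_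
      refine (ae_restrict_iff' measurableSet_Icc).2 (ae_of_all _ fun r hr => ?_)
      exact (conjFamily_comm hS h hr _).symm
    · rw [((hW τ hτ).2 _).1, ((hW' τ hτ).2 _).1]
  set U : ℝ → ℝ → H →L[ℝ] H := fun t τ => S t * W t τ * S (-τ) with hU
  have hUa : ∀ t τ x, U t τ x = S t (W t τ (S (-τ) x)) := fun _ _ _ => rfl
  have hUK : ∀ τ t, τ ∈ Icc 0 T → t ∈ Icc 0 T → ∀ x,
      U t τ (K x) = K (S t (W' t τ (S (-τ) x))) := by
    intro τ t hτ ht x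
    rw [hUa, hS.comm, hKW τ t hτ ht, hS.comm]
  have hWn : ∀ t, ∀ τ ∈ Icc 0 T, ∀ x, ‖W t τ x‖ ≤ Real.exp (M * T) * ‖x‖ := fun t τ hτ x =>
    (W t τ).le_of_opNorm_le ((hW τ hτ).1 t) x
  refine ⟨U, ⟨fun t ht => (hA t ht).isClosed, ?_, hYA, hYd, ?_, ?_, ?_, ?_, ?_, ?_, ?_⟩⟩
  · exact hYd.mono (subset_iInter₂ hYA)
  · intro t ht
    ext x
    rw [hUa, ((hW t ht).2 _).1, hS.apply_neg]
    rfl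
  · intro τ r t h0 hr ht hT'
    ext x
    rw [ContinuousLinearMap.comp_apply, hUa, hUa r, hS.neg_apply, hcomp τ r t
      ⟨h0, (hr.trans ht).trans hT'⟩ ⟨h0.trans hr, ht.trans hT'⟩ ⟨(h0.trans hr).trans ht, hT'⟩]
    rfl
  · intro u τ hτ
    exact hS.continuousOn_apply
      ((((hW τ hτ).2 _).2.continuousOn).mono (Icc_subset_Icc_left hτ.1))
  · intro u t ht τ hτ
    have hτ' : τ ∈ Icc 0 T := ⟨hτ.1, hτ.2.trans ht.2⟩
    rw [ContinuousWithinAt, tendsto_iff_norm_sub_tendsto_zero]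
    -- Since W(t,τ) = W(t,r)W(r,τ), U(t,r)u - U(t,τ)u is the image of this difference under
    -- S(t)W(t,r), whose norm is bounded uniformly in r; the difference vanishes at r = τ.
    have h1 : ContinuousOn (fun r => S (-r) u - W r τ (S (-τ) u)) (Icc 0 T) :=
      ((hS.continuous u).comp continuous_neg).continuousOn.sub ((hW τ hτ').2 _).2.continuousOn
    have h2 : Tendsto (fun r => S (-r) u - W r τ (S (-τ) u)) (𝓝[Icc 0 t] τ) (𝓝 0) := by
      have := (h1 τ hτ').mono_left (nhdsWithin_mono τ (Icc_subset_Icc_right ht.2))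
      simpa only [ContinuousWithinAt, ((hW τ hτ').2 _).1, sub_self] using this
    have h3 : Tendsto (fun r => Real.exp (M * T) * ‖S (-r) u - W r τ (S (-τ) u)‖)
        (𝓝[Icc 0 t] τ) (𝓝 0) := by
      simpa using h2.norm.const_mul (Real.exp (M * T))
    refine squeeze_zero' (Eventually.of_forall fun _ => norm_nonneg _) ?_ h3
    filter_upwards [self_mem_nhdsWithin] with r hr
    have hr' : r ∈ Icc 0 T := ⟨hr.1, hr.2.trans ht.2⟩
    rw [hUa, hUa, ← map_sub, hS.norm_eq, ← hcomp τ r t hτ' hr' ht, ← map_sub]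
    exact hWn t r hr' _
  · refine ⟨Real.exp (M * T), fun τ t h0 h1 h2 =>
      ContinuousLinearMap.opNorm_le_bound _ (Real.exp_pos _).le fun x => ?_⟩
    rw [hUa, hS.norm_eq, ← hS.norm_eq (-τ) x]
    exact hWn t τ ⟨h0, h1.trans h2⟩ _
  · intro τ hτ
    refine (ae_restrict_iff' measurableSet_Icc).2 (ae_of_all _ fun t ht u hu => ?_)
    obtain ⟨x, rfl⟩ := (hY u).1 hu
    have ht' : t ∈ Icc 0 T := ⟨hτ.1.trans ht.1, ht.2⟩
    exact ((hA t ht').mem_domain _).2 ⟨_, (hUK τ t ⟨hτ.1, hτ.2.le⟩ ht' x).symm⟩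
  · intro u hu τ hτ
    obtain ⟨x, rfl⟩ := (hY u).1 hu
    have hd := ((hW' τ hτ).2 (S (-τ) x)).2.group_apply h.skew hS hT h.bdd'
    refine ⟨fun r => S r (W' r τ (S (-τ) x)) + K (B' r (S r (W' r τ (S (-τ) x)))),
      (ae_restrict_iff' measurableSet_Icc).2 (ae_of_all _ fun r hr => ?_), ?_, fun t ht => ?_⟩
    · have hr' : r ∈ Icc 0 T := ⟨hτ.1.trans hr.1, hr.2⟩
      have hm := ((hA r hr').mem_domain _).2 ⟨_, (hUK τ r hτ hr' x).symm⟩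
      refine ⟨hm, ?_⟩
      simp only [hUK τ r hτ hr' x] at hm ⊢
      rw [(hA r hr').apply_eq _ hm, h.comm r hr']
    · rw [integrableOn_Icc_iff_integrableOn_Ioc,
        ← intervalIntegrable_iff_integrableOn_Ioc_of_le hτ.2]
      exact hd.integrable_of_mem hτ (right_mem_Icc.2 hT)
    · have ht' : t ∈ Icc 0 T := ⟨hτ.1.trans ht.1, ht.2⟩
      rw [← hd.sub_eq hτ ht', hUK τ t hτ ht' x, ((hW' τ hτ).2 _).1, hS.apply_neg]

/-- By duality: Kp solves the forward equation w' = (K⁻¹ + B)w with value Ku at time t, and K²p then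
solves the equation adjoint to that of U. Thus the pairing of U(r,τ)Ky with K²p(r) does not depend
on r; comparing r = τ with r = t gives the formula for the adjoint. -/
theorem exists_adjoint_eq (hT : 0 ≤ T) (h : IsPerturbation T M K B B')
    {A : ℝ → H →ₗ.[ℝ] H} (hA : ∀ t ∈ Icc 0 T, IsInverseAdd K (B t) (A t)) {Y : Submodule ℝ H}
    (hY : ∀ w, w ∈ Y ↔ ∃ x, K x = w) {U : ℝ → ℝ → H →L[ℝ] H}
    (hU : IsAlmostStrongEvolutionSystem T A Y U) {t : ℝ} (ht : t ∈ Icc 0 T) (u : H) :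
    ∃ p : ℝ → H, (∀ τ ∈ Icc 0 t, ContinuousLinearMap.adjoint (U t τ) (K (K u)) = K (K (p τ))) ∧
      ContinuousOn p (Icc 0 T) ∧
      HasL1Deriv 0 T (fun τ => K (p τ)) fun τ => p τ + K (B' τ (p τ)) := by
  obtain ⟨S, hS⟩ := exists_isGroupOfInverse h.skew h.inj
  obtain ⟨W, hW⟩ := exists_propagator hT (h.bdd'.conj hS)
  -- The data are prescribed at the final time t. Working with B' instead of B yields p itself, that
  -- is, K⁻¹ of the solution Kp.
  obtain ⟨hWt, hW⟩ := (hW t ht).2 (S (-t) u)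
  have hd := hW.group_apply h.skew hS hT h.bdd'
  have hc := hS.continuousOn_apply hW.continuousOn
  obtain ⟨p, hp⟩ : ∃ p : ℝ → H, ∀ τ, p τ = S τ (W τ t (S (-t) u)) := ⟨_, fun _ => rfl⟩
  simp only [← hp] at hd hc
  have hpt : p t = u := by rw [hp, hWt, hS.apply_neg]
  refine ⟨p, fun τ hτ => ?_, hc, hd⟩
  have hτT : τ ∈ Icc 0 T := ⟨hτ.1, hτ.2.trans ht.2⟩
  refine ext_inner_left ℝ fun z => ?_
  refine congrFun ((denseRange_skew h.skew h.inj).equalizer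
    (g := fun z => ⟪z, ContinuousLinearMap.adjoint (U t τ) (K (K u))⟫_ℝ)
    (h := fun z => ⟪z, K (K (p τ))⟫_ℝ) (by fun_prop) (by fun_prop) (funext fun y => ?_)) z
  simp only [Function.comp_apply]
  obtain ⟨f, hf, hfi, hfe⟩ := hU.integral_eq (K y) ((hY _).2 ⟨y, rfl⟩) τ hτT
  have hx : HasL1Deriv τ t (fun r => U r τ (K y)) f := by
    refine ⟨?_, fun s hs => ?_⟩
    · rw [intervalIntegrable_iff_integrableOn_Ioc_of_le hτ.2]
      exact hfi.mono_set (Ioc_subset_Icc_self.trans (Icc_subset_Icc_right ht.2))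
    · rw [hfe s ⟨hs.1, hs.2.trans ht.2⟩, hU.refl τ hτT]
      simp
  have hP := (hd.mono hτ.2 hτ.1 ht.2).clm K
  have hI := hx.inner hτ.2 hP
  -- Write U(r,τ)Ky = Kx, so that f(r) = x + BKx. The terms without B cancel because K is skew;
  -- those with B cancel because KB'p = BKp and KB is symmetric.
  have hzero : ∫ r in τ..t, (⟪f r, K (K (p r))⟫_ℝ
      + ⟪U r τ (K y), K (p r + K (B' r (p r)))⟫_ℝ) = 0 := by
    rw [intervalIntegral.integral_of_le hτ.2]
    refine integral_eq_zero_of_ae ?_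
    have hsub : Ioc τ t ⊆ Icc τ T := Ioc_subset_Icc_self.trans (Icc_subset_Icc_right ht.2)
    filter_upwards [ae_restrict_of_ae_restrict_of_subset hsub hf,
      ae_restrict_mem measurableSet_Ioc] with r hr hrm
    have hrT : r ∈ Icc 0 T := ⟨hτ.1.trans hrm.1.le, hrm.2.trans ht.2⟩
    obtain ⟨hm, hfr⟩ := hr
    obtain ⟨x, hxr⟩ := ((hA r hrT).mem_domain _).1 hm
    have hfr' : f r = x + B r (K x) := by
      rw [hfr]
      simp only [← hxr] at hm ⊢
      exact (hA r hrT).apply_eq x hm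
    have h1 := h.adj r hrT (K (p r)) (K x)
    rw [h.comm r hrT (p r), real_inner_comm, real_inner_comm (K x)] at h1
    have h2 := inner_skew h.skew x (K (p r))
    rw [hfr', ← hxr, inner_add_left, map_add, inner_add_right, h1, h2, Pi.zero_apply]
    ring
  have := hI.eq t ⟨hτ.2, le_rfl⟩
  rw [hzero, add_zero, hU.refl τ hτT, hpt] at this
  rw [ContinuousLinearMap.adjoint_inner_right]
  exact this

/-- Formally A* = -K⁻¹ + B* with B* = -KBK⁻¹, that is, A* = -KAK⁻¹. On K²p this is -K(p + BKp), and
BKp = KB'p. -/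
theorem IsInverseAdd.adjoint_apply (h : IsPerturbation T M K B B') {A : H →ₗ.[ℝ] H} {τ : ℝ}
    (hτ : τ ∈ Icc 0 T) (hA : IsInverseAdd K (B τ) A) (p : H) :
    ∃ hd : K (K p) ∈ A.adjoint.domain,
      A.adjoint ⟨K (K p), hd⟩ = -K (p + K (B' τ p)) := by
  have key : ∀ x : A.domain, ⟪-K (p + K (B' τ p)), (x : H)⟫_ℝ = ⟪K (K p), A x⟫_ℝ := by
    rintro ⟨w, hw⟩
    obtain ⟨x, rfl⟩ := (hA.mem_domain w).1 hw
    rw [hA.apply_eq, inner_add_right, h.adj τ hτ, h.comm τ hτ, inner_skew h.skew (K p)]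
    simp only [map_add, neg_add, inner_add_left, inner_neg_left]
  have hd := A.mem_adjoint_domain_of_exists (K (K p)) ⟨_, key⟩
  exact ⟨hd, LinearPMap.adjoint_apply_eq (hA.dense h.skew h.inj) ⟨_, hd⟩ key⟩

end Evolution

/-! ### Sup-norm and L² estimates on (0, l) -/

section Bounds
variable {E F : Type*} [NormedAddCommGroup E] [NormedSpace ℝ E] [NormedAddCommGroup F]
  [NormedSpace ℝ F] {l : ℝ}

/-- The norm of the inclusion `L² → L¹` on `(0, l)`. -/
def inclConst (l : ℝ) : ℝ := (vol l univ ^ (1 / (1 : ℝ≥0∞).toReal - 1 / (2 : ℝ≥0∞).toReal)).toReal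

theorem inclConst_nonneg (l : ℝ) : 0 ≤ inclConst l := ENNReal.toReal_nonneg

theorem integral_norm_le (v : Lp E 2 (vol l)) : ∫ s, ‖v s‖ ∂(vol l) ≤ inclConst l * ‖v‖ := by
  have hv := Lp.memLp v
  have h := eLpNorm_le_eLpNorm_mul_rpow_measure_univ (p := 1) (q := 2) (by norm_num) hv.1
  rw [integral_norm_eq_lintegral_enorm hv.1, ← eLpNorm_one_eq_lintegral_enorm, Lp.norm_def,
    mul_comm, inclConst, ← ENNReal.toReal_mul]
  refine ENNReal.toReal_mono (ENNReal.mul_ne_top hv.2.ne ?_) h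
  exact ENNReal.rpow_ne_top_of_nonneg (by norm_num) (measure_ne_top _ _)

theorem norm_integral_vol_le {v : ℝ → E} (hv : Integrable v (vol l)) {s t : ℝ}
    (hs : s ∈ Icc 0 l) (ht : t ∈ Icc 0 l) : ‖∫ r in s..t, v r‖ ≤ ∫ r, ‖v r‖ ∂(vol l) := by
  rw [intervalIntegral.norm_intervalIntegral_eq]
  refine (norm_integral_le_integral_norm _).trans ?_
  have e : ∫ r, ‖v r‖ ∂(vol l) = ∫ r in Ioc 0 l, ‖v r‖ := integral_Ioc_eq_integral_Ioo.symm
  rw [e]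
  refine setIntegral_mono_set (((integrableOn_Ioc_iff_integrableOn_Ioo (μ := volume)).2 hv).norm)
    (ae_of_all _ fun _ => norm_nonneg _) (LE.le.eventuallyLE ?_)
  exact Ioc_subset_Ioc (le_min hs.1 ht.1) (max_le hs.2 ht.2)

theorem HasL1Deriv.norm_le [CompleteSpace E] (hl : 0 ≤ l) {f f' : ℝ → E} (h : HasL1Deriv 0 l f f') {c : ℝ}
    (hc : c ∈ Icc 0 l) (h0 : f c = 0) {v : Lp E 2 (vol l)} (hv : f' =ᵐ[vol l] v) {s : ℝ}
    (hs : s ∈ Icc 0 l) : ‖f s‖ ≤ inclConst l * ‖v‖ := by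
  rw [← sub_zero (f s), ← h0, h.sub_eq hc hs]
  refine (norm_integral_vol_le (h.integrable_vol hl) hc hs).trans ?_
  exact (integral_congr_ae (hv.fun_comp norm)).trans_le (integral_norm_le v)

theorem HasL1Deriv.norm_le_of_bound {f f' : ℝ → E} (h : HasL1Deriv 0 l f f') {c : ℝ}
    (hc : c ∈ Icc 0 l) (h0 : f c = 0) {D : ℝ} (hD : ∀ s ∈ Icc 0 l, ‖f' s‖ ≤ D) {s : ℝ}
    (hs : s ∈ Icc 0 l) : ‖f s‖ ≤ l * D := by
  rw [← sub_zero (f s), ← h0, h.sub_eq hc hs]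
  refine (intervalIntegral.norm_integral_le_of_norm_le_const (C := D) fun r hr =>
    hD r (uIcc_subset_Icc hc hs (uIoc_subset_uIcc hr))).trans ?_
  have h1 : |s - c| ≤ l := by
    rw [abs_le]; constructor <;> linarith [hs.1, hs.2, hc.1, hc.2]
  have h2 : 0 ≤ D := (norm_nonneg _).trans (hD s hs)
  rw [mul_comm]
  exact mul_le_mul_of_nonneg_right h1 h2

theorem ae_vol_of_forall {p : ℝ → Prop} (h : ∀ s ∈ Icc 0 l, p s) : ∀ᵐ s ∂(vol l), p s :=
  (ae_restrict_iff' measurableSet_Ioo).2 (ae_of_all _ fun s hs => h s (Ioo_subset_Icc_self hs))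

theorem exists_Lp_of_le {f : ℝ → E} (hf : AEStronglyMeasurable f (vol l)) {v : Lp F 2 (vol l)}
    {D : ℝ} (h : ∀ᵐ s ∂(vol l), ‖f s‖ ≤ D * ‖v s‖) :
    ∃ w : Lp E 2 (vol l), w =ᵐ[vol l] f ∧ ‖w‖ ≤ D * ‖v‖ := by
  have hm : MemLp f 2 (vol l) := (Lp.memLp v).of_le_mul hf h
  refine ⟨hm.toLp f, hm.coeFn_toLp, Lp.norm_le_mul_norm_of_ae_le_mul ?_⟩
  filter_upwards [h, hm.coeFn_toLp] with s h1 h2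
  rwa [h2]

/-- The norm of the inclusion of the bounded functions in `L²` on `(0, l)`. -/
def bddConst (l : ℝ) : ℝ := ((measureUnivNNReal (vol l) ^ ((2 : ℝ≥0∞).toReal)⁻¹ : ℝ≥0) : ℝ)

theorem bddConst_nonneg (l : ℝ) : 0 ≤ bddConst l := NNReal.coe_nonneg _

theorem exists_Lp_of_bound {f : ℝ → E} (hf : AEStronglyMeasurable f (vol l)) {D : ℝ} (hD : 0 ≤ D)
    (h : ∀ᵐ s ∂(vol l), ‖f s‖ ≤ D) :
    ∃ w : Lp E 2 (vol l), w =ᵐ[vol l] f ∧ ‖w‖ ≤ bddConst l * D := by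
  have hm : MemLp f 2 (vol l) := MemLp.of_bound hf D h
  refine ⟨hm.toLp f, hm.coeFn_toLp, ?_⟩
  have := Lp.norm_le_of_ae_bound (f := hm.toLp f) hD (by
    filter_upwards [h, hm.coeFn_toLp] with s h1 h2
    rwa [h2])
  simpa [bddConst] using this

theorem HasL1Deriv.aestronglyMeasurable {f f' : ℝ → E} (h : HasL1Deriv 0 l f f') :
    AEStronglyMeasurable f (vol l) :=
  (h.continuousOn.mono Ioo_subset_Icc_self).aestronglyMeasurable measurableSet_Ioo

theorem Lp_norm_le_of_forall {u : Lp E 2 (vol l)} {f : ℝ → E} (h : u =ᵐ[vol l] f) {D : ℝ}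
    (hD : 0 ≤ D) (hf : ∀ s ∈ Icc 0 l, ‖f s‖ ≤ D) : ‖u‖ ≤ bddConst l * D := by
  have := Lp.norm_le_of_ae_bound (f := u) hD (by
    filter_upwards [h, ae_vol_of_forall hf] with s h1 h2
    rwa [h1])
  simpa [bddConst] using this

variable [CompleteSpace E]

/-- Links weak derivatives to the pointwise derivative `derivWithin` in which the boundary
conditions on λ are expressed. -/
theorem HasL1Deriv.hasDerivWithinAt {f f' : ℝ → E} (h : HasL1Deriv 0 l f f')
    (hc : ContinuousOn f' (Icc 0 l)) {s : ℝ} (hs : s ∈ Icc 0 l) :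
    HasDerivWithinAt f (f' s) (Icc 0 l) s := by
  have hl : 0 ≤ l := hs.1.trans hs.2
  have hfact : Fact (s ∈ Icc 0 l) := ⟨hs⟩
  have h1 := intervalIntegral.integral_hasDerivWithinAt_right (s := Icc 0 l) (t := Icc 0 l)
    (h.integrable_of_mem (left_mem_Icc.2 hl) hs)
    (hc.stronglyMeasurableAtFilter_nhdsWithin measurableSet_Icc s) (hc s hs)
  exact (h1.const_add (f 0)).congr h.eq (h.eq s hs)

end Bounds

/-! ### Absolutely continuous representatives in H^{2,2}_bc and H^{4,2}_bc -/

section Representatives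
variable {l : ℝ}

theorem exists_rep_of_mem_H2bc (hl : 0 < l) {u v : L2 l} (hu : u ∈ H2bc l)
    (hv : IsWeakDeriv l 2 u v) : ∃ g0 g1 : ℝ → R3, u =ᵐ[vol l] g0 ∧ HasL1Deriv 0 l g0 g1 ∧
      HasL1Deriv 0 l g1 v ∧ g0 l = 0 ∧ g1 l = 0 := by
  obtain ⟨-, ⟨g0, hg0, hw0, h0⟩, ⟨g1, hg1, hw1, h1⟩⟩ := hu
  refine ⟨g0, g1, hw0.ae_eq (integrable_coe u) (integrable_of_continuousOn hg0), ?_, ?_, h0, h1⟩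
  · exact .of_isWeakDeriv hl hg0 (integrable_of_continuousOn hg1)
      (IsWeakDeriv.sub_index hw0 (k := 1) hw1)
  · exact .of_isWeakDeriv hl hg1 (integrable_coe v) (IsWeakDeriv.sub_index hw1 (k := 1) hv)

theorem exists_rep_of_mem_H4bc (hl : 0 < l) {u v : L2 l} (hu : u ∈ H4bc l)
    (hv : IsWeakDeriv l 4 u v) : ∃ g0 g1 g2 g3 : ℝ → R3, u =ᵐ[vol l] g0 ∧ HasL1Deriv 0 l g0 g1 ∧
      HasL1Deriv 0 l g1 g2 ∧ HasL1Deriv 0 l g2 g3 ∧ HasL1Deriv 0 l g3 v ∧ g0 l = 0 ∧ g1 l = 0 ∧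
      g2 0 = 0 ∧ g3 0 = 0 := by
  obtain ⟨-, ⟨g0, hg0, hw0, h0⟩, ⟨g1, hg1, hw1, h1⟩, ⟨g2, hg2, hw2, h2⟩, ⟨g3, hg3, hw3, h3⟩⟩ := hu
  refine ⟨g0, g1, g2, g3, hw0.ae_eq (integrable_coe u) (integrable_of_continuousOn hg0),
    ?_, ?_, ?_, ?_, h0, h1, h2, h3⟩
  · exact .of_isWeakDeriv hl hg0 (integrable_of_continuousOn hg1)
      (IsWeakDeriv.sub_index hw0 (k := 1) hw1)
  · exact .of_isWeakDeriv hl hg1 (integrable_of_continuousOn hg2)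
      (IsWeakDeriv.sub_index hw1 (k := 1) hw2)
  · exact .of_isWeakDeriv hl hg2 (integrable_of_continuousOn hg3)
      (IsWeakDeriv.sub_index hw2 (k := 1) hw3)
  · exact .of_isWeakDeriv hl hg3 (integrable_coe v) (IsWeakDeriv.sub_index hw3 (k := 1) hv)

theorem isWeakDeriv_zero_of_ae_eq {E : Type*} [NormedAddCommGroup E] [NormedSpace ℝ E]
    {u g : ℝ → E} (h : u =ᵐ[vol l] g) : IsWeakDeriv l 0 u g := by
  have : IsWeakDeriv l 0 g g := fun φ hφ => by simp
  exact this.congr h.symm .rfl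

theorem mem_H2bc_of_rep (hl : 0 < l) {u v : L2 l} {g0 g1 : ℝ → R3} (h : u =ᵐ[vol l] g0)
    (h0 : HasL1Deriv 0 l g0 g1) (h1 : HasL1Deriv 0 l g1 v) (z0 : g0 l = 0) (z1 : g1 l = 0) :
    u ∈ H2bc l ∧ IsWeakDeriv l 2 u v := by
  have w0 := isWeakDeriv_zero_of_ae_eq h
  have w1 : IsWeakDeriv l 1 u g1 := w0.comp (k := 1) (h0.isWeakDeriv hl.le)
  have w2 : IsWeakDeriv l 2 u v := w1.comp (k := 1) (h1.isWeakDeriv hl.le)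
  refine ⟨⟨⟨Lp.memLp u, fun k hk => ?_⟩, ⟨g0, h0.continuousOn, w0, z0⟩,
    ⟨g1, h1.continuousOn, w1, z1⟩⟩, w2⟩
  interval_cases k
  · exact ⟨g0, memLp_of_continuousOn h0.continuousOn 2, w0⟩
  · exact ⟨g1, memLp_of_continuousOn h1.continuousOn 2, w1⟩
  · exact ⟨v, Lp.memLp v, w2⟩

theorem mem_H4bc_of_rep (hl : 0 < l) {u v : L2 l} {g0 g1 g2 g3 : ℝ → R3} (h : u =ᵐ[vol l] g0)
    (h0 : HasL1Deriv 0 l g0 g1) (h1 : HasL1Deriv 0 l g1 g2) (h2 : HasL1Deriv 0 l g2 g3)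
    (h3 : HasL1Deriv 0 l g3 v) (z0 : g0 l = 0) (z1 : g1 l = 0) (z2 : g2 0 = 0) (z3 : g3 0 = 0) :
    u ∈ H4bc l ∧ IsWeakDeriv l 4 u v := by
  have w0 := isWeakDeriv_zero_of_ae_eq h
  have w1 : IsWeakDeriv l 1 u g1 := w0.comp (k := 1) (h0.isWeakDeriv hl.le)
  have w2 : IsWeakDeriv l 2 u g2 := w1.comp (k := 1) (h1.isWeakDeriv hl.le)
  have w3 : IsWeakDeriv l 3 u g3 := w2.comp (k := 1) (h2.isWeakDeriv hl.le)
  have w4 : IsWeakDeriv l 4 u v := w3.comp (k := 1) (h3.isWeakDeriv hl.le)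
  refine ⟨⟨⟨Lp.memLp u, fun k hk => ?_⟩, ⟨g0, h0.continuousOn, w0, z0⟩,
    ⟨g1, h1.continuousOn, w1, z1⟩, ⟨g2, h2.continuousOn, w2, z2⟩,
    ⟨g3, h3.continuousOn, w3, z3⟩⟩, w4⟩
  interval_cases k
  · exact ⟨g0, memLp_of_continuousOn h0.continuousOn 2, w0⟩
  · exact ⟨g1, memLp_of_continuousOn h1.continuousOn 2, w1⟩
  · exact ⟨g2, memLp_of_continuousOn h2.continuousOn 2, w2⟩
  · exact ⟨g3, memLp_of_continuousOn h3.continuousOn 2, w3⟩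
  · exact ⟨v, Lp.memLp v, w4⟩

/-- `∂⁴ : H^{4,2}_bc → L²` is onto. -/
theorem exists_H4bc (hl : 0 < l) (f : L2 l) : ∃ u : L2 l, u ∈ H4bc l ∧ IsWeakDeriv l 4 u f := by
  have hm0 : (0 : ℝ) ∈ Icc 0 l := left_mem_Icc.2 hl.le
  have hml : l ∈ Icc 0 l := right_mem_Icc.2 hl.le
  have hint : ∀ {g : ℝ → R3}, ContinuousOn g (Icc 0 l) → IntervalIntegrable g volume 0 l :=
    fun hg => intervalIntegrable_of_Icc hg.integrableOn_Icc hm0 hml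
  -- Two integrations from 0 followed by two from l produce exactly the four boundary conditions.
  have h3 := hasL1Deriv_primitive hm0 ((intervalIntegrable_iff_vol hl.le).2 (integrable_coe f))
  have h2 := hasL1Deriv_primitive hm0 (hint h3.continuousOn)
  have h1 := hasL1Deriv_primitive hml (hint h2.continuousOn)
  have h0 := hasL1Deriv_primitive hml (hint h1.continuousOn)
  have hm := memLp_of_continuousOn h0.continuousOn 2
  exact ⟨hm.toLp _, mem_H4bc_of_rep hl hm.coeFn_toLp h0 h1 h2 h3 (by simp) (by simp) (by simp)
    (by simp)⟩

theorem H2.d1_spec {b : ℝ} (u : H2 l b) : IsWeakDeriv l 1 (H2.toL2 l b u) (H2.d1 l b u) :=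
  weakDeriv_spec (l := l) (k := 1)
    ⟨H2.toL2 l b u, MemSobolev.mem_domain (Subtype.prop (p := (· ∈ H2bc l)) u).1 (by norm_num)⟩

theorem H2.d2_eq {b : ℝ} (u : H2 l b) {v : L2 l} (h : IsWeakDeriv l 2 (H2.toL2 l b u) v) :
    H2.d2 l b u = v :=
  weakDeriv_eq (l := l) (k := 2)
    ⟨H2.toL2 l b u, MemSobolev.mem_domain (Subtype.prop (p := (· ∈ H2bc l)) u).1 le_rfl⟩ h

theorem H4.d4_eq {b : ℝ} (u : H4 l b) {v : L2 l} (h : IsWeakDeriv l 4 (H4.toL2 l b u) v) :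
    H4.d4 l b u = v :=
  weakDeriv_eq (l := l) (k := 4)
    ⟨H4.toL2 l b u, MemSobolev.mem_domain (Subtype.prop (p := (· ∈ H4bc l)) u).1 le_rfl⟩ h

theorem H2.exists_rep {b : ℝ} (hl : 0 < l) (u : H2 l b) : ∃ g0 g1 : ℝ → R3,
    H2.toL2 l b u =ᵐ[vol l] g0 ∧ H2.d1 l b u =ᵐ[vol l] g1 ∧ HasL1Deriv 0 l g0 g1 ∧
      HasL1Deriv 0 l g1 (H2.d2 l b u) ∧ g0 l = 0 ∧ g1 l = 0 := by
  obtain ⟨g0, g1, h, h0, h1, z0, z1⟩ :=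
    exists_rep_of_mem_H2bc hl (Subtype.prop (p := (· ∈ H2bc l)) u) (H2.d2_spec u)
  refine ⟨g0, g1, h, ?_, h0, h1, z0, z1⟩
  have w1 := (isWeakDeriv_zero_of_ae_eq h).comp (k := 1) (h0.isWeakDeriv hl.le)
  exact (H2.d1_spec u).unique w1 (integrable_coe _) (integrable_of_continuousOn h1.continuousOn)

theorem H4.exists_rep {b : ℝ} (hl : 0 < l) (u : H4 l b) : ∃ g0 g1 g2 g3 : ℝ → R3,
    H4.toL2 l b u =ᵐ[vol l] g0 ∧ H2.d1 l b (H4.toH2 l b u) =ᵐ[vol l] g1 ∧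
      H2.d2 l b (H4.toH2 l b u) =ᵐ[vol l] g2 ∧ HasL1Deriv 0 l g0 g1 ∧
      HasL1Deriv 0 l g1 g2 ∧ HasL1Deriv 0 l g2 g3 ∧ HasL1Deriv 0 l g3 (H4.d4 l b u) ∧
      g0 l = 0 ∧ g1 l = 0 ∧ g2 0 = 0 ∧ g3 0 = 0 := by
  obtain ⟨g0, g1, g2, g3, h, h0, h1, h2, h3, z⟩ :=
    exists_rep_of_mem_H4bc hl (Subtype.prop (p := (· ∈ H4bc l)) u) (H4.d4_spec u)
  have w1 := (isWeakDeriv_zero_of_ae_eq h).comp (k := 1) (h0.isWeakDeriv hl.le)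
  have w2 : IsWeakDeriv l 2 _ g2 := w1.comp (k := 1) (h1.isWeakDeriv hl.le)
  exact ⟨g0, g1, g2, g3, h, (H2.d1_spec (H4.toH2 l b u)).unique w1 (integrable_coe _)
    (integrable_of_continuousOn h1.continuousOn), (H2.d2_spec (H4.toH2 l b u)).unique w2
    (integrable_coe _) (integrable_of_continuousOn h2.continuousOn), h0, h1, h2, h3, z⟩

end Representatives

/-! ### Product rules and integration by parts -/

section Calculus
variable {E : Type*} [NormedAddCommGroup E] [NormedSpace ℝ E] [CompleteSpace E]

theorem HasL1Deriv.sub {a b : ℝ} {f f' f₁ f₁' : ℝ → E} (h : HasL1Deriv a b f f')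
    (h₁ : HasL1Deriv a b f₁ f₁') :
    HasL1Deriv a b (fun s => f s - f₁ s) (fun s => f' s - f₁' s) := by
  simpa [sub_eq_add_neg] using h.add (h₁.clm (-ContinuousLinearMap.id ℝ E))

theorem HasL1Deriv.smul {a b : ℝ} (hab : a ≤ b) {c c' : ℝ → ℝ} {f f' : ℝ → E}
    (hc : HasL1Deriv a b c c') (hf : HasL1Deriv a b f f') :
    HasL1Deriv a b (fun s => c s • f s) (fun s => c' s • f s + c s • f' s) :=
  hc.bilin hab (ContinuousLinearMap.lsmul ℝ ℝ) hf

theorem HasL1Deriv.congr_vol {l : ℝ} (hl : 0 ≤ l) {f f' f₁' : ℝ → E} (h : HasL1Deriv 0 l f f')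
    (e : f' =ᵐ[vol l] f₁') : HasL1Deriv 0 l f f₁' :=
  h.congr hl (fun _ _ => rfl) (by rwa [← Measure.restrict_congr_set Ioo_ae_eq_Icc])

theorem L2_inner_sub_eq {l : ℝ} {u v u' v' : L2 l} {f g f' g' : ℝ → R3} (hu : u =ᵐ[vol l] f)
    (hv : v =ᵐ[vol l] g) (hu' : u' =ᵐ[vol l] f') (hv' : v' =ᵐ[vol l] g') (hl : 0 ≤ l) :
    ⟪u, v⟫_ℝ - ⟪u', v'⟫_ℝ = ∫ s in 0..l, (⟪f s, g s⟫_ℝ - ⟪f' s, g' s⟫_ℝ) := by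
  rw [intervalIntegral.integral_of_le hl, integral_Ioc_eq_integral_Ioo, L2.inner_def, L2.inner_def,
    ← integral_sub (L2.integrable_inner u v) (L2.integrable_inner u' v')]
  refine integral_congr_ae ?_
  filter_upwards [hu, hv, hu', hv'] with s h1 h2 h3 h4
  rw [h1, h2, h3, h4]

end Calculus

/-! ### The inverse of b∂⁴ -/

section Operators
variable {l b : ℝ} [hl : Fact (0 < l)] [hb : Fact (0 < b)]

theorem H2.norm_sq (u : H2 l b) : ‖u‖ ^ 2 = b * ‖H2.d2 l b u‖ ^ 2 := by
  rw [← real_inner_self_eq_norm_sq, H2.inner_def, real_inner_self_eq_norm_sq]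

theorem H2.norm_eq (u : H2 l b) : ‖u‖ = Real.sqrt b * ‖H2.d2 l b u‖ := by
  have h := H2.norm_sq u
  rw [← Real.sqrt_sq (norm_nonneg u), h, Real.sqrt_mul hb.out.le, Real.sqrt_sq (norm_nonneg _)]

theorem H2.norm_d2_le (u : H2 l b) : ‖H2.d2 l b u‖ ≤ (Real.sqrt b)⁻¹ * ‖u‖ := by
  have := Real.sqrt_pos.2 hb.out
  rw [H2.norm_eq, inv_mul_cancel_left₀ this.ne']

/-- A Poincaré inequality: ∂u vanishes at l, so it is the primitive of ∂²u from there. -/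
theorem H2.norm_d1_le (u : H2 l b) :
    ‖H2.d1 l b u‖ ≤ bddConst l * inclConst l * (Real.sqrt b)⁻¹ * ‖u‖ := by
  obtain ⟨g0, g1, -, e1, h0, h1, z0, z1⟩ := H2.exists_rep hl.out u
  have hml : l ∈ Icc 0 l := right_mem_Icc.2 hl.out.le
  refine (Lp_norm_le_of_forall e1 (mul_nonneg (inclConst_nonneg l) (norm_nonneg (H2.d2 l b u)))
    fun s hs => h1.norm_le hl.out.le hml z1 .rfl hs).trans ?_
  have := mul_le_mul_of_nonneg_left (H2.norm_d2_le u)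
    (mul_nonneg (bddConst_nonneg l) (inclConst_nonneg l))
  linarith

theorem H2.norm_toL2_le (u : H2 l b) :
    ‖H2.toL2 l b u‖ ≤ bddConst l * (l * (inclConst l * (Real.sqrt b)⁻¹)) * ‖u‖ := by
  obtain ⟨g0, g1, e0, e1, h0, h1, z0, z1⟩ := H2.exists_rep hl.out u
  have hml : l ∈ Icc 0 l := right_mem_Icc.2 hl.out.le
  have hb1 : ∀ s ∈ Icc 0 l, ‖g1 s‖ ≤ inclConst l * ‖H2.d2 l b u‖ :=
    fun s hs => h1.norm_le hl.out.le hml z1 .rfl hs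
  have hn := mul_nonneg (inclConst_nonneg l) (norm_nonneg (H2.d2 l b u))
  refine (Lp_norm_le_of_forall e0 (mul_nonneg hl.out.le hn)
    fun s hs => h0.norm_le_of_bound hml z0 hb1 hs).trans ?_
  have := mul_le_mul_of_nonneg_left (H2.norm_d2_le u)
    (mul_nonneg (bddConst_nonneg l) (mul_nonneg hl.out.le (inclConst_nonneg l)))
  linarith

variable (l b)

/-- The bounded inclusion `H^{2,2}_bc → L²`. -/
def H2.toL2L : H2 l b →L[ℝ] L2 l := (H2.toL2 l b).mkContinuous _ H2.norm_toL2_le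

theorem H2.toL2_injective : Function.Injective (H2.toL2 l b) := Subtype.val_injective

/-- The isometry `b ∂⁴ : H^{4,2}_bc → L²`. -/
def H4.equiv : H4 l b ≃ₗᵢ[ℝ] L2 l :=
  LinearIsometryEquiv.ofSurjective (LinearMap.isometryOfInner (b • H4.d4 l b) (by
    intro u v
    rw [H4.inner_def, LinearMap.smul_apply, LinearMap.smul_apply, real_inner_smul_left,
      real_inner_smul_right, ← mul_assoc, sq])) (by
    intro f
    obtain ⟨u, hu, hw⟩ := exists_H4bc hl.out (b⁻¹ • f)
    refine ⟨(⟨u, hu⟩ : H4bc l), ?_⟩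
    show b • H4.d4 l b (⟨u, hu⟩ : H4bc l) = f
    have : H4.d4 l b (⟨u, hu⟩ : H4bc l) = b⁻¹ • f := H4.d4_eq (b := b) (⟨u, hu⟩ : H4bc l) hw
    rw [this, smul_inv_smul₀ hb.out.ne'])

theorem H4.equiv_apply (u : H4 l b) : H4.equiv l b u = b • H4.d4 l b u := rfl

variable {l b}

/-- Two integrations by parts, done at once by integrating the derivative of ⟨∂³u, f⟩ - ⟨∂²u, ∂f⟩.
The boundary terms vanish at 0 by the conditions on u and at l by those on f. -/
theorem H4.inner_toH2 (u : H4 l b) (f : H2 l b) :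
    ⟪H4.toH2 l b u, f⟫_ℝ = ⟪b • H4.d4 l b u, H2.toL2 l b f⟫_ℝ := by
  have hl0 := hl.out.le
  obtain ⟨g0, g1, g2, g3, -, -, e2, -, -, d2, d3, -, -, z2, z3⟩ := H4.exists_rep hl.out u
  obtain ⟨h0, h1, k0, -, q0, q1, y0, y1⟩ := H2.exists_rep hl.out f
  have hd := (d3.inner hl0 q0).sub (d2.inner hl0 q1)
  have h := hd.eq l (right_mem_Icc.2 hl0)
  have e := L2_inner_sub_eq (Filter.EventuallyEq.refl _ (H4.d4 l b u)) k0 e2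
    (Filter.EventuallyEq.refl _ (H2.d2 l b f)) hl0
  have e' : ∫ s in 0..l, (⟪H4.d4 l b u s, h0 s⟫_ℝ + ⟪g3 s, h1 s⟫_ℝ
      - (⟪g3 s, h1 s⟫_ℝ + ⟪g2 s, H2.d2 l b f s⟫_ℝ))
      = ⟪H4.d4 l b u, H2.toL2 l b f⟫_ℝ - ⟪H2.d2 l b (H4.toH2 l b u), H2.d2 l b f⟫_ℝ := by
    rw [e]
    refine intervalIntegral.integral_congr fun s _ => ?_
    ring
  rw [e', z2, z3, y0, y1] at h
  simp only [inner_zero_left, inner_zero_right, sub_zero, zero_add] at h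
  rw [H2.inner_def, real_inner_smul_left]
  congr 1
  linarith

variable (l b)

/-- The adjoint `L² → H^{2,2}_bc` of the inclusion; it inverts `b ∂⁴`. -/
def invBiharm : L2 l →L[ℝ] H2 l b := ContinuousLinearMap.adjoint (H2.toL2L l b)

/-- Two descriptions of one operator: as an adjoint it makes the inverse of L₀ skew, as an inverse
of b∂⁴ it gains four derivatives. -/
theorem invBiharm_eq (g : L2 l) : invBiharm l b g = H4.toH2 l b ((H4.equiv l b).symm g) := by
  refine ext_inner_right ℝ fun f => ?_
  rw [invBiharm, ContinuousLinearMap.adjoint_inner_left, H4.inner_toH2, ← H4.equiv_apply,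
    LinearIsometryEquiv.apply_symm_apply]
  rfl

theorem H4.toH2_injective : Function.Injective (H4.toH2 l b) :=
  Submodule.inclusion_injective (H4bc_le_H2bc l)

theorem invBiharm_injective : Function.Injective (invBiharm l b) := by
  intro f g h
  rw [invBiharm_eq, invBiharm_eq] at h
  exact (H4.equiv l b).symm.injective (H4.toH2_injective l b h)

theorem invBiharm_d4 (u : H4 l b) : invBiharm l b (b • H4.d4 l b u) = H4.toH2 l b u := by
  rw [← H4.equiv_apply, invBiharm_eq, LinearIsometryEquiv.symm_apply_apply]

theorem inner_invBiharm_left (g : L2 l) (f : H2 l b) :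
    ⟪invBiharm l b g, f⟫_ℝ = ⟪g, H2.toL2 l b f⟫_ℝ :=
  ContinuousLinearMap.adjoint_inner_left _ _ _

theorem inner_invBiharm_right (g : L2 l) (f : H2 l b) :
    ⟪f, invBiharm l b g⟫_ℝ = ⟪H2.toL2 l b f, g⟫_ℝ :=
  ContinuousLinearMap.adjoint_inner_right _ _ _

end Operators

/-! ### The operator ∂(a∂·) for a fixed coefficient -/

section Coefficients

/-- A coefficient `a ∈ H^{3,2}(0, l)` with `a(0) = a(l) = a'(l) = 0`, with bounds for its
derivatives. -/
structure IsCoeff (l C : ℝ) (a : ℝ → ℝ) : Prop where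
  bound : ∀ s ∈ Icc 0 l, ‖a s‖ ≤ C
  bound_deriv : ∀ s ∈ Icc 0 l, ‖derivWithin a (Icc 0 l) s‖ ≤ C
  left : a 0 = 0
  right : a l = 0
  deriv_right : derivWithin a (Icc 0 l) l = 0
  exists_deriv : ∃ (a2 : ℝ → ℝ) (v2 v3 : Lp ℝ 2 (vol l)),
    HasL1Deriv 0 l a (derivWithin a (Icc 0 l)) ∧ HasL1Deriv 0 l (derivWithin a (Icc 0 l)) a2 ∧
      HasL1Deriv 0 l a2 v3 ∧ a2 =ᵐ[vol l] v2 ∧ ‖v2‖ ≤ C ∧ ‖v3‖ ≤ C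

variable {l b C : ℝ} {a : ℝ → ℝ}

theorem IsCoeff.nonneg (hl : 0 ≤ l) (h : IsCoeff l C a) : 0 ≤ C :=
  (norm_nonneg _).trans (h.bound 0 (left_mem_Icc.2 hl))

theorem mulL2_apply {a : ℝ → ℝ} (h : MemLp a ∞ (vol l)) (f : L2 l) :
    mulL2 l a f =ᵐ[vol l] fun s => a s • f s := by
  have e : mulL2 l a f = h.toLp a • f := by rw [mulL2, dif_pos h]; rfl
  rw [e]
  filter_upwards [Lp.coeFn_lpSMul (r := 2) (h.toLp a) f, h.coeFn_toLp] with s h1 h2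
  rw [h1, Pi.smul_apply', h2]

theorem norm_mulL2_le {a : ℝ → ℝ} (h : MemLp a ∞ (vol l)) (ha : ∀ s ∈ Icc 0 l, ‖a s‖ ≤ C)
    (f : L2 l) : ‖mulL2 l a f‖ ≤ C * ‖f‖ := by
  refine Lp.norm_le_mul_norm_of_ae_le_mul ?_
  filter_upwards [mulL2_apply h f, ae_vol_of_forall ha] with s h1 h2
  rw [h1, norm_smul]
  exact mul_le_mul_of_nonneg_right h2 (norm_nonneg _)

theorem IsCoeff.memLp (h : IsCoeff l C a) : MemLp a ∞ (vol l) := by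
  obtain ⟨a2, v2, v3, h0, h1, -⟩ := h.exists_deriv
  exact memLp_of_continuousOn h0.continuousOn ∞

theorem IsCoeff.memLp_deriv (h : IsCoeff l C a) :
    MemLp (derivWithin a (Icc 0 l)) ∞ (vol l) := by
  obtain ⟨a2, v2, v3, h0, h1, -⟩ := h.exists_deriv
  exact memLp_of_continuousOn h1.continuousOn ∞

/-- The operator `u ↦ ∂(a ∂u)`, written as `a' ∂u + a ∂²u`. -/
def divOp (l b : ℝ) (a : ℝ → ℝ) : H2 l b →ₗ[ℝ] L2 l :=
  mulL2 l (derivWithin a (Icc 0 l)) ∘ₗ H2.d1 l b + mulL2 l a ∘ₗ H2.d2 l b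

theorem IsCoeff.divOp_ae_eq (h : IsCoeff l C a) (u : H2 l b) {g1 g2 : ℝ → R3}
    (h1 : H2.d1 l b u =ᵐ[vol l] g1) (h2 : H2.d2 l b u =ᵐ[vol l] g2) :
    divOp l b a u =ᵐ[vol l] fun s => derivWithin a (Icc 0 l) s • g1 s + a s • g2 s := by
  have e : divOp l b a u = mulL2 l (derivWithin a (Icc 0 l)) (H2.d1 l b u)
    + mulL2 l a (H2.d2 l b u) := rfl
  rw [e]
  filter_upwards [Lp.coeFn_add (mulL2 l (derivWithin a (Icc 0 l)) (H2.d1 l b u))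
    (mulL2 l a (H2.d2 l b u)), mulL2_apply h.memLp (H2.d2 l b u),
    mulL2_apply h.memLp_deriv (H2.d1 l b u), h1, h2] with s k1 k2 k3 k4 k5
  rw [k1, Pi.add_apply, k2, k3, k4, k5]

variable [hl : Fact (0 < l)] [hb : Fact (0 < b)]

theorem IsCoeff.weakDeriv_divOp (h : IsCoeff l C a) (u : H2 l b) :
    IsWeakDeriv l 1 (mulL2 l a (H2.d1 l b u)) (divOp l b a u) := by
  obtain ⟨g0, g1, -, e1, d0, d1, -, -⟩ := H2.exists_rep hl.out u
  obtain ⟨a2, v2, v3, c0, c1, -⟩ := h.exists_deriv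
  refine ((c0.smul hl.out.le d1).isWeakDeriv hl.out.le).congr ?_
    (h.divOp_ae_eq u e1 .rfl).symm
  filter_upwards [mulL2_apply h.memLp (H2.d1 l b u), e1] with s k1 k2
  rw [k1, k2]

/-- Both sides equal -∫ a⟨∂u, ∂w⟩; the boundary terms carry the factor a, which vanishes at 0 and l.
-/
theorem IsCoeff.inner_divOp (h : IsCoeff l C a) (u w : H2 l b) :
    ⟪divOp l b a u, H2.toL2 l b w⟫_ℝ = ⟪H2.toL2 l b u, divOp l b a w⟫_ℝ := by
  have hl0 := hl.out.le
  obtain ⟨g0, g1, e0, e1, d0, d1, -, -⟩ := H2.exists_rep hl.out u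
  obtain ⟨h0, h1, k0, k1, q0, q1, -, -⟩ := H2.exists_rep hl.out w
  obtain ⟨a2, v2, v3, c0, c1, -⟩ := h.exists_deriv
  have hd := ((c0.smul hl0 d1).inner hl0 q0).sub (d0.inner hl0 (c0.smul hl0 q1))
  have hh := hd.eq l (right_mem_Icc.2 hl0)
  have e := L2_inner_sub_eq (h.divOp_ae_eq u e1 .rfl) k0 e0 (h.divOp_ae_eq w k1 .rfl) hl0
  have e' : ∀ s, (⟪derivWithin a (Icc 0 l) s • g1 s + a s • H2.d2 l b u s, h0 s⟫_ℝ
      + ⟪a s • g1 s, h1 s⟫_ℝ - (⟪g1 s, a s • h1 s⟫_ℝ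
      + ⟪g0 s, derivWithin a (Icc 0 l) s • h1 s + a s • H2.d2 l b w s⟫_ℝ)) =
      ⟪derivWithin a (Icc 0 l) s • g1 s + a s • H2.d2 l b u s, h0 s⟫_ℝ -
      ⟪g0 s, derivWithin a (Icc 0 l) s • h1 s + a s • H2.d2 l b w s⟫_ℝ := by
    intro s
    rw [real_inner_smul_left, real_inner_smul_right]
    ring
  simp only [e'] at hh
  rw [← e, h.left, h.right] at hh
  simp only [zero_smul, inner_zero_left, inner_zero_right, sub_zero, zero_add] at hh
  linarith

/-- A bound for the operators with a given coefficient bound. -/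
theorem exists_divOp_bound (l b : ℝ) [hl : Fact (0 < l)] [hb : Fact (0 < b)] :
    ∃ κ : ℝ, 0 ≤ κ ∧ ∀ C a, IsCoeff l C a → ∀ u : H2 l b, ‖divOp l b a u‖ ≤ C * κ * ‖u‖ := by
  refine ⟨bddConst l * inclConst l * (Real.sqrt b)⁻¹ + (Real.sqrt b)⁻¹, ?_, fun C a h u => ?_⟩
  · have := mul_nonneg (bddConst_nonneg l) (inclConst_nonneg l)
    positivity
  have hC := h.nonneg hl.out.le
  have h1 := norm_mulL2_le h.memLp_deriv h.bound_deriv (H2.d1 l b u)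
  have h2 := norm_mulL2_le h.memLp h.bound (H2.d2 l b u)
  have h3 := mul_le_mul_of_nonneg_left (H2.norm_d1_le u) hC
  have h4 := mul_le_mul_of_nonneg_left (H2.norm_d2_le u) hC
  calc ‖divOp l b a u‖ ≤ _ := norm_add_le _ _
    _ ≤ _ := add_le_add (h1.trans h3) (h2.trans h4)
    _ = _ := by ring

/-- The gain of regularity behind B'. Here a''' multiplies the bounded function ∂u, so a''' in L² is
enough; ∂(a∂u) and its derivative vanish at l because a, a' and ∂u do. -/
theorem exists_divOp_H4_bound (l b : ℝ) [hl : Fact (0 < l)] [Fact (0 < b)] :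
    ∃ κ : ℝ, 0 ≤ κ ∧ ∀ C a, IsCoeff l C a → ∀ u : H4 l b, ∃ w : H2 l b,
      H2.toL2 l b w = divOp l b a (H4.toH2 l b u) ∧
      ‖H2.d2 l b w‖ ≤ C * κ * ‖H4.d4 l b u‖ := by
  set i := inclConst l with hi
  have hi0 : 0 ≤ i := inclConst_nonneg l
  have hβ := bddConst_nonneg l
  have hl0 := hl.out.le
  have hm0 : (0 : ℝ) ∈ Icc 0 l := left_mem_Icc.2 hl0
  have hml : l ∈ Icc 0 l := right_mem_Icc.2 hl0
  -- The four summands bound a'''∂u, 3a''∂²u, 3a'∂³u and a∂⁴u, the terms of (a∂u)'''.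
  refine ⟨l * (l * i) + 3 * (l * i) + 3 * (bddConst l * i) + 1, by positivity, fun C a h u => ?_⟩
  have hC := h.nonneg hl0
  obtain ⟨g0, g1, g2, g3, -, e1, e2, d0, d1, d2, d3, z0, z1, z2, z3⟩ := H4.exists_rep hl.out u
  obtain ⟨a2, v2, v3, c0, c1, c2, ev2, hv2, hv3⟩ := h.exists_deriv
  set N := ‖H4.d4 l b u‖ with hN
  have hN0 : 0 ≤ N := norm_nonneg _
  have b3 : ∀ s ∈ Icc 0 l, ‖g3 s‖ ≤ i * N := fun s hs => d3.norm_le hl0 hm0 z3 .rfl hs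
  have b2 : ∀ s ∈ Icc 0 l, ‖g2 s‖ ≤ l * (i * N) := fun s hs => d2.norm_le_of_bound hm0 z2 b3 hs
  have b1 : ∀ s ∈ Icc 0 l, ‖g1 s‖ ≤ l * (l * (i * N)) :=
    fun s hs => d1.norm_le_of_bound hml z1 b2 hs
  obtain ⟨F1, eF1, nF1⟩ := exists_Lp_of_le (f := fun s => v3 s • g1 s) (v := v3)
    (D := l * (l * (i * N))) ((Lp.aestronglyMeasurable v3).smul d1.aestronglyMeasurable) (by
      filter_upwards [ae_vol_of_forall b1] with s hs
      rw [norm_smul, mul_comm]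
      exact mul_le_mul_of_nonneg_right hs (norm_nonneg _))
  obtain ⟨F2, eF2, nF2⟩ := exists_Lp_of_le (f := fun s => a2 s • g2 s) (v := v2)
    (D := l * (i * N)) (c2.aestronglyMeasurable.smul d2.aestronglyMeasurable) (by
      filter_upwards [ae_vol_of_forall b2, ev2] with s hs h2
      rw [norm_smul, mul_comm, h2]
      exact mul_le_mul_of_nonneg_right hs (norm_nonneg _))
  obtain ⟨F3, eF3, nF3⟩ := exists_Lp_of_bound (f := fun s => derivWithin a (Icc 0 l) s • g3 s)
    (D := C * (i * N)) (c1.aestronglyMeasurable.smul d3.aestronglyMeasurable) (by positivity) (by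
      filter_upwards [ae_vol_of_forall b3, ae_vol_of_forall h.bound_deriv] with s hs h2
      rw [norm_smul]
      exact mul_le_mul h2 hs (norm_nonneg _) hC)
  have nF4 := norm_mulL2_le h.memLp h.bound (H4.d4 l b u)
  have eF4 := mulL2_apply h.memLp (H4.d4 l b u)
  set F4 := mulL2 l a (H4.d4 l b u)
  have w0 := (c1.smul hl0 d1).add (c0.smul hl0 d2)
  have w1 := ((c2.smul hl0 d1).add (c1.smul hl0 d2)).add ((c1.smul hl0 d2).add (c0.smul hl0 d3))
  have w2 : HasL1Deriv 0 l (fun s => a2 s • g1 s + derivWithin a (Icc 0 l) s • g2 s +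
      (derivWithin a (Icc 0 l) s • g2 s + a s • g3 s)) (F1 + (3 : ℝ) • F2 + (3 : ℝ) • F3 + F4 : L2 l) := by
    refine w1.congr_vol hl0 ?_
    filter_upwards [eF1, eF2, eF3, eF4, Lp.coeFn_add (F1 + (3 : ℝ) • F2 + (3 : ℝ) • F3) F4,
      Lp.coeFn_add (F1 + (3 : ℝ) • F2) ((3 : ℝ) • F3), Lp.coeFn_add F1 ((3 : ℝ) • F2),
      Lp.coeFn_smul (3 : ℝ) F2, Lp.coeFn_smul (3 : ℝ) F3] with s k1 k2 k3 k4 k5 k6 k7 k8 k9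
    rw [k5, Pi.add_apply, k6, Pi.add_apply, k7, Pi.add_apply, k8, k9, Pi.smul_apply, Pi.smul_apply,
      k1, k2, k3, k4]
    module
  obtain ⟨hw, hw2⟩ := mem_H2bc_of_rep hl.out (h.divOp_ae_eq (H4.toH2 l b u) e1 e2) w0 w2
    (by simp [h.deriv_right, h.right]) (by simp [h.deriv_right, h.right, z1])
  refine ⟨(⟨_, hw⟩ : H2bc l), rfl, ?_⟩
  rw [H2.d2_eq (b := b) (⟨_, hw⟩ : H2bc l) hw2]
  have t1 := mul_le_mul_of_nonneg_left hv3 (show 0 ≤ l * (l * (i * N)) by positivity)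
  have t2 := mul_le_mul_of_nonneg_left hv2 (show 0 ≤ l * (i * N) by positivity)
  calc _ ≤ ‖F1‖ + ‖(3 : ℝ) • F2‖ + ‖(3 : ℝ) • F3‖ + ‖F4‖ := by
        refine (norm_add_le _ _).trans (add_le_add_left ?_ _)
        refine (norm_add_le _ _).trans (add_le_add_left ?_ _)
        exact norm_add_le _ _
    _ = ‖F1‖ + 3 * ‖F2‖ + 3 * ‖F3‖ + ‖F4‖ := by
        rw [norm_smul, norm_smul, Real.norm_of_nonneg (by norm_num : (0 : ℝ) ≤ 3)]
    _ ≤ _ := by nlinarith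

end Coefficients

/-! ### Weak measurability in separable Hilbert spaces -/

section Measurability
variable {H : Type*} [NormedAddCommGroup H] [InnerProductSpace ℝ H] [CompleteSpace H]

/-- Distinct members have distance √2 > 1, so balls of radius 1/2 around them are disjoint open
sets. -/
theorem Orthonormal.countable [SecondCountableTopology H] {ι : Type*} {e : ι → H}
    (he : Orthonormal ℝ e) : Countable ι := by
  refine Pairwise.countable_of_isOpen_disjoint (s := fun i => Metric.ball (e i) (1 / 2)) ?_
    (fun _ => Metric.isOpen_ball) fun i => Metric.nonempty_ball.2 (by norm_num)
  intro i j hij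
  refine Metric.ball_disjoint_ball ?_
  rw [dist_eq_norm]
  have h := norm_sub_sq_real (e i) (e j)
  rw [he.2 hij, he.1 i, he.1 j] at h
  nlinarith [norm_nonneg (e i - e j)]

/-- A weakly measurable function with values in a separable Hilbert space is measurable. -/
theorem aestronglyMeasurable_of_inner [SecondCountableTopology H] {α : Type*} [MeasurableSpace α]
    {μ : Measure α} {f : α → H} (h : ∀ z, AEStronglyMeasurable (fun t => ⟪z, f t⟫_ℝ) μ) :
    AEStronglyMeasurable f μ := by
  obtain ⟨w, e, -⟩ := exists_hilbertBasis ℝ H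
  have := Orthonormal.countable e.orthonormal
  refine aestronglyMeasurable_of_tendsto_ae (atTop : Filter (Finset w))
    (f := fun I t => ∑ i ∈ I, ⟪e i, f t⟫_ℝ • e i) (fun I => ?_) (ae_of_all _ fun t => ?_)
  · exact Finset.aestronglyMeasurable_fun_sum _ fun i _ => (h (e i)).smul_const (e i)
  · have := e.hasSum_repr (f t)
    simp only [e.repr_apply_apply] at this
    exact this

/-- Tested against z the family is t ↦ ∫ a(t,s)⟨z(s), f(s)⟩ ds, measurable by Fubini from joint
measurability of a. -/
theorem aestronglyMeasurable_mulL2 {l T : ℝ} {a : ℝ → ℝ → ℝ}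
    (ha : AEMeasurable (fun p : ℝ × ℝ => a p.1 p.2) (volume.restrict (Icc 0 T ×ˢ Icc 0 l)))
    (hb : ∀ t ∈ Icc 0 T, MemLp (a t) ∞ (vol l)) (f : L2 l) :
    AEStronglyMeasurable (fun t => mulL2 l (a t) f) (volume.restrict (Icc 0 T)) := by
  have : Fact ((2 : ℝ≥0∞) ≠ ⊤) := ⟨by norm_num⟩
  refine aestronglyMeasurable_of_inner fun z => ?_
  have h1 : AEStronglyMeasurable (fun p : ℝ × ℝ => a p.1 p.2)
      ((volume.restrict (Icc 0 T)).prod (vol l)) := by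
    rw [Measure.prod_restrict]
    exact ha.aestronglyMeasurable.mono_measure
      (Measure.restrict_mono (Set.prod_mono le_rfl Ioo_subset_Icc_self) le_rfl)
  have h2 : AEStronglyMeasurable (fun s => ⟪z s, f s⟫_ℝ) (vol l) :=
    (Lp.aestronglyMeasurable z).inner (Lp.aestronglyMeasurable f)
  have h3 := (h1.mul (h2.comp_snd (μ := volume.restrict (Icc 0 T)))).integral_prod_right'
  refine h3.congr ((ae_restrict_iff' measurableSet_Icc).2 (ae_of_all _ fun t ht => ?_))
  change _ = ⟪z, mulL2 l (a t) f⟫_ℝ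
  rw [L2.inner_def]
  refine integral_congr_ae ?_
  filter_upwards [mulL2_apply (hb t ht) f] with s hs
  rw [hs, real_inner_smul_right]
  rfl

end Measurability

/-! ### Uniform coefficient bounds for the tractive force -/

section Force
variable {l T : ℝ} {lam : ℝ → ℝ → ℝ}

theorem norm_toLp_le {E : Type*} [NormedAddCommGroup E] [InnerProductSpace ℝ E] {v : ℝ → E}
    (hv : MemLp v 2 (vol l)) {C : ℝ} (hC : 0 ≤ C) (h : ∫ s, ‖v s‖ ^ 2 ∂(vol l) ≤ C ^ 2) :
    ‖hv.toLp v‖ ≤ C := by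
  refine le_of_sq_le_sq ?_ hC
  rw [← real_inner_self_eq_norm_sq, L2.inner_def]
  refine le_trans (le_of_eq (integral_congr_ae ?_)) h
  filter_upwards [hv.coeFn_toLp] with s hs
  rw [hs, real_inner_self_eq_norm_sq]

theorem IsTractiveForce.exists_isCoeff (hl : 0 < l) (h : IsTractiveForce l T lam) :
    ∃ C, ∀ t ∈ Icc 0 T, IsCoeff l C (lam t) := by
  obtain ⟨D, hD, hb⟩ := h.bounded
  have hi := inclConst_nonneg l
  have hm0 : (0 : ℝ) ∈ Icc 0 l := left_mem_Icc.2 hl.le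
  -- The summands bound the L² norms of ∂²λ and ∂³λ, then sup |∂λ| and sup |λ|, the last two by
  -- integrating from 0, where λ and ∂λ vanish.
  refine ⟨D + inclConst l * D + l * (inclConst l * D), fun t ht => ?_⟩
  obtain ⟨v, hv, hsum⟩ := hb t ht
  have hk : ∀ k ≤ 3, ∫ s, ‖v k s‖ ^ 2 ∂(vol l) ≤ D ^ 2 := fun k hk =>
    (Finset.single_le_sum (f := fun k => ∫ s, ‖v k s‖ ^ 2 ∂(vol l))
      (fun _ _ => integral_nonneg fun _ => sq_nonneg _)
      (Finset.mem_range.2 (Nat.lt_succ_of_le hk))).trans hsum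
  obtain ⟨m1, w1⟩ := hv 1 (by norm_num)
  obtain ⟨m2, w2⟩ := hv 2 (by norm_num)
  obtain ⟨m3, w3⟩ := hv 3 (by norm_num)
  have i1 := integrable_of_memLp_two m1
  have i2 := integrable_of_memLp_two m2
  have i3 := integrable_of_memLp_two m3
  obtain ⟨g1, e1, c1⟩ := (w1.sub_index (k := 1) w2).exists_hasL1Deriv hl i1 i2
  obtain ⟨g2, e2, c2⟩ := (w2.sub_index (k := 1) w3).exists_hasL1Deriv hl i2 i3
  have c0 : HasL1Deriv 0 l (lam t) g1 :=
    (HasL1Deriv.of_isWeakDeriv hl (h.continuousOn t ht) i1 w1).congr_vol hl.le e1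
  have hd : ∀ s ∈ Icc 0 l, g1 s = derivWithin (lam t) (Icc 0 l) s := fun s hs =>
    ((c0.hasDerivWithinAt c1.continuousOn hs).derivWithin (uniqueDiffOn_Icc hl s hs)).symm
  have d1 : HasL1Deriv 0 l (derivWithin (lam t) (Icc 0 l)) g2 :=
    (c1.congr hl.le hd .rfl).congr_vol hl.le e2
  have n2 := norm_toLp_le m2 hD (hk 2 (by norm_num))
  have n3 := norm_toLp_le m3 hD (hk 3 (by norm_num))
  have b1 : ∀ s ∈ Icc 0 l, ‖derivWithin (lam t) (Icc 0 l) s‖ ≤ inclConst l * D := fun s hs =>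
    (d1.norm_le hl.le hm0 (h.deriv_left t ht) (e2.symm.trans m2.coeFn_toLp.symm) hs).trans
      (mul_le_mul_of_nonneg_left n2 hi)
  have d0 : HasL1Deriv 0 l (lam t) (derivWithin (lam t) (Icc 0 l)) :=
    c0.congr_vol hl.le (ae_vol_of_forall hd)
  have b0 : ∀ s ∈ Icc 0 l, ‖lam t s‖ ≤ l * (inclConst l * D) := fun s hs =>
    d0.norm_le_of_bound hm0 (h.left t ht) b1 hs
  have p1 : 0 ≤ inclConst l * D := mul_nonneg hi hD
  have p2 : 0 ≤ l * (inclConst l * D) := mul_nonneg hl.le p1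
  exact ⟨fun s hs => (b0 s hs).trans (by linarith), fun s hs => (b1 s hs).trans (by linarith),
    h.left t ht, h.right t ht, h.deriv_right t ht, g2, m2.toLp _, m3.toLp _, d0, d1,
    c2.congr_vol hl.le m3.coeFn_toLp.symm, e2.symm.trans m2.coeFn_toLp.symm,
    n2.trans (by linarith), n3.trans (by linarith)⟩

end Force

/-! ### The inverse of L₀ and the perturbation on the energy space -/

section Energy
variable (l b : ℝ) [hl : Fact (0 < l)] [hb : Fact (0 < b)]

variable {l b} in
/-- The operator with components `F` and `G`. -/
def Energy.pair (F : Energy l b →L[ℝ] H2 l b) (G : Energy l b →L[ℝ] L2 l) :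
    Energy l b →L[ℝ] Energy l b :=
  ((WithLp.prodContinuousLinearEquiv 2 ℝ (H2 l b) (L2 l)).symm :
    H2 l b × L2 l →L[ℝ] Energy l b) ∘L F.prod G

/-- The inverse of `L₀`. -/
def invL0 : Energy l b →L[ℝ] Energy l b :=
  Energy.pair (-(invBiharm l b ∘L WithLp.sndL 2 ℝ (H2 l b) (L2 l)))
    (H2.toL2L l b ∘L WithLp.fstL 2 ℝ (H2 l b) (L2 l))

/-- The inverse of `L₀` as an operator from `H` to `𝒟`. -/
def invL0Dom : Energy l b →L[ℝ] Dom l b :=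
  ((WithLp.prodContinuousLinearEquiv 2 ℝ (H4 l b) (H2 l b)).symm :
    H4 l b × H2 l b →L[ℝ] Dom l b) ∘L
    (-(((H4.equiv l b).symm : L2 l →L[ℝ] H4 l b) ∘L WithLp.sndL 2 ℝ (H2 l b) (L2 l))).prod
      (WithLp.fstL 2 ℝ (H2 l b) (L2 l))

variable {l b}

theorem invL0_apply (x : Energy l b) :
    invL0 l b x = WithLp.toLp 2 (-invBiharm l b x.snd, H2.toL2 l b x.fst) := rfl

theorem invL0_fst (x : Energy l b) : (invL0 l b x).fst = -invBiharm l b x.snd := rfl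

theorem invL0_snd (x : Energy l b) : (invL0 l b x).snd = H2.toL2 l b x.fst := rfl

theorem incl_invL0Dom (x : Energy l b) : Dom.incl l b (invL0Dom l b x) = invL0 l b x := by
  rw [invL0_apply, invBiharm_eq, ← map_neg]
  rfl

theorem mem_domSub_iff (w : Energy l b) : w ∈ domSub l b ↔ ∃ x, invL0 l b x = w := by
  constructor
  · intro h
    obtain ⟨h1, h2⟩ : H2.toL2 l b w.fst ∈ H4bc l ∧ w.snd ∈ H2bc l := h
    obtain ⟨u, hu⟩ : ∃ u : H4 l b, H4.toH2 l b u = w.fst := ⟨(⟨_, h1⟩ : H4bc l), rfl⟩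
    obtain ⟨v, hv⟩ : ∃ v : H2 l b, H2.toL2 l b v = w.snd := ⟨(⟨_, h2⟩ : H2bc l), rfl⟩
    refine ⟨WithLp.toLp 2 (v, -(b • H4.d4 l b u)), ?_⟩
    change WithLp.toLp 2 (-invBiharm l b (-(b • H4.d4 l b u)), H2.toL2 l b v) = w
    rw [map_neg, invBiharm_d4, neg_neg, hu, hv]
    rfl
  · rintro ⟨x, rfl⟩
    rw [← incl_invL0Dom]
    exact ⟨Subtype.prop (p := (· ∈ H4bc l)) (invL0Dom l b x).fst,
      Subtype.prop (p := (· ∈ H2bc l)) (invL0Dom l b x).snd⟩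

theorem toPair_invL0 (x : Energy l b) (h : invL0 l b x ∈ domSub l b) :
    domSub.toPair l b ⟨invL0 l b x, h⟩ = (-(H4.equiv l b).symm x.snd, x.fst) := by
  refine Prod.ext (H4.toH2_injective l b ?_) rfl
  rw [map_neg, ← invBiharm_eq]
  rfl

theorem d4_equiv_symm (f : L2 l) : b • H4.d4 l b ((H4.equiv l b).symm f) = f :=
  (H4.equiv l b).apply_symm_apply f

theorem L0_invL0 (x : Energy l b) (h : invL0 l b x ∈ (L0 l b).domain) :
    L0 l b ⟨invL0 l b x, h⟩ = x := by
  have hx : invL0 l b x ∈ domSub l b := h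
  change WithLp.toLp 2 ((domSub.toPair l b ⟨invL0 l b x, hx⟩).2,
    -(b • H4.d4 l b (domSub.toPair l b ⟨invL0 l b x, hx⟩).1)) = x
  rw [toPair_invL0]
  simp only [map_neg, smul_neg, neg_neg, d4_equiv_symm]
  rfl

theorem exists_invL0_of_mem_sqDomain {u : Energy l b} (hu : u ∈ sqDomain (L0 l b)) :
    ∃ y, invL0 l b (invL0 l b y) = u := by
  obtain ⟨h, h'⟩ := hu
  obtain ⟨x, rfl⟩ := (mem_domSub_iff u).1 h
  rw [L0_invL0] at h'
  obtain ⟨y, rfl⟩ := (mem_domSub_iff x).1 h'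
  exact ⟨y, rfl⟩

theorem invL0_injective : Function.Injective (invL0 l b) := by
  intro x y h
  rw [invL0_apply, invL0_apply] at h
  have h' := congrArg WithLp.ofLp h
  simp only [Prod.mk.injEq, neg_inj] at h'
  have h1 := invBiharm_injective l b h'.1
  have h2 := H2.toL2_injective l b h'.2
  exact congrArg (WithLp.toLp 2) (Prod.ext h2 h1)

/-- The off-diagonal entries are the inclusion H^{2,2}_bc → L² and minus its adjoint. -/
theorem star_invL0 : star (invL0 l b) = -invL0 l b := by
  rw [ContinuousLinearMap.star_eq_adjoint]
  refine ((ContinuousLinearMap.eq_adjoint_iff _ _).2 fun x y => ?_).symm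
  rw [neg_apply, inner_neg_left, WithLp.prod_inner_apply, WithLp.prod_inner_apply]
  change -(⟪(invL0 l b x).fst, y.fst⟫_ℝ + ⟪(invL0 l b x).snd, y.snd⟫_ℝ) =
    ⟪x.fst, (invL0 l b y).fst⟫_ℝ + ⟪x.snd, (invL0 l b y).snd⟫_ℝ
  simp only [invL0_fst, invL0_snd, inner_neg_left, inner_neg_right, inner_invBiharm_left,
    inner_invBiharm_right]
  ring

/-- The perturbation of `L₀` given by an operator `M : H^{2,2}_bc → L²`. -/
def lowerOp (M : H2 l b →L[ℝ] L2 l) : Energy l b →L[ℝ] Energy l b :=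
  Energy.pair 0 (M ∘L WithLp.fstL 2 ℝ (H2 l b) (L2 l))

theorem lowerOp_apply (M : H2 l b →L[ℝ] L2 l) (x : Energy l b) :
    lowerOp M x = WithLp.toLp 2 (0, M x.fst) := rfl

/-- The operator in `H` with the only component `-N : L² → H^{2,2}_bc`. -/
def upperOp (N : L2 l →L[ℝ] H2 l b) : Energy l b →L[ℝ] Energy l b :=
  Energy.pair (-(N ∘L WithLp.sndL 2 ℝ (H2 l b) (L2 l))) 0

theorem upperOp_apply (N : L2 l →L[ℝ] H2 l b) (x : Energy l b) :
    upperOp N x = WithLp.toLp 2 (-N x.snd, 0) := rfl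

theorem norm_lowerOp_le (M : H2 l b →L[ℝ] L2 l) : ‖lowerOp M‖ ≤ ‖M‖ := by
  refine ContinuousLinearMap.opNorm_le_bound _ (norm_nonneg M) fun x => ?_
  rw [lowerOp_apply, WithLp.norm_toLp_snd]
  exact (M.le_opNorm _).trans
    (mul_le_mul_of_nonneg_left (WithLp.norm_fst_le _ x) (norm_nonneg _))

theorem norm_upperOp_le (N : L2 l →L[ℝ] H2 l b) : ‖upperOp N‖ ≤ ‖N‖ := by
  refine ContinuousLinearMap.opNorm_le_bound _ (norm_nonneg N) fun x => ?_
  rw [upperOp_apply, WithLp.norm_toLp_fst, norm_neg]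
  exact (N.le_opNorm _).trans
    (mul_le_mul_of_nonneg_left (WithLp.norm_snd_le _ x) (norm_nonneg _))

/-- `∂(a ∂·)` as a bounded operator `H^{2,2}_bc → L²`, and the bounded operator `L² → H^{2,2}_bc`
obtained by composing it with the inverse of `b ∂⁴`. -/
theorem exists_divOpL (l b : ℝ) [hl : Fact (0 < l)] [hb : Fact (0 < b)] :
    ∃ κ : ℝ, ∀ C a, IsCoeff l C a → ∃ (M : H2 l b →L[ℝ] L2 l) (N : L2 l →L[ℝ] H2 l b),
      (∀ u, M u = divOp l b a u) ∧ (∀ g, H2.toL2 l b (N g) = M (invBiharm l b g)) ∧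
      ‖M‖ ≤ C * κ ∧ ‖N‖ ≤ C * κ := by
  obtain ⟨κ, hκ, hM⟩ := exists_divOp_bound l b
  obtain ⟨ν, hν, hN⟩ := exists_divOp_H4_bound l b
  have hb' : 0 ≤ Real.sqrt b * b⁻¹ := mul_nonneg (Real.sqrt_nonneg _) (inv_nonneg.2 hb.out.le)
  -- √b converts ‖∂²w‖ into the norm of H^{2,2}_bc, and b⁻¹ comes from ∂⁴u = b⁻¹g.
  refine ⟨κ + ν * (Real.sqrt b * b⁻¹), fun C a h => ?_⟩
  have hC := h.nonneg hl.out.le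
  have p1 := mul_nonneg hC hκ
  have p2 : 0 ≤ C * (ν * (Real.sqrt b * b⁻¹)) := by positivity
  choose w hw hwn using fun g => hN C a h ((H4.equiv l b).symm g)
  have hlin : IsLinearMap ℝ w :=
    ⟨fun f g => H2.toL2_injective l b (by simp [hw]),
      fun c f => H2.toL2_injective l b (by simp [hw])⟩
  refine ⟨(divOp l b a).mkContinuous (C * κ) (hM C a h),
    hlin.mk'.mkContinuous (C * (ν * (Real.sqrt b * b⁻¹))) fun g => ?_, fun u => rfl, fun g => ?_,
    (LinearMap.mkContinuous_norm_le _ p1 _).trans (by linarith),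
    (LinearMap.mkContinuous_norm_le _ p2 _).trans (by linarith)⟩
  · have e : ‖H4.d4 l b ((H4.equiv l b).symm g)‖ = b⁻¹ * ‖g‖ := by
      conv_rhs => rw [← d4_equiv_symm (b := b) g, norm_smul, Real.norm_of_nonneg hb.out.le,
        inv_mul_cancel_left₀ hb.out.ne']
    have := mul_le_mul_of_nonneg_left (hwn g) (Real.sqrt_nonneg b)
    rw [e] at this
    change ‖w g‖ ≤ _
    rw [H2.norm_eq]
    linarith
  · rw [invBiharm_eq]
    exact hw g

/-- For such a the weak derivative ∂(a∂u) always exists in L², so the extra condition in the domain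
of `beamOp` is void and the domain is the range of `invL0`. -/
theorem isInverseAdd_beamOp {C : ℝ} {a : ℝ → ℝ} (h : IsCoeff l C a) {M : H2 l b →L[ℝ] L2 l}
    (hM : ∀ u, M u = divOp l b a u) : IsInverseAdd (invL0 l b) (lowerOp M) (beamOp l b a) := by
  refine ⟨fun w => ⟨fun hw => (mem_domSub_iff w).1 hw.1, fun hw =>
    ⟨(mem_domSub_iff w).2 hw, divOp l b a w.fst, h.weakDeriv_divOp w.fst⟩⟩, fun x hx => ?_⟩
  rw [beamOp_apply, toPair_invL0, weakDeriv_eq _ (h.weakDeriv_divOp _), ← hM, lowerOp_apply]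
  simp only [map_neg, smul_neg, sub_neg_eq_add, d4_equiv_symm]
  refine congrArg (WithLp.toLp 2) (Prod.ext (add_zero _).symm (add_comm _ _))

variable {T : ℝ} {lam : ℝ → ℝ → ℝ}

/-- The bridge to the abstract theory: measurability comes from that of λ and ∂λ, the relation with
B' from the operator N of `exists_divOpL`, and the symmetry from `IsCoeff.inner_divOp`. -/
theorem IsTractiveForce.exists_isPerturbation (h : IsTractiveForce l T lam) :
    ∃ (D : ℝ) (M : ℝ → H2 l b →L[ℝ] L2 l) (N : ℝ → L2 l →L[ℝ] H2 l b),
      IsPerturbation T D (invL0 l b) (fun t => lowerOp (M t)) (fun t => upperOp (N t)) ∧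
      ∀ t ∈ Icc 0 T, IsInverseAdd (invL0 l b) (lowerOp (M t)) (beamOp l b (lam t)) := by
  obtain ⟨C, hC⟩ := h.exists_isCoeff hl.out
  obtain ⟨κ, hκ⟩ := exists_divOpL l b
  have : ∀ t, ∃ (M : H2 l b →L[ℝ] L2 l) (N : L2 l →L[ℝ] H2 l b), t ∈ Icc 0 T →
      (∀ u, M u = divOp l b (lam t) u) ∧ (∀ g, H2.toL2 l b (N g) = M (invBiharm l b g)) ∧
      ‖M‖ ≤ C * κ ∧ ‖N‖ ≤ C * κ := fun t => by
    by_cases ht : t ∈ Icc 0 T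
    · obtain ⟨M, N, hMN⟩ := hκ C _ (hC t ht)
      exact ⟨M, N, fun _ => hMN⟩
    · exact ⟨0, 0, fun h => absurd h ht⟩
  choose M N hMN using this
  refine ⟨C * κ, M, N, ⟨star_invL0, invL0_injective, ⟨fun t ht => (norm_lowerOp_le _).trans
    (hMN t ht).2.2.1, fun x => ?_⟩, fun t ht => (norm_upperOp_le _).trans (hMN t ht).2.2.2,
    fun t ht x => ?_, fun t ht x y => ?_⟩, fun t ht => isInverseAdd_beamOp (hC t ht) (hMN t ht).1⟩
  · have e1 := aestronglyMeasurable_mulL2 h.measurable_deriv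
      (fun t ht => (hC t ht).memLp_deriv) (H2.d1 l b x.fst)
    have e2 := aestronglyMeasurable_mulL2 h.measurable (fun t ht => (hC t ht).memLp)
      (H2.d2 l b x.fst)
    have e3 := ((WithLp.prodContinuousLinearEquiv 2 ℝ (H2 l b) (L2 l)).symm.continuous.comp
      (Continuous.prodMk_right (0 : H2 l b))).comp_aestronglyMeasurable (e1.add e2)
    refine e3.congr ((ae_restrict_iff' measurableSet_Icc).2 (ae_of_all _ fun t ht => ?_))
    simp only [lowerOp_apply, (hMN t ht).1]
    rfl
  · rw [lowerOp_apply, invL0_fst, invL0_apply, upperOp_apply]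
    refine congrArg (WithLp.toLp 2) (Prod.ext ?_ ?_)
    · change 0 = -invBiharm l b 0
      rw [map_zero, neg_zero]
    · change M t (-invBiharm l b x.snd) = H2.toL2 l b (-N t x.snd)
      rw [map_neg, map_neg, (hMN t ht).2.1]
  · rw [WithLp.prod_inner_apply, WithLp.prod_inner_apply]
    change ⟪(invL0 l b x).fst, 0⟫_ℝ + ⟪(invL0 l b x).snd, M t y.fst⟫_ℝ =
      -(⟪-invBiharm l b (M t x.fst), y.fst⟫_ℝ + ⟪H2.toL2 l b 0, y.snd⟫_ℝ)
    rw [invL0_snd, map_zero, inner_zero_left, inner_zero_right, zero_add, add_zero, inner_neg_left,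
      neg_neg, inner_invBiharm_left, (hMN t ht).1, (hMN t ht).1]
    exact ((hC t ht).inner_divOp _ _).symm

end Energy

/-! ### Indefinite integrals and the space C_w^1 -/

section Regularity

theorem IsBddFamily.memLp {E : Type*} [NormedAddCommGroup E] [NormedSpace ℝ E] {T M t : ℝ}
    {C : ℝ → E →L[ℝ] E} (hC : IsBddFamily T M C) {w : ℝ → E} (hw : ContinuousOn w (Icc 0 T))
    (ht : t ≤ T) (p : ℝ≥0∞) : MemLp (fun r => C r (w r)) p (vol t) := by
  obtain ⟨D, hD⟩ := isCompact_Icc.exists_bound_of_continuousOn hw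
  have hsub : Ioo 0 t ⊆ Icc 0 T := fun r hr => ⟨hr.1.le, hr.2.le.trans ht⟩
  refine MemLp.of_bound ((aestronglyMeasurable_family_apply hC.measurable
    (hw.aestronglyMeasurable measurableSet_Icc)).mono_measure (Measure.restrict_mono hsub le_rfl))
    (M * D) ?_
  refine (ae_restrict_iff' measurableSet_Ioo).2 (ae_of_all _ fun r hr => ?_)
  exact ((C r).le_opNorm _).trans (mul_le_mul (hC.norm_le r (hsub hr)) (hD r (hsub hr))
    (norm_nonneg _) ((norm_nonneg _).trans (hC.norm_le r (hsub hr))))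

variable {E K : Type*} [NormedAddCommGroup E] [NormedSpace ℝ E] [CompleteSpace E]
  [NormedAddCommGroup K] [InnerProductSpace ℝ K] {T : ℝ} {f f' : ℝ → E}

theorem HasL1Deriv.isCw1Deriv (hT : 0 ≤ T) (h : HasL1Deriv 0 T f f') (hf : MemLp f' 2 (vol T))
    (P : E →L[ℝ] K) : IsCw1Deriv T (fun r => P (f r)) (fun r => P (f' r)) := by
  refine ⟨P.comp_memLp' hf, fun v => ?_⟩
  have := (h.clm (innerSL ℝ v ∘L P)).isWeakDeriv hT
  simpa only [ContinuousLinearMap.comp_apply, innerSL_apply_apply, real_inner_comm v] using this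

theorem HasL1Deriv.memCw1 (hT : 0 ≤ T) (h : HasL1Deriv 0 T f f') (hf : MemLp f' 2 (vol T))
    (P : E →L[ℝ] K) : MemCw1 T (fun r => P (f r)) := by
  have hd := h.isCw1Deriv hT hf P
  have hc := h.continuousOn
  have h0 : MemLp (fun r => P (f r)) 2 (vol T) :=
    memLp_of_continuousOn (P.continuous.comp_continuousOn hc) 2
  refine ⟨h0, fun v => ⟨h0.inner_const v, fun k hk => ?_⟩, _, hd⟩
  interval_cases k
  · exact ⟨_, h0.inner_const v, isWeakDeriv_zero_of_ae_eq .rfl⟩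
  · exact ⟨_, hd.1.inner_const v, hd.2 v⟩

end Regularity

end Beam
end

/-! ### The beam equation -/

theorem mainTheorem8 (l b T : ℝ) [Fact (0 < l)] [Fact (0 < b)] (hT : 0 < T)
    (lam : ℝ → ℝ → ℝ) (hlam : Beam.IsTractiveForce l T lam) :
    (∃ U : ℝ → ℝ → Beam.Energy l b →L[ℝ] Beam.Energy l b,
      Beam.IsAlmostStrongEvolutionSystem T (fun t => Beam.beamOp l b (lam t))
        (Beam.domSub l b) U) ∧
    ∀ U : ℝ → ℝ → Beam.Energy l b →L[ℝ] Beam.Energy l b,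
      Beam.IsAlmostStrongEvolutionSystem T (fun t => Beam.beamOp l b (lam t))
        (Beam.domSub l b) U →
      ∀ u ∈ Beam.sqDomain (Beam.L0 l b), ∀ t ∈ Set.Icc 0 T,
        ∃ ρ ρ' : ℝ → Beam.Dom l b,
          (∀ τ ∈ Set.Icc 0 t, Beam.Dom.incl l b (ρ τ) = ContinuousLinearMap.adjoint (U t τ) u) ∧
          Beam.MemCw1 t ρ ∧ Beam.IsCw1Deriv t ρ ρ' ∧
          ∀ τ ∈ Set.Icc 0 t,
            ∃ h : Beam.Dom.incl l b (ρ τ) ∈ (Beam.beamOp l b (lam τ)).adjoint.domain,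
              Beam.Dom.incl l b (ρ' τ) =
                -(Beam.beamOp l b (lam τ)).adjoint ⟨Beam.Dom.incl l b (ρ τ), h⟩ := by
  obtain ⟨D, M, N, hP, hA⟩ := hlam.exists_isPerturbation (b := b)
  refine ⟨Beam.exists_evolutionSystem hT.le hP hA Beam.mem_domSub_iff, fun U hU u hu t ht => ?_⟩
  obtain ⟨y, rfl⟩ := Beam.exists_invL0_of_mem_sqDomain hu
  obtain ⟨p, hp, hpc, hd⟩ := Beam.exists_adjoint_eq hT.le hP hA Beam.mem_domSub_iff hU ht y
  have hd' := hd.mono ht.1 le_rfl ht.2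
  have hm : MemLp (fun τ => p τ + Beam.invL0 l b (Beam.upperOp (N τ) (p τ))) 2 (Beam.vol t) :=
    (Beam.memLp_of_continuousOn (hpc.mono (Set.Icc_subset_Icc_right ht.2)) 2).add
      ((Beam.invL0 l b).comp_memLp' (hP.bdd'.memLp hpc ht.2 2))
  -- ϱ = K²p is written with the outer K as a bounded operator H → 𝒟, so that the derivative of Kp
  -- in H becomes a derivative of ϱ in 𝒟.
  refine ⟨fun τ => Beam.invL0Dom l b (Beam.invL0 l b (p τ)),
    fun τ => Beam.invL0Dom l b (p τ + Beam.invL0 l b (Beam.upperOp (N τ) (p τ))),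
    fun τ hτ => ?_, hd'.memCw1 ht.1 hm _, hd'.isCw1Deriv ht.1 hm _, fun τ hτ => ?_⟩
  · rw [Beam.incl_invL0Dom, hp τ hτ]
  · have hτT : τ ∈ Set.Icc 0 T := ⟨hτ.1, hτ.2.trans ht.2⟩
    simp only [Beam.incl_invL0Dom]
    obtain ⟨h, he⟩ := (hA τ hτT).adjoint_apply hP hτT (p τ)
    exact ⟨h, by rw [he, neg_neg]⟩
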